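/- **Theorem 2.4 (Main Theorem).** Let $k$ be a commutative ring with $1\neq 0$, let $\alpha,\beta\in k$ and $A=k[u,v]$. *The algebras and the trace.* Let $B_n$ be the braid group on $n$ strings with standard generators $\sigma_1,\dots,\sigma_{n-1}$. Let $AK_n=K_n(\alpha,\beta;A)$ be the quotient of the group algebra $AB_n$ by the relation $\sigma_1^3-\alpha\sigma_1^2+\beta\sigma_1-1=0$ (if $n\ge 2$) and, if $n\ge 3$, by the relation $$ \begin{aligned} y\bar xy={}&2\alpha-\beta^2-(x+y)-(\alpha^2-\beta)(\bar x+\bar y)+\beta(xy+yx)+\alpha(x\bar y+y\bar x+\bar xy+\bar yx)\\ &+(\alpha\beta-1)(\bar x\bar y+\bar y\bar x)-\alpha xyx-(\bar xyx+x\bar yx+xy\bar x)-\beta(\bar x\bar yx+x\bar y\bar x)+(\alpha-\beta^2)\bar x\bar y\bar x \end{aligned}\tag{1} $$ with $x,\bar x,y,\bar y=\sigma_1,\sigma_1^{-1},\sigma_2,\sigma_2^{-1}$. Let $AK_\infty=\varinjlim AK_n$ with respect to the morphisms induced by the standard embeddings $B_n\subset B_{n+1}$, and let $s_i$ be the image of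 $\sigma_i$. Let $M$ be the quotient of the $A$-module $AK_\infty$ by the submodule generated by all $xy-yx$, $xs_n-ux$, $xs_n^{-1}-vx$ with $n\ge 1$ and $x,y$ in the image of $AK_n$ (so the projection $AK_\infty\to M$ is the universal Markov trace), and let $I\subset A$ be the annihilator of $M$. *Reductions.* Let $F_n^+$ be the free monoid of all words in $x_1^{\pm1},\dots,x_{n-1}^{\pm1}$ (not necessarily reduced), $F_\infty^+=\bigcup_n F_n^+$, and let $AF_n^+$, $AF_\infty^+$ be the corresponding free associative $A$-algebras. The basic replacements are, for $i\ge1$ and arbitrary signs unless indicated: - (i) $x_ix_i^{-1}\to1$, $x_i^{-1}x_i\to 1$; - (ii) $x_i^2\to\alpha x_i-\beta+x_i^{-1}$; - (iii) $x_i^{-2}\to\beta x_i^{-1}-\alpha+x_i$; - (iv) $x_{i+1}^{\varepsilon_1}x_i^{\varepsilon_2}x_{i+1}^{\varepsilon_3}\to x_i^{\varepsilon_3}x_{i+1}^{\varepsilon_2}x_i^{\varepsilon_1}$ if $\varepsilon_2\in\{\varepsilon_1,\varepsilon_3\}$; - (v) $x_{i+1}x_i^{-1}x_{i+1}\to$ the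 right-hand side of (1) with $x,\bar x,y,\bar y=x_i,x_i^{-1},x_{i+1},x_{i+1}^{-1}$; - (vi) $x_{i+1}^{-1}x_ix_{i+1}^{-1}\to$ the right-hand side of (1) with $\alpha,\beta$ interchanged and $x,\bar x,y,\bar y=x_i^{-1},x_i,x_{i+1}^{-1},x_{i+1}$; - (vii) $x_{i+1}^{\varepsilon_1}x_i^{\varepsilon_2}Wx_{i+1}^{\varepsilon_3}\to VW$ if $x_{i+1}^{\varepsilon_1}x_i^{\varepsilon_2}x_{i+1}^{\varepsilon_3}\to V$ is one of (iv)–(vi) and $W$ is a word in $x_1^{\pm1},\dots,x_{i-1}^{\pm1}$; - (viii) $x_j^{\varepsilon_1}x_i^{\varepsilon_2}\to x_i^{\varepsilon_2}x_j^{\varepsilon_1}$ if $j>i+1$. An elementary reduction of a word is $BUC\to BVC$ with words $B,C$ and a basic replacement $U\to V$; an elementary reduction of an element of $AF_\infty^+$ replaces one word, occurring in it with a nonzero coefficient, by an elementary reduction of this word. A word, or an element of $AF_\infty^+$, is reduced if no elementary reduction applies to it. Let $AF_n^{\rm red}$ be the $A$-span of the set $F_n^{\rm red}$ of the reduced words in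 $F_n^+$. For every word $X$ choose arbitrarily a finite sequence of elementary reductions from $X$ to a reduced element, and call this element $\mathbf r(X)$; extend $\mathbf r$ $A$-linearly to $AF_\infty^+$. *Markov reductions.* A word in $F_n^{\rm red}$ contains at most one letter $x_{n-1}^{\pm1}$. For $n\ge2$ let $\tau_n:AF_n^+\to AF_{n-1}^{\rm red}$ be the $A$-linear map which on reduced words is given by $\tau_n(X)=X$, $\tau_n(Xx_{n-1}Y)=u\,\mathbf r(XY)$, $\tau_n(Xx_{n-1}^{-1}Y)=v\,\mathbf r(XY)$ with $X,Y\in F_{n-1}^+$, and in general by $\tau_n(X)=\tau_n(\mathbf r(X))$. Put $\tau=\tau_2\circ\dots\circ\tau_n:AF_n^+\to AF_1^{\rm red}=A$. *The modules $J_4$ and $L$.* Let $\operatorname{sh}$ be the endomorphism $x_i^{\pm1}\mapsto x_{i+1}^{\pm1}$ of $AF_\infty^+$. Let $S_i$ be the set consisting of the empty word $1$ and of all words $x_i^{\pm1}x_{i-1}^{\pm1}\cdots x_j^{\pm1}$, $1\le j\le i$, with independent signs. For $X\in S_4$ and $Y\in AF_4^{\rm red}$ put $\rho_X(Y)=\tau_5(X\operatorname{sh}Y)$.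 Let $J_4$ be the smallest submodule of $AF_4^{\rm red}$ such that - (J1) $\mathbf r(\mathbf r(X_3X_2)X_1)-\mathbf r(X_3\mathbf r(X_2X_1))\in J_4$ for all $X_j\in\operatorname{sh}^{3-j}S_j\setminus\{1\}$, $j=1,2,3$; - (J2) $\rho_X(J_4)\subset J_4$ for all $X\in S_4$. Let $N=AF_2^{\rm red}\otimes_AAF_2^{\rm red}$. Define $A$-linear maps $\tau_N:N\to A$ and $\rho_\delta:N\to N$, $\delta=(\delta_1,\delta_2)\in\{-1,0,1\}^2$, by $$\tau_N(x_1^{\varepsilon_1}\otimes x_1^{\varepsilon_2})=\tau(x_1^{\varepsilon_1}x_1^{\varepsilon_2}),\qquad \rho_\delta(x_1^{\varepsilon_1}\otimes x_1^{\varepsilon_2})=x_1^{\delta_1}\otimes\tau_3(x_2^{\varepsilon_1}x_1^{\delta_2}x_2^{\varepsilon_2}),\qquad \varepsilon_1,\varepsilon_2\in\{-1,0,1\}.$$ Let $L$ be the smallest submodule of $N$ such that - (L1) $\tau_3(x_2^{\varepsilon_1}x_1^{\varepsilon_2}x_2^{\varepsilon_3})\otimes x_1^{\varepsilon_4}-x_1^{\varepsilon_2}\otimes\tau_3(x_2^{\varepsilon_3}x_1^{\varepsilon_4}x_2^{\varepsilon_1})\in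 L$ for all $\varepsilon_1,\varepsilon_3\in\{-1,1\}$ and $\varepsilon_2,\varepsilon_4\in\{-1,0,1\}$; - (L2) $\rho_\delta(L)\subset L$ for all $\delta\in\{-1,0,1\}^2$. Then, for every choice of $\mathbf r$, $$I=\tau(J_4)+\tau_N(L).$$ -/

import Mathlib

namespace Funar

noncomputable section

/-! ## Braid groups, the algebras `K n`, their limit, and the universal Markov trace

Generators are indexed from `0`: the index `i : ℕ` stands for the braid generator number `i + 1`.
So the generators of the braid group on `n` strings are the indices `i` with `i + 1 < n`. -/

/-- Indices of the standard generators of the braid group on `n` strings. -/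
abbrev GenIdx (n : ℕ) : Type := {i : ℕ // i + 1 < n}

/-- The relators of the standard (Artin) presentation of the braid group on `n` strings. -/
inductive BraidRel (n : ℕ) : FreeGroup (GenIdx n) → Prop
  | braid (i j : GenIdx n) (h : i.1 + 1 = j.1) :
      BraidRel n (FreeGroup.of i * FreeGroup.of j * FreeGroup.of i *
        (FreeGroup.of j * FreeGroup.of i * FreeGroup.of j)⁻¹)
  | comm (i j : GenIdx n) (h : i.1 + 1 < j.1) :
      BraidRel n (FreeGroup.of i * FreeGroup.of j * (FreeGroup.of j * FreeGroup.of i)⁻¹)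

/-- The braid group on `n` strings. -/
abbrev BraidGroup (n : ℕ) : Type := PresentedGroup {w | BraidRel n w}

/-- The standard generators of the braid group: `sigma i` is the generator number `i + 1`. -/
def sigma {n : ℕ} (i : GenIdx n) : BraidGroup n := PresentedGroup.of i

/-- The inclusion of index sets. -/
def GenIdx.cast {m n : ℕ} (h : m ≤ n) (i : GenIdx m) : GenIdx n := ⟨i.1, i.2.trans_le h⟩

/-- The standard homomorphism between braid groups (adding strings on the right). -/
def braidMap {m n : ℕ} (h : m ≤ n) : BraidGroup m →* BraidGroup n :=
  PresentedGroup.toGroup (f := fun i => sigma (GenIdx.cast h i)) (by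
    intro r hr
    rcases hr with ⟨i, j, hij⟩ | ⟨i, j, hij⟩
    · have := PresentedGroup.one_of_mem (rels := {w | BraidRel n w})
        (BraidRel.braid (GenIdx.cast h i) (GenIdx.cast h j) hij)
      simpa [sigma, PresentedGroup.of] using this
    · have := PresentedGroup.one_of_mem (rels := {w | BraidRel n w})
        (BraidRel.comm (GenIdx.cast h i) (GenIdx.cast h j) hij)
      simpa [sigma, PresentedGroup.of] using this)

@[simp] theorem braidMap_sigma {m n : ℕ} (h : m ≤ n) (i : GenIdx m) :
    braidMap h (sigma i) = sigma (GenIdx.cast h i) :=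
  PresentedGroup.toGroup.of _

section Algebras

variable {R : Type*} [CommRing R]

/-- The right hand side of the relation for `y * xb * y`, evaluated at elements `x, xb, y, yb`
of an algebra (`xb, yb` play the role of the inverses of `x, y`). -/
def cubicRHS {B : Type*} [Ring B] [Algebra R B] (α β : R) (x xb y yb : B) : B :=
  (2 * α - β ^ 2) • (1 : B) - (x + y) - (α ^ 2 - β) • (xb + yb)
    + β • (x * y + y * x) + α • (x * yb + y * xb + xb * y + yb * x)
    + (α * β - 1) • (xb * yb + yb * xb)
    - α • (x * y * x)
    - (xb * y * x + x * yb * x + x * y * xb) - β • (xb * yb * x + x * yb * xb)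
    + (α - β ^ 2) • (xb * yb * xb)

/-- A group element as an element of the group algebra. -/
def grp (R : Type*) [CommRing R] {G : Type*} [Group G] (g : G) : MonoidAlgebra R G :=
  MonoidAlgebra.of R G g

/-- The defining relations of `K n`: the cubic relation for the first generator and the relation
for the first two generators (each of them present only if these generators exist). -/
inductive KRel (α β : R) (n : ℕ) :
    MonoidAlgebra R (BraidGroup n) → MonoidAlgebra R (BraidGroup n) → Prop
  | cubic (h : 0 + 1 < n) :
      KRel α β n
        (grp R (sigma ⟨0, h⟩) ^ 3 - α • grp R (sigma ⟨0, h⟩) ^ 2 + β • grp R (sigma ⟨0, h⟩) - 1) 0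
  | funar (h : 0 + 1 < n) (h2 : 1 + 1 < n) :
      KRel α β n
        (grp R (sigma ⟨1, h2⟩) * grp R ((sigma ⟨0, h⟩)⁻¹) * grp R (sigma ⟨1, h2⟩))
        (cubicRHS α β (grp R (sigma ⟨0, h⟩)) (grp R ((sigma ⟨0, h⟩)⁻¹))
          (grp R (sigma ⟨1, h2⟩)) (grp R ((sigma ⟨1, h2⟩)⁻¹)))

/-- The algebra `K_n(α, β; R)`: the quotient of the group algebra of the braid group. -/
abbrev K (α β : R) (n : ℕ) : Type _ := RingQuot (KRel α β n)

/-- The image in `K_n` of a braid. -/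
def toK (α β : R) (n : ℕ) (g : BraidGroup n) : K α β n :=
  RingQuot.mkAlgHom R (KRel α β n) (grp R g)

/-- An algebra homomorphism commutes with the right hand side of the relation. -/
theorem map_cubicRHS {B C : Type*} [Ring B] [Algebra R B] [Ring C] [Algebra R C]
    (f : B →ₐ[R] C) (α β : R) (x xb y yb : B) :
    f (cubicRHS α β x xb y yb) = cubicRHS α β (f x) (f xb) (f y) (f yb) := by
  simp only [cubicRHS, map_add, map_sub, map_smul, map_mul, map_one]

/-- The homomorphism of group algebras induced by `braidMap`. -/
def braidAlgMap (R : Type*) [CommRing R] {m n : ℕ} (h : m ≤ n) :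
    MonoidAlgebra R (BraidGroup m) →ₐ[R] MonoidAlgebra R (BraidGroup n) :=
  MonoidAlgebra.mapDomainAlgHom R R (braidMap h)

theorem braidAlgMap_grp {m n : ℕ} (h : m ≤ n) (g : BraidGroup m) :
    braidAlgMap R h (grp R g) = grp R (braidMap h g) := by
  simp [braidAlgMap, grp]

/-- The morphism `K_m → K_n` induced by the standard homomorphism of braid groups. -/
def kMap (α β : R) {m n : ℕ} (h : m ≤ n) : K α β m →ₐ[R] K α β n :=
  RingQuot.liftAlgHom R ⟨(RingQuot.mkAlgHom R (KRel α β n)).comp (braidAlgMap R h), by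
    intro a b hab
    simp only [AlgHom.comp_apply]
    rcases hab with ⟨h1⟩ | ⟨h1, h2⟩
    · simp only [map_add, map_sub, map_smul, map_pow, map_one, map_zero, braidAlgMap_grp,
        braidMap_sigma, GenIdx.cast]
      simpa only [map_add, map_sub, map_smul, map_pow, map_one, map_zero] using
        RingQuot.mkAlgHom_rel R (KRel.cubic (α := α) (β := β) (n := n) (h1.trans_le h))
    · rw [map_cubicRHS]
      simp only [map_mul, braidAlgMap_grp, map_inv, braidMap_sigma, GenIdx.cast]
      simpa only [map_mul] using RingQuot.mkAlgHom_rel R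
        (KRel.funar (α := α) (β := β) (n := n) (h1.trans_le h) (h2.trans_le h))⟩

theorem kMap_toK (α β : R) {m n : ℕ} (h : m ≤ n) (g : BraidGroup m) :
    kMap α β h (toK α β m g) = toK α β n (braidMap h g) := by
  simp [kMap, toK, braidAlgMap_grp]

theorem K.algHom_ext {α β : R} {n : ℕ} {B : Type*} [Semiring B] [Algebra R B]
    {f g : K α β n →ₐ[R] B} (h : ∀ i : GenIdx n, f (toK α β n (sigma i)) = g (toK α β n (sigma i))) :
    f = g := by
  apply RingQuot.ringQuot_ext'
  have key : ∀ p q : BraidGroup n →* B, (∀ i, p (sigma i) = q (sigma i)) → p = q := by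
    intro p q hpq
    have : p.toHomUnits = q.toHomUnits :=
      PresentedGroup.ext (rels := {w | BraidRel n w}) fun i => Units.ext (hpq i)
    ext x
    exact congrArg Units.val (DFunLike.congr_fun this x)
  apply MonoidAlgebra.algHom_ext'
  · refine key _ _ fun i => ?_
    simpa [toK, grp] using h i
  · exact Subsingleton.elim _ _

instance kDirectedSystem (α β : R) :
    DirectedSystem (fun n => K α β n) (fun _ _ h => kMap α β h) where
  map_self n x := by
    have : kMap α β (le_refl n) = AlgHom.id R _ :=
      K.algHom_ext fun i => by simp [kMap_toK, GenIdx.cast]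
    simp [this]
  map_map k j i hij hjk x := by
    have : (kMap α β hjk).comp (kMap α β hij) = kMap α β (hij.trans hjk) :=
      K.algHom_ext fun i => by simp [kMap_toK, GenIdx.cast]
    exact DFunLike.congr_fun this x

/-- `K_∞`, the direct limit of the `K_n`. -/
abbrev KInf (α β : R) : Type _ := DirectLimit (fun n => K α β n) (fun _ _ h => kMap α β h)

/-- The canonical map `K_n → K_∞`. -/
def ofK (α β : R) (n : ℕ) : K α β n →ₗ[R] KInf α β :=
  DirectLimit.Module.of R ℕ (fun n => K α β n) (fun _ _ h => kMap α β h) n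

/-- The `n`-th generator of `K_∞` (`n ≥ 1`, here `n = m + 1`), or its inverse. It comes
from `K_{n+1}`. -/
def sGen (α β : R) (m : ℕ) (e : Bool) : KInf α β :=
  ofK α β (m + 2) (toK α β (m + 2)
    (bif e then sigma ⟨m, by omega⟩ else (sigma ⟨m, by omega⟩)⁻¹))

/-- The elements that a Markov trace with parameters `u, v` has to kill. In the last two
constructors `n = m + 1 ≥ 1` is the index of the generator. -/
inductive MarkovRel (α β u v : R) : KInf α β → Prop
  | comm (n : ℕ) (x y : K α β n) :
      MarkovRel α β u v (ofK α β n x * ofK α β n y - ofK α β n y * ofK α β n x)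
  | pos (m : ℕ) (x : K α β (m + 1)) :
      MarkovRel α β u v (ofK α β (m + 1) x * sGen α β m true - u • ofK α β (m + 1) x)
  | neg (m : ℕ) (x : K α β (m + 1)) :
      MarkovRel α β u v (ofK α β (m + 1) x * sGen α β m false - v • ofK α β (m + 1) x)

/-- The target of the universal Markov trace with parameters `u, v`. -/
abbrev MarkovModule (α β u v : R) : Type _ :=
  KInf α β ⧸ Submodule.span R {z | MarkovRel α β u v z}

/-- The universal Markov trace. -/
def universalTrace (α β u v : R) : KInf α β →ₗ[R] MarkovModule α β u v := Submodule.mkQ _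

end Algebras

/-! ## Words and `K`-reductions -/

/-- The letter `(i, true)` is the generator number `i + 1`, the letter `(i, false)` its formal
inverse. -/
abbrev Letter : Type := ℕ × Bool

/-- All (not necessarily reduced) words in the generators and their inverses. -/
abbrev Word : Type := FreeMonoid Letter

/-- The word that consists of one letter. -/
def gen (i : ℕ) (e : Bool) : Word := FreeMonoid.of (i, e)

/-- The generator with index `i`, raised to the power `-1`, `0` or `1`. -/
def genPow (i : ℕ) : SignType → Word
  | .zero => 1
  | .pos => gen i true
  | .neg => gen i false

/-- The words of `F_n`: only the generators number `1, …, n - 1` and their inverses occur. -/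
def InF (n : ℕ) (W : Word) : Prop := ∀ l ∈ W.toList, l.1 + 1 < n

/-- All letters of the word have an index smaller than `i`. -/
def IdxLT (i : ℕ) (W : Word) : Prop := ∀ l ∈ W.toList, l.1 < i

/-- Descending words: `Desc i j` consists of the words `x_i^{±1} x_{i-1}^{±1} ⋯ x_j^{±1}`, with
independent signs. The numbers `i, j` count the generators from `1`. -/
def Desc (i j : ℕ) : Set Word :=
  {W | W.toList.map (fun l => l.1 + 1) = (List.range' j (i + 1 - j)).reverse}

/-- The set `S_i`: the empty word and the descending words that start with generator number `i`. -/
def S (i : ℕ) : Set Word := {1} ∪ ⋃ j ∈ Finset.Icc 1 i, Desc i j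

/-- The shift of words, which raises every index by one. -/
def shWord : Word →* Word := FreeMonoid.map fun l => (l.1 + 1, l.2)

section Reductions

variable {R : Type*} [CommRing R]

/-- The free associative algebra, whose elements are the linear combinations of words. -/
abbrev FA (R : Type*) [CommRing R] : Type _ := MonoidAlgebra R Word

/-- A word as an element of the free algebra. -/
def w (R : Type*) [CommRing R] (W : Word) : FA R := MonoidAlgebra.of R Word W

/-- The basic replacements of a product of three letters `y^{e₁} x^{e₂} y^{e₃}`, where `x, y` have
the indices `i, i + 1`. -/
inductive TripleRepl (α β : R) (i : ℕ) : Bool → Bool → Bool → FA R → Prop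
  | braid (e₁ e₂ e₃ : Bool) (h : e₂ = e₁ ∨ e₂ = e₃) :
      TripleRepl α β i e₁ e₂ e₃ (w R (gen i e₃ * gen (i + 1) e₂ * gen i e₁))
  | pos :
      TripleRepl α β i true false true
        (cubicRHS α β (w R (gen i true)) (w R (gen i false))
          (w R (gen (i + 1) true)) (w R (gen (i + 1) false)))
  | neg :
      TripleRepl α β i false true false
        (cubicRHS β α (w R (gen i false)) (w R (gen i true))
          (w R (gen (i + 1) false)) (w R (gen (i + 1) true)))

/-- The basic replacements `U → V`. -/
inductive BasicRepl (α β : R) : Word → FA R → Prop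
  | cancel (i : ℕ) (e : Bool) : BasicRepl α β (gen i e * gen i (!e)) 1
  | sq (i : ℕ) :
      BasicRepl α β (gen i true * gen i true)
        (α • w R (gen i true) - β • (1 : FA R) + w R (gen i false))
  | sqInv (i : ℕ) :
      BasicRepl α β (gen i false * gen i false)
        (β • w R (gen i false) - α • (1 : FA R) + w R (gen i true))
  | triple (i : ℕ) (e₁ e₂ e₃ : Bool) (V : FA R) (h : TripleRepl α β i e₁ e₂ e₃ V) :
      BasicRepl α β (gen (i + 1) e₁ * gen i e₂ * gen (i + 1) e₃) V
  | tripleFar (i : ℕ) (e₁ e₂ e₃ : Bool) (V : FA R) (h : TripleRepl α β i e₁ e₂ e₃ V)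
      (W : Word) (hW : IdxLT i W) :
      BasicRepl α β (gen (i + 1) e₁ * gen i e₂ * W * gen (i + 1) e₃) (V * w R W)
  | comm (i j : ℕ) (h : i + 1 < j) (e₁ e₂ : Bool) :
      BasicRepl α β (gen j e₁ * gen i e₂) (w R (gen i e₂ * gen j e₁))

/-- Elementary `K`-reductions of words. -/
def WordStep (α β : R) (W : Word) (Y : FA R) : Prop :=
  ∃ (A U B : Word) (V : FA R), BasicRepl α β U V ∧ W = A * U * B ∧ Y = w R A * V * w R B

/-- Elementary `K`-reductions of elements of the free algebra: one of the words that occur in the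
element, with a nonzero coefficient, is replaced. -/
def Step (α β : R) (X Y : FA R) : Prop :=
  ∃ (W : Word) (V : FA R), X.coeff W ≠ 0 ∧ WordStep α β W V ∧
    Y = X - X.coeff W • w R W + X.coeff W • V

/-- A word is reduced if no elementary reduction applies to it. -/
def WordReduced (α β : R) (W : Word) : Prop := ¬ ∃ Y, WordStep α β W Y

/-- An element of the free algebra is reduced if no elementary reduction applies to it. -/
def Reduced (α β : R) (X : FA R) : Prop := ¬ ∃ Y, Step α β X Y

/-- The submodule spanned by the reduced words of `F_n`. -/
def redSub (α β : R) (n : ℕ) : Submodule R (FA R) :=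
  Submodule.span R {X | ∃ W : Word, InF n W ∧ WordReduced α β W ∧ X = w R W}

/-- An admissible choice of the reduction map on words: every word `X` is sent to the end point of
some finite sequence of elementary reductions that starts at `X` and ends at a reduced element. -/
def IsReductionMap (α β : R) (r : Word → FA R) : Prop :=
  ∀ X : Word, Relation.ReflTransGen (Step α β) (w R X) (r X) ∧ Reduced α β (r X)

/-- The linear extension of a map that is defined on words. -/
def lin (f : Word → FA R) : FA R →ₗ[R] FA R :=
  (Finsupp.linearCombination R f).comp (MonoidAlgebra.coeffLinearEquiv R).toLinearMap

/-! ## Markov reductions -/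

/-- The Markov reduction `F_n → F_{n-1}` on reduced words of `F_n`, in which the generator number
`n - 1` occurs at most once: a word `X` without it is fixed, and `X x_{n-1} Y`, `X x_{n-1}⁻¹ Y`
are sent to `u r(XY)`, `v r(XY)`. -/
def tauWord (r : Word → FA R) (u v : R) (n : ℕ) (W : Word) : FA R :=
  match W.toList.dropWhile (fun l => l.1 + 2 ≠ n) with
  | [] => w R W
  | l :: Y =>
      (bif l.2 then u else v) •
        r (FreeMonoid.ofList (W.toList.takeWhile (fun l => l.1 + 2 ≠ n)) * FreeMonoid.ofList Y)

/-- The Markov reduction `τ_n` (`n ≥ 2`): first reduce, then apply `tauWord`. It is used on the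
span of the words of `F_n`. -/
def tauN (r : Word → FA R) (u v : R) (n : ℕ) : FA R →ₗ[R] FA R :=
  (lin (tauWord r u v n)).comp (lin r)

/-- The composition `τ_2 ∘ ⋯ ∘ τ_n`. -/
def tauComp (r : Word → FA R) (u v : R) : ℕ → (FA R →ₗ[R] FA R)
  | 0 => LinearMap.id
  | 1 => LinearMap.id
  | n + 2 => (tauComp r u v (n + 1)).comp (tauN r u v (n + 2))

/-- The map `τ` on the span of the words of `F_n`. The values of `τ_2 ∘ ⋯ ∘ τ_n` there are
multiples of the empty word, and are identified with their coefficient. -/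
def tau (r : Word → FA R) (u v : R) (n : ℕ) : FA R →ₗ[R] R :=
  (Finsupp.lapply (1 : Word)).comp
    ((MonoidAlgebra.coeffLinearEquiv R).toLinearMap.comp (tauComp r u v n))

/-- The shift, as an endomorphism of the free algebra. -/
def sh (R : Type*) [CommRing R] : FA R →ₐ[R] FA R := MonoidAlgebra.mapDomainAlgHom R R shWord

/-! ## The modules `J_4` and `L` -/

/-- The map `Y ↦ τ_5(X sh(Y))`. -/
def rhoX (r : Word → FA R) (u v : R) (X : Word) : FA R →ₗ[R] FA R :=
  (tauN r u v 5).comp ((LinearMap.mulLeft R (w R X)).comp (sh R).toLinearMap)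

/-- The associativity defects: `X₃, X₂, X₁` are nonempty words of `S_3`, of the shifted `S_2` and
of the twice shifted `S_1`. -/
def assocDefects (r : Word → FA R) : Set (FA R) :=
  {Z | ∃ X₃ ∈ S 3 \ {1}, ∃ X₂ ∈ (shWord '' S 2) \ {1}, ∃ X₁ ∈ (shWord '' (shWord '' S 1)) \ {1},
    Z = lin r (lin r (w R (X₃ * X₂)) * w R X₁) - lin r (w R X₃ * lin r (w R (X₂ * X₁)))}

/-- The smallest submodule of the span of the reduced words of `F_4` that contains the
associativity defects and is stable under `rhoX X` for all `X` in `S_4`. -/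
def J4 (α β u v : R) (r : Word → FA R) : Submodule R (FA R) :=
  sInf {P | P ≤ redSub α β 4 ∧ assocDefects r ⊆ P ∧ ∀ X ∈ S 4, P.map (rhoX r u v X) ≤ P}

open scoped TensorProduct

/-- The tensor square of the span of the reduced words of `F_2`. Since this span is a direct
summand of the free algebra, its tensor square is realized as a submodule of the tensor square
of the free algebra. -/
def N (α β : R) : Submodule R (FA R ⊗[R] FA R) :=
  Submodule.map₂ (TensorProduct.mk R (FA R) (FA R)) (redSub α β 2) (redSub α β 2)

/-- The map `τ_N`, which sends `Y₁ ⊗ Y₂` to `τ(Y₁ Y₂)`. -/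
def tauTensor (r : Word → FA R) (u v : R) : FA R ⊗[R] FA R →ₗ[R] R :=
  (tau r u v 2).comp (TensorProduct.lift (LinearMap.mul R (FA R)))

/-- The map `ρ_δ`, which sends `Y₁ ⊗ Y₂` to `x_1^{δ₁} ⊗ τ_3(sh(Y₁) x_1^{δ₂} sh(Y₂))`. -/
def rhoDelta (r : Word → FA R) (u v : R) (δ₁ δ₂ : SignType) :
    FA R ⊗[R] FA R →ₗ[R] FA R ⊗[R] FA R :=
  (TensorProduct.mk R (FA R) (FA R) (w R (genPow 0 δ₁))).comp
    ((tauN r u v 3).comp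
      (TensorProduct.lift ((LinearMap.mul R (FA R)).compl₁₂
        ((LinearMap.mulRight R (w R (genPow 0 δ₂))).comp (sh R).toLinearMap)
        (sh R).toLinearMap)))

/-- The generators of `L`, with signs `e₁, e₃` in `{-1, 1}` and `e₂, e₄` in `{-1, 0, 1}`. -/
def pentagonDefects (r : Word → FA R) (u v : R) : Set (FA R ⊗[R] FA R) :=
  {Z | ∃ e₁ e₂ e₃ e₄ : SignType, e₁ ≠ 0 ∧ e₃ ≠ 0 ∧
    Z = tauN r u v 3 (w R (genPow 1 e₁ * genPow 0 e₂ * genPow 1 e₃)) ⊗ₜ[R] w R (genPow 0 e₄)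
      - w R (genPow 0 e₂) ⊗ₜ[R] tauN r u v 3 (w R (genPow 1 e₃ * genPow 0 e₄ * genPow 1 e₁))}

/-- The smallest submodule of `N` that contains `pentagonDefects` and is stable under all the maps
`rhoDelta`. -/
def L (α β u v : R) (r : Word → FA R) : Submodule R (FA R ⊗[R] FA R) :=
  sInf {P | P ≤ N α β ∧ pentagonDefects r u v ⊆ P ∧
    ∀ δ₁ δ₂ : SignType, P.map (rhoDelta r u v δ₁ δ₂) ≤ P}

end Reductions

/-! ## The polynomial coefficient ring -/

section Poly

variable (k : Type*) [CommRing k]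

/-- The polynomial ring `A = k[u, v]`. -/
abbrev A : Type _ := MvPolynomial (Fin 2) k

/-- The variable `u`. -/
def u : A k := MvPolynomial.X 0

/-- The variable `v`. -/
def v : A k := MvPolynomial.X 1

variable {k}

/-- The image in `A` of an element of `k`. -/
def c (a : k) : A k := MvPolynomial.C a

/-- The annihilator `I` of the target of the universal Markov trace on `K_∞(α, β; A)`. -/
def traceIdeal (α β : k) : Ideal (A k) :=
  Module.annihilator (A k) (MarkovModule (c α) (c β) (u k) (v k))

end Poly

end

end Funar

namespace Funar

noncomputable section

open scoped TensorProduct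

section Presentation

variable {R : Type*} [CommRing R]

/-! ### The relations of `K n` for all generators -/

/-- The relation for `yb * x * yb` follows from the one for `y * xb * y`: multiply the latter by
`x` on the left, use `x * y * xb = yb * x * y` and expand the squares. -/
theorem cubicRHS_inv {B : Type*} [Ring B] [Algebra R B] {α β : R} {x xb y yb : B}
    (hx : x * xb = 1) (hy' : yb * y = 1)
    (hb : y * x * y = x * y * x) (hxx : x * x = α • x - β • 1 + xb)
    (hyy : y * y = α • y - β • 1 + yb) (h : y * xb * y = cubicRHS α β x xb y yb) :
    yb * x * yb = cubicRHS β α xb x yb y := by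
  have h0 : x * y * xb = yb * x * y := by
    calc x * y * xb = yb * (y * x * y) * xb := by simp only [← mul_assoc, hy', one_mul]
      _ = yb * x * y := by rw [hb]; simp only [mul_assoc, hx, mul_one]
  have h1 : x * (y * xb * y) = α • (x * y * xb) - β • (yb * x) + yb * x * yb := by
    calc x * (y * xb * y) = yb * x * (y * y) := by simp only [← mul_assoc, h0]
      _ = _ := by
        rw [hyy, h0]
        simp only [mul_add, mul_sub, mul_smul_comm, mul_one, mul_assoc]
  have h2 : ∀ z, x * (x * z) = α • (x * z) - β • z + xb * z := fun z => by
    rw [← mul_assoc, hxx]; simp only [add_mul, sub_mul, smul_mul_assoc, one_mul]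
  have h3 : ∀ z, x * (xb * z) = z := fun z => by rw [← mul_assoc, hx, one_mul]
  have h4 : yb * x * yb = x * cubicRHS α β x xb y yb - α • (x * y * xb) + β • (yb * x) := by
    rw [← h, h1]; abel
  rw [h4]
  simp only [cubicRHS, mul_add, mul_sub, mul_smul_comm, mul_assoc, h2, h3, hx, hxx, mul_one]
  module

theorem braid_signs {G : Type*} [Group G] {a b : G} (h : a * b * a = b * a * b) :
    b * a * b⁻¹ = a⁻¹ * b * a ∧ b⁻¹ * a * b = a * b * a⁻¹ ∧ b * a⁻¹ * b⁻¹ = a⁻¹ * b⁻¹ * a ∧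
      b⁻¹ * a⁻¹ * b = a * b⁻¹ * a⁻¹ ∧ b⁻¹ * a⁻¹ * b⁻¹ = a⁻¹ * b⁻¹ * a⁻¹ := by
  have h1 : b * a * b⁻¹ = a⁻¹ * b * a := by
    rw [mul_inv_eq_iff_eq_mul]
    calc b * a = a⁻¹ * (a * b * a) := by group
      _ = _ := by rw [h]; group
  have h2 : b⁻¹ * a * b = a * b * a⁻¹ := by
    rw [eq_mul_inv_iff_mul_eq]
    calc b⁻¹ * a * b * a = b⁻¹ * (a * b * a) := by group
      _ = _ := by rw [h]; group
  refine ⟨h1, h2, ?_, ?_, ?_⟩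
  · simpa [mul_assoc] using congrArg (·⁻¹) h1
  · simpa [mul_assoc] using congrArg (·⁻¹) h2
  · simpa [mul_assoc] using congrArg (·⁻¹) h.symm

/-- The generator with index `i` of the braid group on `n` strings, or its inverse, where
generators that do not exist are replaced by `1`. -/
def sigmaPow (n i : ℕ) (e : Bool) : BraidGroup n :=
  if h : i + 1 < n then (bif e then sigma ⟨i, h⟩ else (sigma ⟨i, h⟩)⁻¹) else 1

theorem sigmaPow_not (n i : ℕ) (e : Bool) : sigmaPow n i (!e) = (sigmaPow n i e)⁻¹ := by
  unfold sigmaPow; split_ifs <;> cases e <;> simp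

theorem sigmaPow_false (n i : ℕ) : sigmaPow n i false = (sigmaPow n i true)⁻¹ :=
  sigmaPow_not n i true

theorem sigma_braid {n : ℕ} (i j : GenIdx n) (h : i.1 + 1 = j.1) :
    sigma i * sigma j * sigma i = sigma j * sigma i * sigma j := by
  have := PresentedGroup.one_of_mem (rels := {w | BraidRel n w}) (BraidRel.braid i j h)
  simp only [map_mul, map_inv] at this
  exact mul_inv_eq_one.mp this

theorem sigma_comm {n : ℕ} (i j : GenIdx n) (h : i.1 + 1 < j.1) :
    sigma i * sigma j = sigma j * sigma i := by
  have := PresentedGroup.one_of_mem (rels := {w | BraidRel n w}) (BraidRel.comm i j h)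
  simp only [map_mul, map_inv] at this
  exact mul_inv_eq_one.mp this

theorem sigmaPow_braid {n i : ℕ} (h : i + 2 < n) :
    sigmaPow n i true * sigmaPow n (i + 1) true * sigmaPow n i true =
      sigmaPow n (i + 1) true * sigmaPow n i true * sigmaPow n (i + 1) true := by
  simpa [sigmaPow, h, show i + 1 < n by omega, show i + 1 + 1 < n by omega] using
    sigma_braid (n := n) ⟨i, by omega⟩ ⟨i + 1, by omega⟩ rfl

theorem sigmaPow_braid_signs {n i : ℕ} (h : i + 2 < n) (e₁ e₂ e₃ : Bool)
    (he : e₂ = e₁ ∨ e₂ = e₃) :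
    sigmaPow n (i + 1) e₁ * sigmaPow n i e₂ * sigmaPow n (i + 1) e₃ =
      sigmaPow n i e₃ * sigmaPow n (i + 1) e₂ * sigmaPow n i e₁ := by
  have hb := sigmaPow_braid h
  obtain ⟨h1, h2, h3, h4, h5⟩ := braid_signs hb
  cases e₁ <;> cases e₂ <;> cases e₃ <;> simp [sigmaPow_false] at he ⊢ <;>
    first | assumption | exact hb.symm

theorem sigmaPow_comm (n : ℕ) {i j : ℕ} (h : i + 1 < j) (e₁ e₂ : Bool) :
    Commute (sigmaPow n i e₁) (sigmaPow n j e₂) := by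
  unfold sigmaPow
  by_cases hj : j + 1 < n
  · have hc : Commute (sigma (⟨i, by omega⟩ : GenIdx n)) (sigma ⟨j, hj⟩) := sigma_comm _ _ h
    have hi : i + 1 < n := by omega
    cases e₁ <;> cases e₂ <;> simp [hi, hj, hc]
  · simp [hj]

theorem toK_mul (α β : R) (n : ℕ) (g h : BraidGroup n) :
    toK α β n (g * h) = toK α β n g * toK α β n h := by
  simp only [toK, grp, map_mul]

theorem toK_one (α β : R) (n : ℕ) : toK α β n 1 = 1 := by
  simp only [toK, grp, map_one]

/-- The generator with index `i` of `K n`, or its inverse. -/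
def sK (α β : R) (n i : ℕ) (e : Bool) : K α β n := toK α β n (sigmaPow n i e)

theorem sK_mul_not (α β : R) (n i : ℕ) (e : Bool) : sK α β n i e * sK α β n i (!e) = 1 := by
  simp [sK, ← toK_mul, sigmaPow_not, toK_one]

/-- The generators of the braid group with consecutive pairs of indices are conjugate. -/
theorem exists_conj_pair {n i : ℕ} (h : i + 2 < n) : ∃ g : BraidGroup n,
    g * sigmaPow n 0 true = sigmaPow n i true * g ∧
      g * sigmaPow n 1 true = sigmaPow n (i + 1) true * g := by
  induction i with
  | zero => exact ⟨1, by simp, by simp⟩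
  | succ i ih =>
    obtain ⟨g, h1, h2⟩ := ih (by omega)
    set a := sigmaPow n i true
    set b := sigmaPow n (i + 1) true
    set c := sigmaPow n (i + 1 + 1) true
    have hab : a * b * a = b * a * b := sigmaPow_braid (by omega)
    have hbc : b * c * b = c * b * c := sigmaPow_braid (by omega)
    have hac : a * c = c * a := sigmaPow_comm n (by omega) _ _
    refine ⟨a * b * c * g, ?_, ?_⟩
    · calc a * b * c * g * sigmaPow n 0 true = a * b * (a * c) * g := by
            rw [hac]; simp only [mul_assoc, h1]
        _ = (a * b * a) * c * g := by simp only [mul_assoc]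
        _ = b * (a * b * c * g) := by rw [hab]; simp only [mul_assoc]
    · calc a * b * c * g * sigmaPow n 1 true = a * (b * c * b) * g := by
            simp only [mul_assoc, h2]
        _ = (a * c) * b * c * g := by rw [hbc]; simp only [mul_assoc]
        _ = c * (a * b * c * g) := by rw [hac]; simp only [mul_assoc]

theorem exists_conj {n i : ℕ} (h : i + 1 < n) : ∃ g : BraidGroup n,
    g * sigmaPow n 0 true = sigmaPow n i true * g := by
  rcases i with _ | i
  · exact ⟨1, by simp⟩
  · obtain ⟨g, h1, -⟩ := exists_conj_pair (n := n) (i := i) (by omega)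
    refine ⟨sigmaPow n i true * sigmaPow n (i + 1) true * g, ?_⟩
    calc _ = sigmaPow n i true * sigmaPow n (i + 1) true * sigmaPow n i true * g := by
          simp only [mul_assoc, h1]
      _ = _ := by rw [sigmaPow_braid (by omega)]; simp only [mul_assoc]

theorem toK_conj {α β : R} {n i j : ℕ} {g : BraidGroup n} (e : Bool)
    (h : g * sigmaPow n i true = sigmaPow n j true * g) :
    sK α β n j e = toK α β n g * sK α β n i e * toK α β n g⁻¹ := by
  have h' : sigmaPow n j true = g * sigmaPow n i true * g⁻¹ := by rw [h]; group
  cases e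
  · simp only [sK, ← toK_mul, sigmaPow_false, h']; congr 1; group
  · simp only [sK, ← toK_mul, h']

/-- Conjugation by an invertible element, as an algebra homomorphism. -/
def conjAlgHom {B : Type*} [Ring B] [Algebra R B] (g g' : B) (h : g' * g = 1) (h' : g * g' = 1) :
    B →ₐ[R] B where
  toFun b := g * b * g'
  map_one' := by rw [mul_one, h']
  map_mul' a b := by
    calc g * (a * b) * g' = g * a * 1 * b * g' := by simp only [mul_assoc, one_mul]
      _ = _ := by rw [← h]; simp only [mul_assoc]
  map_zero' := by simp
  map_add' a b := by simp [mul_add, add_mul]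
  commutes' r := by rw [← Algebra.commutes, mul_assoc, h', mul_one]

theorem sK_sq (α β : R) {n i : ℕ} (h : i + 1 < n) :
    sK α β n i true * sK α β n i true =
      α • sK α β n i true - β • 1 + sK α β n i false := by
  have h0 : 0 + 1 < n := by omega
  have e0 : ∀ e, sK α β n 0 e = RingQuot.mkAlgHom R (KRel α β n)
      (grp R (bif e then sigma ⟨0, h0⟩ else (sigma ⟨0, h0⟩)⁻¹)) := fun e => by
    simp [sK, toK, sigmaPow, show 1 < n by omega]
  have key : sK α β n 0 true * sK α β n 0 true =
      α • sK α β n 0 true - β • 1 + sK α β n 0 false := by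
    have h1 := RingQuot.mkAlgHom_rel R (KRel.cubic (α := α) (β := β) (n := n) h0)
    simp only [map_add, map_sub, map_smul, map_pow, map_one, map_zero] at h1
    have h2 := e0 true
    simp only [cond_true] at h2
    rw [← h2] at h1
    have h3 := sK_mul_not α β n 0 true
    have h4 := congrArg (· * sK α β n 0 false) h1
    simp only [pow_succ, pow_zero, one_mul, add_mul, sub_mul, smul_mul_assoc, mul_assoc,
      zero_mul] at h4
    simp only [Bool.not_true] at h3
    rw [h3, mul_one] at h4
    rw [← sub_eq_zero, ← h4]
    abel
  obtain ⟨g, hg⟩ := exists_conj h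
  let f : K α β n →ₐ[R] K α β n := conjAlgHom (toK α β n g) (toK α β n g⁻¹)
    (by rw [← toK_mul, inv_mul_cancel, toK_one]) (by rw [← toK_mul, mul_inv_cancel, toK_one])
  have hf : ∀ e, f (sK α β n 0 e) = sK α β n i e := fun e => (toK_conj e hg).symm
  have := congrArg f key
  simpa only [map_mul, map_add, map_sub, map_smul, map_one, hf] using this

theorem sK_sq_inv (α β : R) {n i : ℕ} (h : i + 1 < n) :
    sK α β n i false * sK α β n i false =
      β • sK α β n i false - α • 1 + sK α β n i true := by
  have h1 := congrArg (fun z => sK α β n i false * z) (sK_sq α β h)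
  have h2 : sK α β n i false * sK α β n i true = 1 := sK_mul_not α β n i false
  simp only [mul_add, mul_sub, mul_smul_comm, h2, mul_one, ← mul_assoc, one_mul] at h1
  rw [h1]
  abel

theorem sK_funar (α β : R) {n i : ℕ} (h : i + 2 < n) :
    sK α β n (i + 1) true * sK α β n i false * sK α β n (i + 1) true =
      cubicRHS α β (sK α β n i true) (sK α β n i false) (sK α β n (i + 1) true)
        (sK α β n (i + 1) false) := by
  have h0 : 0 + 1 < n := by omega
  have h1 : 1 + 1 < n := by omega
  have e0 : ∀ e, sK α β n 0 e = RingQuot.mkAlgHom R (KRel α β n)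
      (grp R (bif e then sigma ⟨0, h0⟩ else (sigma ⟨0, h0⟩)⁻¹)) := fun e => by
    simp [sK, toK, sigmaPow, show 1 < n by omega]
  have e1 : ∀ e, sK α β n 1 e = RingQuot.mkAlgHom R (KRel α β n)
      (grp R (bif e then sigma ⟨1, h1⟩ else (sigma ⟨1, h1⟩)⁻¹)) := fun e => by
    simp [sK, toK, sigmaPow, show 2 < n by omega]
  have key : sK α β n 1 true * sK α β n 0 false * sK α β n 1 true =
      cubicRHS α β (sK α β n 0 true) (sK α β n 0 false) (sK α β n 1 true)
        (sK α β n 1 false) := by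
    have h2 := RingQuot.mkAlgHom_rel R (KRel.funar (α := α) (β := β) (n := n) h0 h1)
    rw [map_cubicRHS, map_mul, map_mul] at h2
    simpa only [e0, e1, cond_true, cond_false] using h2
  obtain ⟨g, hg0, hg1⟩ := exists_conj_pair h
  let f : K α β n →ₐ[R] K α β n := conjAlgHom (toK α β n g) (toK α β n g⁻¹)
    (by rw [← toK_mul, inv_mul_cancel, toK_one]) (by rw [← toK_mul, mul_inv_cancel, toK_one])
  have hf0 : ∀ e, f (sK α β n 0 e) = sK α β n i e := fun e => (toK_conj e hg0).symm
  have hf1 : ∀ e, f (sK α β n 1 e) = sK α β n (i + 1) e := fun e => (toK_conj e hg1).symm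
  have := congrArg f key
  simpa only [map_cubicRHS, map_mul, hf0, hf1] using this

theorem sK_funar_inv (α β : R) {n i : ℕ} (h : i + 2 < n) :
    sK α β n (i + 1) false * sK α β n i true * sK α β n (i + 1) false =
      cubicRHS β α (sK α β n i false) (sK α β n i true) (sK α β n (i + 1) false)
        (sK α β n (i + 1) true) := by
  refine cubicRHS_inv (sK_mul_not α β n i true) (sK_mul_not α β n (i + 1) false) ?_
    (sK_sq α β (by omega)) (sK_sq α β (by omega)) (sK_funar α β h)
  simp only [sK, ← toK_mul]
  rw [sigmaPow_braid_signs h _ _ _ (Or.inl rfl)]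

theorem sK_comm (α β : R) (n : ℕ) {i j : ℕ} (h : i + 1 < j) (e₁ e₂ : Bool) :
    Commute (sK α β n i e₁) (sK α β n j e₂) := by
  simp only [Commute, SemiconjBy, sK, ← toK_mul, (sigmaPow_comm n h e₁ e₂).eq]

/-- The universal property of `K n`. -/
theorem exists_K_lift {α β : R} {n : ℕ} {B : Type*} [Ring B] [Algebra R B] (g : GenIdx n → Bˣ)
    (hb : ∀ i j : GenIdx n, i.1 + 1 = j.1 → g i * g j * g i = g j * g i * g j)
    (hc : ∀ i j : GenIdx n, i.1 + 1 < j.1 → g i * g j = g j * g i)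
    (hcub : ∀ h : 0 + 1 < n, (g ⟨0, h⟩ : B) * g ⟨0, h⟩ =
      α • (g ⟨0, h⟩ : B) - β • 1 + ((g ⟨0, h⟩)⁻¹ : Bˣ))
    (hf : ∀ (h : 0 + 1 < n) (h2 : 1 + 1 < n),
      (g ⟨1, h2⟩ : B) * ((g ⟨0, h⟩)⁻¹ : Bˣ) * g ⟨1, h2⟩ =
        cubicRHS α β (g ⟨0, h⟩ : B) ((g ⟨0, h⟩)⁻¹ : Bˣ) (g ⟨1, h2⟩) ((g ⟨1, h2⟩)⁻¹ : Bˣ)) :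
    ∃ f : K α β n →ₐ[R] B, ∀ i, f (toK α β n (sigma i)) = g i ∧
      f (toK α β n (sigma i)⁻¹) = ((g i)⁻¹ : Bˣ) := by
  have hrel : ∀ r ∈ {w | BraidRel n w}, FreeGroup.lift g r = 1 := by
    intro r hr
    rcases hr with ⟨i, j, hij⟩ | ⟨i, j, hij⟩
    · simp [← mul_assoc, hb i j hij]
    · simp [← mul_assoc, hc i j hij]
  let G : BraidGroup n →* Bˣ := PresentedGroup.toGroup hrel
  have hG : ∀ i, G (sigma i) = g i := fun i => PresentedGroup.toGroup.of hrel
  let F : MonoidAlgebra R (BraidGroup n) →ₐ[R] B :=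
    MonoidAlgebra.lift R B (BraidGroup n) ((Units.coeHom B).comp G)
  have hF : ∀ b, F (grp R b) = (G b : B) := fun b => by simp [F, grp]
  refine ⟨RingQuot.liftAlgHom R ⟨F, ?_⟩, fun i => ?_⟩
  · intro a b hab
    rcases hab with ⟨h⟩ | ⟨h, h2⟩
    · simp only [map_add, map_sub, map_smul, map_pow, map_one, map_zero, hF, hG]
      rw [pow_succ, pow_two, hcub h]
      simp only [add_mul, sub_mul, smul_mul_assoc, hcub h, one_mul, Units.inv_mul]
      module
    · simp only [map_cubicRHS, map_mul, hF, hG, map_inv, hf h h2]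
  · simp [toK, hF, hG]

end Presentation

end

end Funar

namespace Funar

noncomputable section

open scoped TensorProduct

section Words

variable {R : Type*} [CommRing R]

/-! ### Words, and linear maps that are invariant under reductions -/

theorem w_one : w R 1 = 1 := map_one _

theorem w_mul (A B : Word) : w R (A * B) = w R A * w R B := map_mul _ _ _

/-- All letters of the word have an index that satisfies `S`. -/
def InIdx (S : ℕ → Prop) (W : Word) : Prop := ∀ l ∈ W.toList, S l.1

theorem InIdx.mono {S S' : ℕ → Prop} {W : Word} (h : InIdx S W) (hS : ∀ i, S i → S' i) :
    InIdx S' W := fun l hl => hS _ (h l hl)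

@[simp] theorem inIdx_one (S : ℕ → Prop) : InIdx S 1 := by simp [InIdx]

@[simp] theorem inIdx_mul {S : ℕ → Prop} {A B : Word} :
    InIdx S (A * B) ↔ InIdx S A ∧ InIdx S B := by
  simp only [InIdx, FreeMonoid.toList_mul, List.mem_append]
  exact ⟨fun h => ⟨fun l hl => h l (Or.inl hl), fun l hl => h l (Or.inr hl)⟩,
    fun h l hl => hl.elim (h.1 l) (h.2 l)⟩

@[simp] theorem inIdx_gen {S : ℕ → Prop} {i : ℕ} {e : Bool} : InIdx S (gen i e) ↔ S i := by
  simp [InIdx, gen]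

theorem inIdx_genPow {S : ℕ → Prop} {i : ℕ} {e : SignType} (h : S i) :
    InIdx S (genPow i e) := by
  cases e <;> simp [genPow, h]

theorem word_cases (W : Word) : W = 1 ∨ ∃ i e W', W = gen i e * W' := by
  induction W using FreeMonoid.casesOn with
  | one => exact Or.inl rfl
  | of_mul l W' => exact Or.inr ⟨l.1, l.2, W', rfl⟩

theorem word_induction {P : Word → Prop} (h1 : P 1)
    (h : ∀ i e W, P W → P (gen i e * W)) (W : Word) : P W := by
  induction W using FreeMonoid.recOn with
  | one => exact h1
  | of_mul l W' ih => exact h l.1 l.2 W' ih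

theorem eq_one_of_inIdx {S : ℕ → Prop} (hS : ∀ i, ¬ S i) {W : Word} (h : InIdx S W) : W = 1 := by
  rcases word_cases W with rfl | ⟨i, e, W', rfl⟩
  · rfl
  · exact (hS i (by simpa using (inIdx_mul.mp h).1)).elim

/-- The span of the words that satisfy `p`. -/
def Sp (R : Type*) [CommRing R] (p : Word → Prop) : Submodule R (FA R) :=
  Submodule.span R {X | ∃ W, p W ∧ X = w R W}

theorem w_mem_Sp {p : Word → Prop} {W : Word} (h : p W) : w R W ∈ Sp R p :=
  Submodule.subset_span ⟨W, h, rfl⟩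

theorem w_eq_single (W : Word) : w R W = MonoidAlgebra.single W 1 := rfl

theorem FA_eq_sum (X : FA R) : X = X.coeff.sum fun W a => a • w R W := by
  conv_lhs => rw [← MonoidAlgebra.sum_coeff_single X]
  simp [w_eq_single]

theorem mem_Sp {p : Word → Prop} {X : FA R} : X ∈ Sp R p ↔ ∀ W, X.coeff W ≠ 0 → p W := by
  constructor
  · intro h
    induction h using Submodule.span_induction with
    | mem x hx =>
      obtain ⟨W, hW, rfl⟩ := hx
      intro W' h'
      by_cases hE : W = W'
      · exact hE ▸ hW
      · simp [w_eq_single, hE] at h'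
    | zero => intro W h; simp at h
    | add x y _ _ hx hy =>
      intro W h
      by_cases h1 : x.coeff W = 0
      · exact hy W fun h2 => h (by simp [h1, h2])
      · exact hx W h1
    | smul a x _ hx =>
      intro W h
      exact hx W fun h2 => h (by simp [h2])
  · intro h
    rw [FA_eq_sum X]
    exact Submodule.sum_mem _ fun W hW =>
      Submodule.smul_mem _ _ (w_mem_Sp (h W (Finsupp.mem_support_iff.mp hW)))

theorem Sp_mono {p q : Word → Prop} (h : ∀ W, p W → q W) : Sp R p ≤ Sp R q :=
  fun _ hX => mem_Sp.mpr fun W hW => h W (mem_Sp.mp hX W hW)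

theorem Sp_inf {p q : Word → Prop} {X : FA R} (h1 : X ∈ Sp R p) (h2 : X ∈ Sp R q) :
    X ∈ Sp R fun W => p W ∧ q W :=
  mem_Sp.mpr fun W hW => ⟨mem_Sp.mp h1 W hW, mem_Sp.mp h2 W hW⟩

theorem Sp_le {p : Word → Prop} {P : Submodule R (FA R)} (h : ∀ W, p W → w R W ∈ P) :
    Sp R p ≤ P :=
  Submodule.span_le.mpr fun _ ⟨W, hW, hX⟩ => hX ▸ h W hW

theorem Sp_map_le {p : Word → Prop} {X' : Type*} [AddCommGroup X'] [Module R X']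
    {f : FA R →ₗ[R] X'} {P : Submodule R X'} (h : ∀ W, p W → f (w R W) ∈ P) {X : FA R}
    (hX : X ∈ Sp R p) : f X ∈ P :=
  Sp_le (P := P.comap f) h hX

theorem Sp_eqOn {p : Word → Prop} {X' : Type*} [AddCommGroup X'] [Module R X']
    {f g : FA R →ₗ[R] X'} (h : ∀ W, p W → f (w R W) = g (w R W)) {X : FA R} (hX : X ∈ Sp R p) :
    f X = g X :=
  Sp_le (P := LinearMap.eqLocus f g) h hX

theorem Sp_mul {p q s : Word → Prop} (h : ∀ A B, p A → q B → s (A * B)) {X Y : FA R}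
    (hX : X ∈ Sp R p) (hY : Y ∈ Sp R q) : X * Y ∈ Sp R s := by
  refine Sp_map_le (f := LinearMap.mulRight R Y) (fun A hA => ?_) hX
  refine Sp_map_le (f := LinearMap.mulLeft R (w R A)) (fun B hB => ?_) hY
  rw [LinearMap.mulLeft_apply, ← w_mul]
  exact w_mem_Sp (h A B hA hB)

/-- The linear map on the free algebra with prescribed values on the words. -/
def wlin {X' : Type*} [AddCommGroup X'] [Module R X'] (f : Word → X') : FA R →ₗ[R] X' :=
  (Finsupp.linearCombination R f).comp (MonoidAlgebra.coeffLinearEquiv R).toLinearMap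

@[simp] theorem wlin_w {X' : Type*} [AddCommGroup X'] [Module R X'] (f : Word → X') (W : Word) :
    wlin (R := R) f (w R W) = f W := by
  simp [wlin, w_eq_single]

@[simp] theorem lin_w (f : Word → FA R) (W : Word) : lin f (w R W) = f W := wlin_w f W

theorem FA_hom_ext {X' : Type*} [AddCommGroup X'] [Module R X'] {f g : FA R →ₗ[R] X'}
    (h : ∀ W, f (w R W) = g (w R W)) : f = g := by
  refine LinearMap.ext fun X => ?_
  exact Sp_eqOn (p := fun _ => True) (fun W _ => h W) (mem_Sp.mpr fun _ _ => trivial)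

/-- A linear map which is invariant under elementary reductions of the words in a class that is
closed under elementary reductions is invariant under reductions of all combinations of these
words. -/
theorem reduction_invariant {α β : R} {p : Word → Prop} {X' : Type*} [AddCommGroup X']
    [Module R X'] {f : FA R →ₗ[R] X'}
    (hp : ∀ W Y, p W → WordStep α β W Y → Y ∈ Sp R p ∧ f Y = f (w R W)) {X Y : FA R}
    (hX : X ∈ Sp R p) (h : Relation.ReflTransGen (Step α β) X Y) : Y ∈ Sp R p ∧ f Y = f X := by
  induction h with
  | refl => exact ⟨hX, rfl⟩
  | tail _ hs ih =>
    obtain ⟨W, V, hW, hst, rfl⟩ := hs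
    have hpW := mem_Sp.mp ih.1 W hW
    obtain ⟨h1, h2⟩ := hp W V hpW hst
    refine ⟨Submodule.add_mem _ (Submodule.sub_mem _ ih.1 (Submodule.smul_mem _ _ (w_mem_Sp hpW)))
      (Submodule.smul_mem _ _ h1), ?_⟩
    rw [map_add, map_sub, map_smul, map_smul, h2, ih.2]
    abel

theorem reduced_mem_Sp {α β : R} {X : FA R} (h : Reduced α β X) : X ∈ Sp R (WordReduced α β) :=
  mem_Sp.mpr fun W hW ⟨Y, hY⟩ => h ⟨_, W, Y, hW, hY, rfl⟩

theorem cubicRHS_mem {B : Type*} [Ring B] [Algebra R B] (P : Subalgebra R B) {α β : R}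
    {x xb y yb : B} (hx : x ∈ P) (hxb : xb ∈ P) (hy : y ∈ P) (hyb : yb ∈ P) :
    cubicRHS α β x xb y yb ∈ P := by
  have := (cubicRHS α β (⟨x, hx⟩ : P) ⟨xb, hxb⟩ ⟨y, hy⟩ ⟨yb, hyb⟩).2
  rwa [← P.coe_val, map_cubicRHS] at this

/-- The span of a class of words that is closed under multiplication, as a subalgebra. -/
def idxAlg (R : Type*) [CommRing R] (S : ℕ → Prop) : Subalgebra R (FA R) :=
  (Sp R (InIdx S)).toSubalgebra (by rw [← w_one]; exact w_mem_Sp (inIdx_one S))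
    fun _ _ hX hY => Sp_mul (fun _ _ h1 h2 => inIdx_mul.mpr ⟨h1, h2⟩) hX hY

theorem mem_idxAlg {S : ℕ → Prop} {X : FA R} : X ∈ idxAlg R S ↔ X ∈ Sp R (InIdx S) := Iff.rfl

theorem gen_mem_idxAlg {S : ℕ → Prop} {i : ℕ} (h : S i) (e : Bool) :
    w R (gen i e) ∈ idxAlg R S := mem_idxAlg.mpr (w_mem_Sp (inIdx_gen.mpr h))

theorem TripleRepl.mem {α β : R} {S : ℕ → Prop} {i : ℕ} {e₁ e₂ e₃ : Bool} {V : FA R}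
    (h : TripleRepl α β i e₁ e₂ e₃ V) (h0 : S i) (h1 : S (i + 1)) : V ∈ idxAlg R S := by
  cases h with
  | braid e₁ e₂ e₃ _ => exact w_mem_Sp (by simp [h0, h1])
  | pos => apply cubicRHS_mem <;> exact gen_mem_idxAlg (by assumption) _
  | neg => apply cubicRHS_mem <;> exact gen_mem_idxAlg (by assumption) _

theorem BasicRepl.mem {α β : R} {S : ℕ → Prop} {U : Word} {V : FA R} (h : BasicRepl α β U V)
    (hU : InIdx S U) : V ∈ idxAlg R S := by
  cases h with
  | cancel i e => exact one_mem _
  | sq i =>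
    have hi : S i := by simpa using hU
    exact add_mem (sub_mem (Subalgebra.smul_mem _ (gen_mem_idxAlg hi _) _)
      (Subalgebra.smul_mem _ (one_mem _) _)) (gen_mem_idxAlg hi _)
  | sqInv i =>
    have hi : S i := by simpa using hU
    exact add_mem (sub_mem (Subalgebra.smul_mem _ (gen_mem_idxAlg hi _) _)
      (Subalgebra.smul_mem _ (one_mem _) _)) (gen_mem_idxAlg hi _)
  | triple i e₁ e₂ e₃ V h =>
    simp only [inIdx_mul, inIdx_gen] at hU
    exact h.mem hU.1.2 hU.2
  | tripleFar i e₁ e₂ e₃ V h W hW =>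
    simp only [inIdx_mul, inIdx_gen] at hU
    exact mul_mem (h.mem hU.1.1.2 hU.2) (w_mem_Sp hU.1.2)
  | comm i j h e₁ e₂ =>
    simp only [inIdx_mul, inIdx_gen] at hU
    exact w_mem_Sp (by simp [hU])

theorem WordStep.mem {α β : R} {S : ℕ → Prop} {W : Word} {Y : FA R} (h : WordStep α β W Y)
    (hW : InIdx S W) : Y ∈ Sp R (InIdx S) := by
  obtain ⟨A, U, B, V, hUV, rfl, rfl⟩ := h
  simp only [inIdx_mul] at hW
  exact mul_mem (S := Subalgebra R (FA R)) (s := idxAlg R S)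
    (mul_mem (w_mem_Sp hW.1.1) (hUV.mem hW.1.2)) (w_mem_Sp hW.2)

/-! ### Change of indices -/

/-- The change of the index `i` of every letter to `i + a - b`. -/
def reidx (a b : ℕ) : Word →* Word := FreeMonoid.map fun l => (l.1 + a - b, l.2)

/-- The change of indices `reidx`, on the free algebra. -/
def reidxA (R : Type*) [CommRing R] (a b : ℕ) : FA R →ₐ[R] FA R :=
  MonoidAlgebra.mapDomainAlgHom R R (reidx a b)

@[simp] theorem reidxA_w (a b : ℕ) (W : Word) : reidxA R a b (w R W) = w R (reidx a b W) := by
  simp [reidxA, w_eq_single]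

@[simp] theorem reidx_gen (a b i : ℕ) (e : Bool) : reidx a b (gen i e) = gen (i + a - b) e := rfl

theorem reidx_genPow (a b i : ℕ) (e : SignType) :
    reidx a b (genPow i e) = genPow (i + a - b) e := by cases e <;> simp [genPow]

theorem sh_w (W : Word) : sh R (w R W) = w R (shWord W) := by
  simp [sh, w_eq_single]

@[simp] theorem shWord_gen (i : ℕ) (e : Bool) : shWord (gen i e) = gen (i + 1) e := rfl

theorem shWord_genPow (i : ℕ) (e : SignType) : shWord (genPow i e) = genPow (i + 1) e := by
  cases e <;> simp [genPow]

theorem reidx_sh (a b : ℕ) (W : Word) : reidx a b (shWord W) = reidx (a + 1) b W := by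
  induction W using word_induction with
  | h1 => simp
  | h i e W ih =>
    simp only [map_mul, ih, shWord_gen, reidx_gen]
    rw [show i + 1 + a - b = i + (a + 1) - b by omega]

theorem reidxA_sh (a b : ℕ) (X : FA R) : reidxA R a b (sh R X) = reidxA R (a + 1) b X := by
  have : (reidxA R a b).toLinearMap.comp (sh R).toLinearMap = (reidxA R (a + 1) b).toLinearMap :=
    FA_hom_ext fun W => by
      simp only [LinearMap.comp_apply, AlgHom.toLinearMap_apply, sh_w, reidxA_w, reidx_sh]
  exact DFunLike.congr_fun this X

theorem inIdx_reidx {S : ℕ → Prop} {a b : ℕ} {W : Word} :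
    InIdx S (reidx a b W) ↔ InIdx (fun i => S (i + a - b)) W := by
  induction W using word_induction with
  | h1 => simp
  | h i e W ih => simp [ih]

theorem inIdx_sh {S : ℕ → Prop} {W : Word} :
    InIdx S (shWord W) ↔ InIdx (fun i => S (i + 1)) W := by
  induction W using word_induction with
  | h1 => simp
  | h i e W ih => simp [ih]

theorem reidx_self (a : ℕ) (W : Word) : reidx a a W = W := by
  induction W using word_induction with
  | h1 => simp
  | h i e W ih => simp [ih]

theorem reidxA_self (a : ℕ) (X : FA R) : reidxA R a a X = X := by
  have : (reidxA R a a).toLinearMap = LinearMap.id :=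
    FA_hom_ext fun W => by simp [reidx_self]
  exact DFunLike.congr_fun this X

theorem TripleRepl.reidx {α β : R} {i : ℕ} {e₁ e₂ e₃ : Bool} {V : FA R} {a b : ℕ}
    (h : TripleRepl α β i e₁ e₂ e₃ V) (hb : b ≤ i + a) :
    TripleRepl α β (i + a - b) e₁ e₂ e₃ (reidxA R a b V) := by
  have e1 : i + 1 + a - b = i + a - b + 1 := by omega
  cases h with
  | braid e₁ e₂ e₃ h => simpa [e1] using TripleRepl.braid (i := i + a - b) e₁ e₂ e₃ h
  | pos => simpa [map_cubicRHS, e1] using TripleRepl.pos (α := α) (β := β) (i := i + a - b)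
  | neg => simpa [map_cubicRHS, e1] using TripleRepl.neg (α := α) (β := β) (i := i + a - b)

theorem BasicRepl.reidx {α β : R} {U : Word} {V : FA R} {a b : ℕ} (h : BasicRepl α β U V)
    (hU : InIdx (fun i => b ≤ i + a) U) : BasicRepl α β (reidx a b U) (reidxA R a b V) := by
  cases h with
  | cancel i e => simpa using BasicRepl.cancel (α := α) (β := β) (i + a - b) e
  | sq i => simpa using BasicRepl.sq (α := α) (β := β) (i + a - b)
  | sqInv i => simpa using BasicRepl.sqInv (α := α) (β := β) (i + a - b)
  | triple i e₁ e₂ e₃ V h =>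
    simp only [inIdx_mul, inIdx_gen] at hU
    have e1 : i + 1 + a - b = i + a - b + 1 := by omega
    simpa [e1] using BasicRepl.triple (i + a - b) e₁ e₂ e₃ _ (h.reidx hU.1.2)
  | tripleFar i e₁ e₂ e₃ V h W hW =>
    simp only [inIdx_mul, inIdx_gen] at hU
    have e1 : i + 1 + a - b = i + a - b + 1 := by omega
    have hW' : IdxLT (i + a - b) (Funar.reidx a b W) := by
      refine inIdx_reidx (S := (· < i + a - b)).mpr fun l hl => ?_
      have := hW l hl
      have := hU.1.2 l hl
      simp only at *
      omega
    simpa [e1] using BasicRepl.tripleFar (i + a - b) e₁ e₂ e₃ _ (h.reidx hU.1.1.2) _ hW'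
  | comm i j h e₁ e₂ =>
    simp only [inIdx_mul, inIdx_gen] at hU
    simpa using BasicRepl.comm (α := α) (β := β) (i + a - b) (j + a - b) (by omega) e₁ e₂

theorem WordStep.reidx {α β : R} {W : Word} {Y : FA R} {a b : ℕ} (h : WordStep α β W Y)
    (hW : InIdx (fun i => b ≤ i + a) W) : WordStep α β (reidx a b W) (reidxA R a b Y) := by
  obtain ⟨A, U, B, V, hUV, rfl, rfl⟩ := h
  simp only [inIdx_mul] at hW
  exact ⟨Funar.reidx a b A, _, Funar.reidx a b B, _, hUV.reidx hW.1.2, by simp, by simp⟩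

/-! ### Classes of words in `K n` -/

/-- The class in `K n` of an element of the free algebra, where generators that do not exist in
`K n` are replaced by `1`. -/
def cls (α β : R) (n : ℕ) : FA R →ₐ[R] K α β n :=
  MonoidAlgebra.lift R (K α β n) Word (FreeMonoid.lift fun l => sK α β n l.1 l.2)

theorem cls_gen (α β : R) (n i : ℕ) (e : Bool) : cls α β n (w R (gen i e)) = sK α β n i e := by
  simp [cls, w_eq_single, gen]

theorem cls_mul (α β : R) (n : ℕ) (A B : Word) :
    cls α β n (w R (A * B)) = cls α β n (w R A) * cls α β n (w R B) := by
  rw [w_mul, map_mul]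

theorem cls_one (α β : R) (n : ℕ) : cls α β n (w R 1) = 1 := by
  rw [w_one, map_one]

theorem cls_commute (α β : R) (n : ℕ) {A B : Word}
    (h : ∀ l ∈ A.toList, InIdx (fun i => l.1 + 1 < i) B) :
    Commute (cls α β n (w R A)) (cls α β n (w R B)) := by
  induction A using word_induction with
  | h1 => rw [cls_one]; exact Commute.one_left _
  | h i e A ih =>
    rw [cls_mul, cls_gen]
    refine Commute.mul_left ?_ (ih fun l hl => h l (by simp [hl]))
    have hi := h (i, e) (by simp [gen])
    clear h ih
    induction B using word_induction with
    | h1 => rw [cls_one]; exact Commute.one_right _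
    | h j f B ih' =>
      simp only [inIdx_mul, inIdx_gen] at hi
      rw [cls_mul, cls_gen]
      exact Commute.mul_right (sK_comm α β n hi.1 _ _) (ih' hi.2)

theorem cls_commute_of_lt (α β : R) (n m : ℕ) {A B : Word}
    (hA : InIdx (fun i => i + 1 < m) A) (hB : InIdx (fun i => m ≤ i) B) :
    Commute (cls α β n (w R A)) (cls α β n (w R B)) :=
  cls_commute α β n fun l hl => hB.mono fun _ hi => (hA l hl).trans_le hi

theorem cls_triple {α β : R} {n i : ℕ} {e₁ e₂ e₃ : Bool} {V : FA R}
    (h : TripleRepl α β i e₁ e₂ e₃ V) (hi : i + 2 < n) :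
    cls α β n (w R (gen (i + 1) e₁ * gen i e₂ * gen (i + 1) e₃)) = cls α β n V := by
  cases h with
  | braid e₁ e₂ e₃ h =>
    simp only [cls_mul, cls_gen, sK, ← toK_mul, sigmaPow_braid_signs hi _ _ _ h]
  | pos =>
    simp only [map_cubicRHS, cls_mul, cls_gen]
    exact sK_funar α β hi
  | neg =>
    simp only [map_cubicRHS, cls_mul, cls_gen]
    exact sK_funar_inv α β hi

theorem cls_basic {α β : R} {n : ℕ} {U : Word} {V : FA R} (h : BasicRepl α β U V)
    (hU : InIdx (fun i => i + 1 < n) U) : cls α β n (w R U) = cls α β n V := by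
  cases h with
  | cancel i e => rw [cls_mul, cls_gen, cls_gen, sK_mul_not, map_one]
  | sq i =>
    simp only [inIdx_mul, inIdx_gen] at hU
    simp only [cls_mul, map_add, map_sub, map_smul, map_one, cls_gen]
    exact sK_sq α β hU.1
  | sqInv i =>
    simp only [inIdx_mul, inIdx_gen] at hU
    simp only [cls_mul, map_add, map_sub, map_smul, map_one, cls_gen]
    exact sK_sq_inv α β hU.1
  | triple i e₁ e₂ e₃ V h =>
    simp only [inIdx_mul, inIdx_gen] at hU
    exact cls_triple h hU.2
  | tripleFar i e₁ e₂ e₃ V h W hW =>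
    simp only [inIdx_mul, inIdx_gen] at hU
    have hc : Commute (cls α β n (w R W)) (cls α β n (w R (gen (i + 1) e₃))) :=
      cls_commute_of_lt α β n (i + 1) (InIdx.mono (S := (· < i)) hW fun j h => by omega) (by simp)
    rw [cls_mul, cls_mul, mul_assoc, hc.eq, ← mul_assoc, ← cls_mul, cls_triple h hU.2, map_mul]
  | comm i j h e₁ e₂ =>
    rw [cls_mul, cls_mul]
    exact (cls_commute_of_lt α β n j (by simpa using h) (by simp)).eq.symm

theorem cls_wordStep {α β : R} {n : ℕ} {W : Word} {Y : FA R} (h : WordStep α β W Y)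
    (hW : InIdx (fun i => i + 1 < n) W) : cls α β n Y = cls α β n (w R W) := by
  obtain ⟨A, U, B, V, hUV, rfl, rfl⟩ := h
  simp only [inIdx_mul] at hW
  rw [map_mul, map_mul, ← cls_basic hUV hW.1.2, cls_mul, cls_mul]

theorem cls_eq_one_sK (α β : R) (n i : ℕ) (e : Bool) (h : ¬ i + 1 < n) : sK α β n i e = 1 := by
  simp [sK, sigmaPow, h, toK_one]

/-- `K n` is spanned by the classes of the words in the generators that exist in `K n`. -/
theorem span_cls (α β : R) (n : ℕ) :
    Submodule.span R {k | ∃ W, InIdx (fun i => i + 1 < n) W ∧ k = cls α β n (w R W)} = ⊤ := by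
  have hinv : ∀ W : Word, ∃ W', InIdx (fun i => i + 1 < n) W' ∧
      cls α β n (w R W) = cls α β n (w R W') := by
    intro W
    induction W using word_induction with
    | h1 => exact ⟨1, by simp, rfl⟩
    | h i e W ih =>
      obtain ⟨W', h1, h2⟩ := ih
      by_cases hi : i + 1 < n
      · exact ⟨gen i e * W', by simp [hi, h1], by rw [cls_mul, cls_mul, h2]⟩
      · exact ⟨W', h1, by rw [cls_mul, cls_gen, cls_eq_one_sK _ _ _ _ _ hi, one_mul, h2]⟩
  have hg : ∀ g : BraidGroup n, ∃ W : Word, toK α β n g = cls α β n (w R W) := by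
    intro g
    have hgen : ∀ (i : GenIdx n) e, toK α β n (bif e then sigma i else (sigma i)⁻¹) =
        cls α β n (w R (gen i.1 e)) := fun i e => by
      rw [cls_gen]; simp [sK, sigmaPow, i.2]
    obtain ⟨g, rfl⟩ := PresentedGroup.mk_surjective _ g
    induction g using FreeGroup.induction_on with
    | C1 => exact ⟨1, by rw [cls_one, map_one, toK_one]⟩
    | of i => exact ⟨_, hgen i true⟩
    | inv_of i _ =>
      refine ⟨_, Eq.trans ?_ (hgen i false)⟩
      simp [sigma, PresentedGroup.of]
    | mul a b ha hb =>
      obtain ⟨A, hA⟩ := ha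
      obtain ⟨B, hB⟩ := hb
      exact ⟨A * B, by rw [map_mul, toK_mul, cls_mul, hA, hB]⟩
  rw [eq_top_iff]
  rintro k -
  obtain ⟨x, rfl⟩ := RingQuot.mkAlgHom_surjective R (KRel α β n) k
  induction x using MonoidAlgebra.induction_linear with
  | zero => simp
  | add f g hf hg => rw [map_add]; exact add_mem hf hg
  | single g a =>
    have : (MonoidAlgebra.single g a : MonoidAlgebra R (BraidGroup n)) = a • grp R g := by
      simp [grp]
    rw [this, map_smul]
    refine Submodule.smul_mem _ _ (Submodule.subset_span ?_)
    obtain ⟨W, hW⟩ := hg g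
    obtain ⟨W', h1, h2⟩ := hinv W
    exact ⟨W', h1, by rw [← h2, ← hW]; rfl⟩

theorem kMap_sK (α β : R) {m n : ℕ} (h : m ≤ n) {i : ℕ} (hi : i + 1 < m) (e : Bool) :
    kMap α β h (sK α β m i e) = sK α β n i e := by
  rw [sK, kMap_toK, sK]
  congr 1
  cases e <;> simp [sigmaPow, hi, hi.trans_le h, GenIdx.cast]

theorem kMap_cls (α β : R) {m n : ℕ} (h : m ≤ n) {X : FA R}
    (hX : X ∈ Sp R (InIdx fun i => i + 1 < m)) :
    kMap α β h (cls α β m X) = cls α β n X := by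
  refine Sp_eqOn (f := (kMap α β h).toLinearMap.comp (cls α β m).toLinearMap)
    (g := (cls α β n).toLinearMap) (fun W hW => ?_) hX
  simp only [LinearMap.comp_apply, AlgHom.toLinearMap_apply]
  induction W using word_induction with
  | h1 => simp [cls_one]
  | h i e W ih =>
    simp only [inIdx_mul, inIdx_gen] at hW
    rw [cls_mul, map_mul, ih hW.2, cls_gen, kMap_sK α β h hW.1, cls_mul, cls_gen]

end Words

end

end Funar

namespace Funar

noncomputable section

open scoped TensorProduct

section ReducedWords

variable {R : Type*} [CommRing R]

/-! ### Reduced words contain the top generator at most once -/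

/-- The number of letters of a word with index `N`. -/
def xc (N : ℕ) (W : Word) : ℕ := W.toList.countP fun l => l.1 = N

@[simp] theorem xc_one (N : ℕ) : xc N 1 = 0 := rfl

@[simp] theorem xc_mul (N : ℕ) (A B : Word) : xc N (A * B) = xc N A + xc N B := by
  simp [xc]

theorem xc_gen (N i : ℕ) (e : Bool) : xc N (gen i e) = if i = N then 1 else 0 := by
  simp [xc, gen, List.countP_singleton]

@[simp] theorem xc_gen_self (N : ℕ) (e : Bool) : xc N (gen N e) = 1 := by simp [xc_gen]

theorem xc_eq_zero {N : ℕ} {W : Word} : xc N W = 0 ↔ InIdx (· ≠ N) W := by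
  simp [xc, InIdx, List.countP_eq_zero]

theorem xc_eq_zero_of {N : ℕ} {S : ℕ → Prop} {W : Word} (h : InIdx S W) (hN : ∀ i, S i → i ≠ N) :
    xc N W = 0 := xc_eq_zero.mpr (h.mono hN)

theorem inIdx_lt_of_xc {N : ℕ} {W : Word} (h : InIdx (· < N + 1) W) (h0 : xc N W = 0) :
    InIdx (· < N) W := fun l hl => by
  have h1 := h l hl
  have h2 := xc_eq_zero.mp h0 l hl
  simp only at h1 h2
  omega

theorem xc_genPow_ne {N i : ℕ} (h : i ≠ N) (e : SignType) : xc N (genPow i e) = 0 := by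
  cases e <;> simp [genPow, xc_gen, h]

theorem exists_split {N : ℕ} : ∀ {W : Word}, 0 < xc N W → ∃ A e B, W = A * gen N e * B ∧
    xc N A = 0 ∧ xc N W = xc N B + 1 := by
  intro W
  induction W using word_induction with
  | h1 => simp
  | h i e W ih =>
    intro h
    by_cases hi : i = N
    · subst hi
      exact ⟨1, e, W, by simp, by simp, by simp; omega⟩
    · have h' : 0 < xc N W := by simpa [xc_gen, hi] using h
      obtain ⟨A, f, B, rfl, h1, h2⟩ := ih h'
      exact ⟨gen i e * A, f, B, by simp [mul_assoc], by simp [xc_gen, hi, h1],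
        by simp [xc_gen, hi] at h2 ⊢; omega⟩

theorem WordReduced.of_mul {α β : R} {A U B : Word} (h : WordReduced α β (A * U * B)) :
    WordReduced α β U := by
  rintro ⟨Y, A', U', B', V, h1, rfl, rfl⟩
  exact h ⟨_, A * A', U', B' * B, V, h1, by simp [mul_assoc], rfl⟩

theorem wordReduced_not_basic {α β : R} {A U B : Word} {V : FA R}
    (h : WordReduced α β (A * U * B)) (hU : BasicRepl α β U V) : False :=
  h ⟨_, A, U, B, V, hU, rfl, rfl⟩

theorem exists_tripleRepl (α β : R) (i : ℕ) (e₁ e₂ e₃ : Bool) :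
    ∃ V, TripleRepl α β i e₁ e₂ e₃ V := by
  by_cases h : e₂ = e₁ ∨ e₂ = e₃
  · exact ⟨_, TripleRepl.braid e₁ e₂ e₃ h⟩
  · cases e₁ <;> cases e₂ <;> cases e₃ <;> simp at h
    · exact ⟨_, TripleRepl.neg⟩
    · exact ⟨_, TripleRepl.pos⟩

/-- Consider the word between two neighbouring letters of top index `N`. If it is empty, then the two
letters can be replaced; if it starts with a letter of index less than `N - 1`, then this letter can
be moved to the left; otherwise it has no further letter of index `N - 1`, by induction, and the
replacement of a triple applies. -/
theorem WordReduced.xc_le_one {α β : R} : ∀ {N : ℕ} {W : Word}, WordReduced α β W →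
    InIdx (· < N + 1) W → xc N W ≤ 1 := by
  intro N
  induction N with
  | zero =>
    intro W hW hN
    by_contra hc
    obtain ⟨A, e, B, rfl, hA, h1⟩ := exists_split (N := 0) (W := W) (by omega)
    obtain ⟨B, f, C, rfl, hB, -⟩ := exists_split (N := 0) (W := B) (by omega)
    simp only [inIdx_mul] at hN
    have : B = 1 := eq_one_of_inIdx (S := (· < 0)) (by simp) (inIdx_lt_of_xc hN.2.1.1 hB)
    subst this
    have hW' : WordReduced α β (A * (gen 0 e * gen 0 f) * C) := by simpa [mul_assoc] using hW
    cases e <;> cases f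
    · exact wordReduced_not_basic hW' (BasicRepl.sqInv 0)
    · exact wordReduced_not_basic hW' (BasicRepl.cancel 0 false)
    · exact wordReduced_not_basic hW' (BasicRepl.cancel 0 true)
    · exact wordReduced_not_basic hW' (BasicRepl.sq 0)
  | succ N ih =>
    intro W hW hN
    by_contra hc
    obtain ⟨A, e, B, rfl, hA, h1⟩ := exists_split (N := N + 1) (W := W) (by omega)
    obtain ⟨B, f, C, rfl, hB, -⟩ := exists_split (N := N + 1) (W := B) (by omega)
    simp only [inIdx_mul] at hN
    have hBlt : InIdx (· < N + 1) B := inIdx_lt_of_xc hN.2.1.1 hB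
    rcases word_cases B with rfl | ⟨j, g, B, rfl⟩
    · have hW' : WordReduced α β (A * (gen (N + 1) e * gen (N + 1) f) * C) := by
        simpa [mul_assoc] using hW
      cases e <;> cases f
      · exact wordReduced_not_basic hW' (BasicRepl.sqInv _)
      · exact wordReduced_not_basic hW' (BasicRepl.cancel _ false)
      · exact wordReduced_not_basic hW' (BasicRepl.cancel _ true)
      · exact wordReduced_not_basic hW' (BasicRepl.sq _)
    · simp only [inIdx_mul, inIdx_gen] at hBlt
      by_cases hj : j = N
      · subst hj
        have hr : WordReduced α β (gen j g * B) := by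
          refine WordReduced.of_mul (A := A * gen (j + 1) e) (B := gen (j + 1) f * C) ?_
          simpa [mul_assoc] using hW
        have hx := ih hr (inIdx_mul.mpr ⟨by simp, hBlt.2⟩)
        have hlt : IdxLT j B := inIdx_lt_of_xc hBlt.2 (by simp at hx; omega)
        obtain ⟨V, hV⟩ := exists_tripleRepl α β j e g f
        have hW' : WordReduced α β (A * (gen (j + 1) e * gen j g * B * gen (j + 1) f) * C) := by
          simpa [mul_assoc] using hW
        exact wordReduced_not_basic hW' (BasicRepl.tripleFar j e g f V hV B hlt)
      · have hW' : WordReduced α β (A * (gen (N + 1) e * gen j g) * (B * gen (N + 1) f * C)) := by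
          simpa [mul_assoc] using hW
        exact wordReduced_not_basic hW' (BasicRepl.comm j (N + 1) (by omega) e g)

/-! ### Properties of a reduction map -/

variable {α β : R} {r : Word → FA R}

theorem IsReductionMap.invariant (hr : IsReductionMap α β r) {p : Word → Prop} {X' : Type*}
    [AddCommGroup X'] [Module R X'] {f : FA R →ₗ[R] X'}
    (hp : ∀ W Y, p W → WordStep α β W Y → Y ∈ Sp R p ∧ f Y = f (w R W)) {W : Word} (hW : p W) :
    r W ∈ Sp R p ∧ f (r W) = f (w R W) :=
  reduction_invariant hp (w_mem_Sp hW) (hr W).1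

theorem IsReductionMap.reduced (hr : IsReductionMap α β r) (W : Word) :
    r W ∈ Sp R (WordReduced α β) := reduced_mem_Sp (hr W).2

theorem IsReductionMap.mem (hr : IsReductionMap α β r) {S : ℕ → Prop} {W : Word}
    (hW : InIdx S W) : r W ∈ Sp R (InIdx S) :=
  (hr.invariant (f := (0 : FA R →ₗ[R] R)) (fun _ _ h hs => ⟨hs.mem h, rfl⟩) hW).1

/-- The indices which `reidx a b` moves to indices of generators of `K n`. -/
def Fits (a b n : ℕ) (i : ℕ) : Prop := b ≤ i + a ∧ i + a - b + 1 < n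

theorem IsReductionMap.cls_reidx (hr : IsReductionMap α β r) {a b n : ℕ} {W : Word}
    (hW : InIdx (Fits a b n) W) :
    cls α β n (reidxA R a b (r W)) = cls α β n (w R (reidx a b W)) := by
  have := (hr.invariant (p := InIdx (Fits a b n))
    (f := (cls α β n).toLinearMap.comp (reidxA R a b).toLinearMap) (fun W Y h hs => ⟨hs.mem h, ?_⟩)
    hW).2
  · simpa using this
  · simp only [LinearMap.comp_apply, AlgHom.toLinearMap_apply, reidxA_w]
    exact cls_wordStep (hs.reidx (h.mono fun i hi => hi.1)) (inIdx_reidx.mpr (h.mono fun i hi => hi.2))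

theorem IsReductionMap.cls_eq (hr : IsReductionMap α β r) {n : ℕ} {W : Word}
    (hW : InIdx (fun i => i + 1 < n) W) : cls α β n (r W) = cls α β n (w R W) := by
  simpa [reidxA_self, reidx_self] using
    hr.cls_reidx (a := 0) (b := 0) (hW.mono fun i hi => ⟨Nat.zero_le _, hi⟩)

theorem IsReductionMap.top (hr : IsReductionMap α β r) {N : ℕ} {W : Word}
    (hW : InIdx (· < N + 1) W) : r W ∈ Sp R fun W => xc N W ≤ 1 :=
  Sp_mono (fun _ h => h.2.xc_le_one h.1) (Sp_inf (hr.mem hW) (hr.reduced W))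

/-- A word in which the index `N` occurs at most once. -/
theorem exists_genPow_split {N : ℕ} {W : Word} (h : xc N W ≤ 1) :
    ∃ A e B, W = A * genPow N e * B ∧ xc N A = 0 ∧ xc N B = 0 := by
  rcases Nat.eq_zero_or_pos (xc N W) with h0 | h0
  · exact ⟨W, 0, 1, by change W = W * 1 * 1; simp, h0, by simp⟩
  · obtain ⟨A, e, B, rfl, hA, h1⟩ := exists_split h0
    exact ⟨A, bif e then 1 else -1, B, by cases e <;> rfl, hA, by omega⟩

/-- Every word in the first `j + 1` generators is equal in `K n` to a combination of words which
contain the last of these generators at most once. -/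
theorem cls_mem_span_mid (hr : IsReductionMap α β r) {n j : ℕ} (hj : j + 1 < n) {W : Word}
    (hW : InIdx (· < j + 1) W) :
    cls α β n (w R W) ∈ Submodule.span R {k | ∃ A B e, InIdx (· < j) A ∧ InIdx (· < j) B ∧
      k = cls α β n (w R (A * genPow j e * B))} := by
  rw [← hr.cls_eq (hW.mono fun i hi => by omega)]
  refine Sp_map_le (f := (cls α β n).toLinearMap) (fun W' h => ?_) (Sp_inf (hr.mem hW) (hr.top hW))
  obtain ⟨A, e, B, rfl, hA, hB⟩ := exists_genPow_split h.2
  simp only [inIdx_mul] at h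
  exact Submodule.subset_span
    ⟨A, B, e, inIdx_lt_of_xc h.1.1.1 hA, inIdx_lt_of_xc h.1.2 hB, rfl⟩

/-- `DescWord m D` says that the letters of `D` have the indices `m - 1, m - 2, …` down to some
index; the word may be empty. -/
inductive DescWord : ℕ → Word → Prop
  | one (m : ℕ) : DescWord m 1
  | cons (m : ℕ) (e : Bool) (D : Word) (h : DescWord m D) : DescWord (m + 1) (gen m e * D)

theorem DescWord.inIdx {m : ℕ} {D : Word} (h : DescWord m D) : InIdx (· < m) D := by
  induction h with
  | one m => simp
  | cons m e D h ih => simpa using ih.mono fun i hi => by omega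

theorem DescWord.genPow_mul {m : ℕ} {D : Word} (h : DescWord m D) (e : SignType) :
    ∃ A D', genPow m e * D = A * D' ∧ InIdx (· < m) A ∧ DescWord (m + 1) D' := by
  cases e with
  | zero => exact ⟨D, 1, by change 1 * D = D * 1; simp, h.inIdx, DescWord.one _⟩
  | pos => exact ⟨1, _, (one_mul _).symm, by simp, DescWord.cons m true D h⟩
  | neg => exact ⟨1, _, (one_mul _).symm, by simp, DescWord.cons m false D h⟩

theorem cls_mem_span_desc (hr : IsReductionMap α β r) {n : ℕ} : ∀ {j : ℕ}, j < n →
    ∀ {W : Word}, InIdx (· < j) W →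
    cls α β n (w R W) ∈ Submodule.span R {k | ∃ A D, InIdx (· + 1 < j) A ∧ DescWord j D ∧
      k = cls α β n (w R (A * D))} := by
  intro j
  induction j with
  | zero =>
    intro _ W hW
    rw [eq_one_of_inIdx (by simp) hW]
    exact Submodule.subset_span ⟨1, 1, by simp, DescWord.one _, by simp⟩
  | succ j ih =>
    intro hj W hW
    refine Submodule.span_le.mpr ?_ (cls_mem_span_mid hr hj hW)
    rintro _ ⟨A, B, e, hA, hB, rfl⟩
    have hB' := ih (by omega) hB
    rw [cls_mul]
    generalize cls α β n (w R B) = b at hB'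
    induction hB' using Submodule.span_induction with
    | mem k hk =>
      obtain ⟨A', D, hA', hD, rfl⟩ := hk
      obtain ⟨A'', D', h1, h2, h3⟩ := hD.genPow_mul e
      have hc : Commute (cls α β n (w R (genPow j e))) (cls α β n (w R A')) :=
        (cls_commute_of_lt α β n j hA' (inIdx_genPow le_rfl)).symm
      refine Submodule.subset_span ⟨A * A' * A'', D', ?_, h3, ?_⟩
      · simp only [inIdx_mul]
        exact ⟨⟨hA.mono fun i hi => by omega, hA'.mono fun i hi => by omega⟩,
          h2.mono fun i hi => by omega⟩
      · rw [mul_assoc _ A'', ← h1]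
        simp only [cls_mul, mul_assoc]
        rw [← mul_assoc _ (cls α β n (w R A')), hc.eq, mul_assoc]
    | zero => simp
    | add x y _ _ hx hy => simp only [mul_add]; exact add_mem hx hy
    | smul a x _ hx => simp only [mul_smul_comm]; exact Submodule.smul_mem _ _ hx

end ReducedWords

/-! ### Markov families of traces -/

section Markov

variable {R : Type*} [CommRing R]

/-- The factor of a Markov trace for a generator to the power `1`, `0` or `-1`. -/
def mu (u v : R) : SignType → R
  | .zero => 1
  | .pos => u
  | .neg => v

theorem takeWhile_append_of_xc {N : ℕ} {A B : Word} (hA : xc N A = 0) (e : Bool) :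
    (A * gen N e * B).toList.takeWhile (fun l => l.1 + 2 ≠ N + 2) = A.toList ∧
      (A * gen N e * B).toList.dropWhile (fun l => l.1 + 2 ≠ N + 2) = (N, e) :: B.toList := by
  have h : ∀ l ∈ A.toList, (decide (l.1 + 2 ≠ N + 2)) = true := fun l hl => by
    have := xc_eq_zero.mp hA l hl
    simpa using this
  have e1 : (A * gen N e * B).toList = A.toList ++ (N, e) :: B.toList := by simp [gen]
  rw [e1, List.takeWhile_append_of_pos h, List.dropWhile_append_of_pos h]
  simp

theorem tauWord_free (r : Word → FA R) (u v : R) {N : ℕ} {W : Word} (h : xc N W = 0) :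
    tauWord r u v (N + 2) W = w R W := by
  have : W.toList.dropWhile (fun l => l.1 + 2 ≠ N + 2) = [] := by
    rw [List.dropWhile_eq_nil_iff]
    intro l hl
    have := xc_eq_zero.mp h l hl
    simpa using this
  rw [tauWord, this]

theorem tauWord_mid (r : Word → FA R) (u v : R) {N : ℕ} {A B : Word} (hA : xc N A = 0)
    (e : Bool) :
    tauWord r u v (N + 2) (A * gen N e * B) = (bif e then u else v) • r (A * B) := by
  obtain ⟨h1, h2⟩ := takeWhile_append_of_xc (B := B) hA e
  rw [tauWord, h1, h2]
  simp

theorem tauN_w (r : Word → FA R) (u v : R) (n : ℕ) (W : Word) :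
    tauN r u v n (w R W) = lin (tauWord r u v n) (r W) := by
  simp [tauN]

variable {α β u v : R} {r : Word → FA R}

theorem tauN_reduced (hr : IsReductionMap α β r) (N : ℕ) (X : FA R) :
    tauN r u v (N + 2) X ∈ Sp R (WordReduced α β) := by
  have hX : X ∈ Sp R fun _ => True := mem_Sp.mpr fun _ _ => trivial
  refine Sp_map_le (fun W _ => ?_) hX
  rw [tauN_w]
  refine Sp_map_le (fun W' hW' => ?_) (hr.reduced W)
  rw [lin_w]
  rcases Nat.eq_zero_or_pos (xc N W') with h0 | h0
  · rw [tauWord_free r u v h0]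
    exact w_mem_Sp hW'
  · obtain ⟨A, e, B, rfl, hA, h1⟩ := exists_split h0
    rw [tauWord_mid r u v hA]
    exact Submodule.smul_mem _ _ (hr.reduced _)

theorem tauN_mem (hr : IsReductionMap α β r) {N : ℕ} {S : ℕ → Prop} {X : FA R}
    (hX : X ∈ Sp R (InIdx fun i => S i ∧ i < N + 1)) :
    tauN r u v (N + 2) X ∈ Sp R (InIdx fun i => S i ∧ i < N) := by
  refine Sp_map_le (fun W hW => ?_) hX
  rw [tauN_w]
  refine Sp_map_le (fun W' hW' => ?_) (Sp_inf (hr.mem hW) (hr.top (hW.mono fun i hi => hi.2)))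
  rw [lin_w]
  have hlt : ∀ {A : Word}, InIdx (fun i => S i ∧ i < N + 1) A → xc N A = 0 →
      InIdx (fun i => S i ∧ i < N) A := fun h h0 l hl =>
    ⟨(h l hl).1, inIdx_lt_of_xc (h.mono fun i hi => hi.2) h0 l hl⟩
  rcases Nat.eq_zero_or_pos (xc N W') with h0 | h0
  · rw [tauWord_free r u v h0]
    exact w_mem_Sp (hlt hW'.1 h0)
  · obtain ⟨A, e, B, rfl, hA, h1⟩ := exists_split h0
    have hB : xc N B = 0 := by have := hW'.2; omega
    rw [tauWord_mid r u v hA]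
    simp only [inIdx_mul] at hW'
    exact Submodule.smul_mem _ _ (hr.mem (inIdx_mul.mpr ⟨hlt hW'.1.1.1 hA, hlt hW'.1.2 hB⟩))

/-- The first members `T 0, …, T n` of the family are traces which are compatible with the maps
`K j → K (j + 1)` and satisfy the Markov property with the parameters `u, v`. -/
structure IsMarkov (α β u v : R) {X : Type*} [AddCommGroup X] [Module R X]
    (T : ∀ n, K α β n →ₗ[R] X) (n : ℕ) : Prop where
  trace : ∀ j ≤ n, ∀ a b, T j (a * b) = T j (b * a)
  compat : ∀ j, j + 1 ≤ n → ∀ a, T (j + 1) (kMap α β (Nat.le_succ j) a) = T j a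
  markov : ∀ m, m + 2 ≤ n → ∀ a e,
    T (m + 2) (kMap α β (Nat.le_succ (m + 1)) a * sK α β (m + 2) m e) =
      (bif e then u else v) • T (m + 1) a

variable {X' : Type*} [AddCommGroup X'] [Module R X'] {T : ∀ n, K α β n →ₗ[R] X'}

theorem IsMarkov.mono {m n : ℕ} (h : IsMarkov α β u v T n) (hm : m ≤ n) :
    IsMarkov α β u v T m :=
  ⟨fun j hj => h.trace j (hj.trans hm), fun j hj => h.compat j (hj.trans hm),
    fun j hj => h.markov j (hj.trans hm)⟩

theorem IsMarkov.mid {m : ℕ} (h : IsMarkov α β u v T (m + 2)) (a b : K α β (m + 1)) (e : Bool) :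
    T (m + 2) (kMap α β (Nat.le_succ (m + 1)) a * sK α β (m + 2) m e *
      kMap α β (Nat.le_succ (m + 1)) b) = (bif e then u else v) • T (m + 1) (a * b) := by
  rw [h.trace _ le_rfl, ← mul_assoc, ← map_mul, h.markov m le_rfl, h.trace _ (by omega)]

/-- The maps `tauN` compute Markov traces, also after a change of indices. -/
theorem IsMarkov.tauN (hr : IsReductionMap α β r) {m : ℕ} (h : IsMarkov α β u v T (m + 2))
    {p : ℕ} (hp : 2 ≤ p) (d : K α β (m + 1)) {X : FA R}
    (hX : X ∈ Sp R (InIdx fun i => p ≤ i + (m + 2) ∧ i + 1 < p)) :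
    T (m + 2) (kMap α β (Nat.le_succ (m + 1)) d * cls α β (m + 2) (reidxA R (m + 2) p X)) =
      T (m + 1) (d * cls α β (m + 1) (reidxA R (m + 2) p (tauN r u v p X))) := by
  obtain ⟨N, rfl⟩ := Nat.exists_eq_add_of_le' hp
  obtain ⟨f, hf⟩ : ∃ f : FA R →ₗ[R] X', ∀ Y, f Y = T (m + 2) (kMap α β (Nat.le_succ (m + 1)) d *
      cls α β (m + 2) (reidxA R (m + 2) (N + 2) Y)) :=
    ⟨(T (m + 2)).comp ((LinearMap.mulLeft R (kMap α β (Nat.le_succ (m + 1)) d)).comp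
      ((cls α β (m + 2)).toLinearMap.comp (reidxA R (m + 2) (N + 2)).toLinearMap)), fun _ => rfl⟩
  obtain ⟨g, hg⟩ : ∃ g : FA R →ₗ[R] X', ∀ Y, g Y = T (m + 1) (d *
      cls α β (m + 1) (reidxA R (m + 2) (N + 2) Y)) :=
    ⟨(T (m + 1)).comp ((LinearMap.mulLeft R d).comp
      ((cls α β (m + 1)).toLinearMap.comp (reidxA R (m + 2) (N + 2)).toLinearMap)), fun _ => rfl⟩
  rw [← hf, ← hg, ← LinearMap.comp_apply]
  refine Sp_eqOn (fun W hW => ?_) hX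
  have hfit : InIdx (Fits (m + 2) (N + 2) (m + 2)) W := hW.mono fun i hi => ⟨hi.1, by omega⟩
  rw [LinearMap.comp_apply, tauN_w]
  have h1 : f (w R W) = f (r W) := by
    rw [hf, hf, hr.cls_reidx hfit, reidxA_w]
  rw [h1]
  rw [← LinearMap.comp_apply]
  refine Sp_eqOn (fun W' hW' => ?_)
    (Sp_inf (hr.mem hW) (hr.top (N := N) (hW.mono fun i hi => by omega)))
  rw [LinearMap.comp_apply, lin_w, hf, hg]
  have hlt : ∀ {A : Word}, InIdx (fun i => N + 2 ≤ i + (m + 2) ∧ i + 1 < N + 2) A → xc N A = 0 →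
      InIdx (Fits (m + 2) (N + 2) (m + 1)) A := fun h h0 l hl => by
    have h1 := h l hl
    have h2 := xc_eq_zero.mp h0 l hl
    simp only at h1 h2
    exact ⟨h1.1, by omega⟩
  have hk : ∀ {A : Word}, InIdx (Fits (m + 2) (N + 2) (m + 1)) A →
      cls α β (m + 2) (w R (reidx (m + 2) (N + 2) A)) =
        kMap α β (Nat.le_succ (m + 1)) (cls α β (m + 1) (w R (reidx (m + 2) (N + 2) A))) :=
    fun h => (kMap_cls α β _ (w_mem_Sp (inIdx_reidx.mpr (h.mono fun i hi => hi.2)))).symm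
  rcases Nat.eq_zero_or_pos (xc N W') with h0 | h0
  · rw [tauWord_free r u v h0, reidxA_w, hk (hlt hW'.1 h0), ← map_mul,
      h.compat _ (by omega)]
  · obtain ⟨A, e, B, rfl, hA, h1⟩ := exists_split h0
    have hB : xc N B = 0 := by have := hW'.2; omega
    simp only [inIdx_mul] at hW'
    have hA' := hlt hW'.1.1.1 hA
    have hB' := hlt hW'.1.2 hB
    rw [tauWord_mid r u v hA, map_smul, map_smul, mul_smul_comm, map_smul,
      hr.cls_reidx (inIdx_mul.mpr ⟨hA', hB'⟩), map_mul (reidx _ _), cls_mul, ← mul_assoc,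
      ← h.mid, reidxA_w, map_mul (reidx _ _), map_mul (reidx _ _), cls_mul, cls_mul, hk hA', hk hB', reidx_gen, cls_gen,
      show N + (m + 2) - (N + 2) = m by omega, map_mul (kMap _ _ _)]
    simp only [mul_assoc]

end Markov

end

end Funar

namespace Funar

noncomputable section

open scoped TensorProduct

/-! ### Reductions and reduced elements -/

section MarkovValues

variable {R : Type*} [CommRing R] {α β u v : R} {r : Word → FA R}
variable {X' : Type*} [AddCommGroup X'] [Module R X'] {T : ∀ n, K α β n →ₗ[R] X'}

theorem reidx_succ (a b : ℕ) (W : Word) : reidx (a + 1) (b + 1) W = reidx a b W := by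
  induction W using word_induction with
  | h1 => simp
  | h i e W ih =>
    simp only [map_mul, ih, reidx_gen]
    rw [show i + (a + 1) - (b + 1) = i + a - b by omega]

theorem reidxA_succ (a b : ℕ) (X : FA R) : reidxA R (a + 1) (b + 1) X = reidxA R a b X := by
  have : (reidxA R (a + 1) (b + 1)).toLinearMap = (reidxA R a b).toLinearMap :=
    FA_hom_ext fun W => by
      simp only [AlgHom.toLinearMap_apply, reidxA_w, reidx_succ]
  exact DFunLike.congr_fun this X

theorem IsReductionMap.lin_mem (hr : IsReductionMap α β r) {S : ℕ → Prop} {Y : FA R}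
    (hY : Y ∈ Sp R (InIdx S)) : lin r Y ∈ Sp R (InIdx S) :=
  Sp_map_le (fun W hW => by rw [lin_w]; exact hr.mem hW) hY

theorem IsReductionMap.lin_reduced (hr : IsReductionMap α β r) (Y : FA R) :
    lin r Y ∈ Sp R (WordReduced α β) :=
  Sp_map_le (p := fun _ => True) (fun W _ => by rw [lin_w]; exact hr.reduced W)
    (mem_Sp.mpr fun _ _ => trivial)

theorem IsReductionMap.lin_cls_reidx (hr : IsReductionMap α β r) {a b n : ℕ} {Y : FA R}
    (hY : Y ∈ Sp R (InIdx (Fits a b n))) :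
    cls α β n (reidxA R a b (lin r Y)) = cls α β n (reidxA R a b Y) := by
  refine Sp_eqOn (f := ((cls α β n).toLinearMap.comp (reidxA R a b).toLinearMap).comp (lin r))
    (g := (cls α β n).toLinearMap.comp (reidxA R a b).toLinearMap) (fun W hW => ?_) hY
  simp only [LinearMap.comp_apply, AlgHom.toLinearMap_apply, lin_w, reidxA_w, hr.cls_reidx hW]

theorem redSub_eq (α β : R) (n : ℕ) :
    redSub α β n = Sp R fun W => InF n W ∧ WordReduced α β W := by
  unfold redSub Sp
  congr 1
  ext X
  simp only [Set.mem_ofPred_eq, and_assoc]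

theorem mem_redSub {n : ℕ} {Y : FA R} : Y ∈ redSub α β n ↔
    Y ∈ Sp R (InIdx fun i => i + 1 < n) ∧ Y ∈ Sp R (WordReduced α β) := by
  rw [redSub_eq]
  exact ⟨fun h => ⟨Sp_mono (fun _ h => h.1) h, Sp_mono (fun _ h => h.2) h⟩,
    fun h => Sp_inf h.1 h.2⟩

/-! ### Values of Markov traces -/

/-- The values of a Markov trace are computed by `tau`. -/
theorem IsMarkov.tau (hr : IsReductionMap α β r) : ∀ {m : ℕ}, IsMarkov α β u v T (m + 1) →
    ∀ {Y : FA R}, Y ∈ Sp R (InIdx fun i => i + 1 < m + 1) →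
      T (m + 1) (cls α β (m + 1) Y) = tau r u v (m + 1) Y • T 0 1 := by
  intro m
  induction m with
  | zero =>
    intro h Y hY
    refine Sp_eqOn (f := (T 1).comp (cls α β 1).toLinearMap)
      (g := (LinearMap.toSpanSingleton R X' (T 0 1)).comp (Funar.tau r u v 1)) (fun W hW => ?_) hY
    rw [eq_one_of_inIdx (by simp) hW]
    have h1 := h.compat 0 le_rfl 1
    rw [map_one] at h1
    rw [LinearMap.comp_apply, AlgHom.toLinearMap_apply, cls_one]
    refine h1.trans ?_
    simp [Funar.tau, tauComp, w_eq_single]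
  | succ m ih =>
    intro h Y hY
    have h1 := h.tauN hr (p := m + 2) (by omega) 1 (X := Y) (Sp_mono (fun W hW => hW.mono
      fun i hi => ⟨by omega, hi⟩) hY)
    simp only [map_one, one_mul, reidxA_self] at h1
    rw [h1, ih (h.mono (by omega))]
    · rfl
    · exact Sp_mono (fun W hW => hW.mono fun i hi => by omega)
        (tauN_mem hr (N := m) (S := fun _ => True)
          (Sp_mono (fun W hW => hW.mono fun i hi => ⟨trivial, by omega⟩) hY))

/-- All values of a Markov trace are multiples of its initial value. -/
theorem IsMarkov.exists_smul (hr : IsReductionMap α β r) {m : ℕ} (h : IsMarkov α β u v T (m + 1))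
    (k : K α β (m + 1)) : ∃ a : R, T (m + 1) k = a • T 0 1 := by
  have hk : k ∈ Submodule.span R {k | ∃ W, InIdx (fun i => i + 1 < m + 1) W ∧
      k = cls α β (m + 1) (w R W)} := by rw [span_cls]; trivial
  induction hk using Submodule.span_induction with
  | mem k hk =>
    obtain ⟨W, hW, rfl⟩ := hk
    exact ⟨_, h.tau hr (w_mem_Sp hW)⟩
  | zero => exact ⟨0, by simp⟩
  | add x y _ _ hx hy =>
    obtain ⟨a, ha⟩ := hx
    obtain ⟨b, hb⟩ := hy
    exact ⟨a + b, by rw [map_add, ha, hb, add_smul]⟩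
  | smul a x _ hx =>
    obtain ⟨b, hb⟩ := hx
    exact ⟨a * b, by rw [map_smul, hb, mul_smul]⟩

theorem inIdx_of_mem_S {i : ℕ} {W : Word} (h : W ∈ S i) : InIdx (· < i) W := by
  rcases h with h | h
  · rw [Set.mem_singleton_iff] at h
    subst h
    simp
  · simp only [Set.mem_iUnion] at h
    obtain ⟨j, hj, h⟩ := h
    rw [Finset.mem_Icc] at hj
    intro l hl
    have h1 : l.1 + 1 ∈ W.toList.map (fun l => l.1 + 1) := List.mem_map_of_mem hl
    rw [show W.toList.map (fun l => l.1 + 1) = _ from h, List.mem_reverse, List.mem_range'_1] at h1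
    omega

theorem one_mem_S (i : ℕ) : (1 : Word) ∈ S i := Or.inl rfl

theorem rhoX_apply (X : Word) (Y : FA R) : rhoX r u v X Y = tauN r u v 5 (w R X * sh R Y) := rfl

theorem sh_mem {S : ℕ → Prop} {Y : FA R} (hY : Y ∈ Sp R (InIdx fun i => S (i + 1))) :
    sh R Y ∈ Sp R (InIdx S) :=
  Sp_map_le (f := (sh R).toLinearMap) (fun W hW => by
    rw [AlgHom.toLinearMap_apply, sh_w]
    exact w_mem_Sp (inIdx_sh.mpr hW)) hY

theorem rhoX_mem (hr : IsReductionMap α β r) {X : Word} (hX : X ∈ S 4) {Y : FA R}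
    (hY : Y ∈ redSub α β 4) : rhoX r u v X Y ∈ redSub α β 4 := by
  rw [rhoX_apply, mem_redSub]
  refine ⟨Sp_mono (fun W hW => hW.mono fun i hi => by omega) (tauN_mem hr (N := 3)
    (S := fun _ => True) (Sp_mul (p := InIdx (· < 4)) (q := InIdx (· < 4)) (fun A B hA hB => ?_)
      (w_mem_Sp (inIdx_of_mem_S hX)) (sh_mem ?_))), tauN_reduced hr 3 _⟩
  · exact inIdx_mul.mpr ⟨hA.mono fun i hi => ⟨trivial, hi⟩, hB.mono fun i hi => ⟨trivial, hi⟩⟩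
  · exact Sp_mono (fun W hW => hW.mono fun i hi => by omega) (mem_redSub.mp hY).1

theorem assocDefects_mem (hr : IsReductionMap α β r) {S : ℕ → Prop} {X₁ X₂ X₃ : Word}
    (h1 : InIdx S X₁) (h2 : InIdx S X₂) (h3 : InIdx S X₃) :
    lin r (lin r (w R (X₃ * X₂)) * w R X₁) ∈ Sp R (InIdx S) ∧
      lin r (w R X₃ * lin r (w R (X₂ * X₁))) ∈ Sp R (InIdx S) := by
  have hm : ∀ A B, InIdx S A → InIdx S B → InIdx S (A * B) := fun A B hA hB =>
    inIdx_mul.mpr ⟨hA, hB⟩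
  exact ⟨hr.lin_mem (Sp_mul hm (hr.lin_mem (w_mem_Sp (hm _ _ h3 h2))) (w_mem_Sp h1)),
    hr.lin_mem (Sp_mul hm (w_mem_Sp h3) (hr.lin_mem (w_mem_Sp (hm _ _ h2 h1))))⟩

theorem inIdx_of_mem_sh_S {X₂ : Word} (h : X₂ ∈ (shWord '' S 2) \ {1}) : InIdx (· < 3) X₂ := by
  obtain ⟨⟨Y, hY, rfl⟩, -⟩ := h
  exact inIdx_sh.mpr ((inIdx_of_mem_S hY).mono fun i hi => by omega)

theorem inIdx_of_mem_sh_sh_S {X₁ : Word} (h : X₁ ∈ (shWord '' (shWord '' S 1)) \ {1}) :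
    InIdx (· < 3) X₁ := by
  obtain ⟨⟨_, ⟨Y, hY, rfl⟩, rfl⟩, -⟩ := h
  exact inIdx_sh.mpr (inIdx_sh.mpr ((inIdx_of_mem_S hY).mono fun i hi => by omega))

theorem assocDefects_subset (hr : IsReductionMap α β r) :
    assocDefects r ⊆ (redSub α β 4 : Submodule R (FA R)) := by
  rintro _ ⟨X₃, h3, X₂, h2, X₁, h1, rfl⟩
  obtain ⟨ha, hb⟩ := assocDefects_mem hr (inIdx_of_mem_sh_sh_S h1) (inIdx_of_mem_sh_S h2)
    (inIdx_of_mem_S h3.1)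
  rw [SetLike.mem_coe]
  refine Submodule.sub_mem _ (mem_redSub.mpr ⟨?_, hr.lin_reduced _⟩)
    (mem_redSub.mpr ⟨?_, hr.lin_reduced _⟩)
  · exact Sp_mono (fun W hW => hW.mono fun i hi => by omega) ha
  · exact Sp_mono (fun W hW => hW.mono fun i hi => by omega) hb

theorem J4_le_redSub (hr : IsReductionMap α β r) : J4 α β u v r ≤ redSub α β 4 :=
  sInf_le ⟨le_rfl, assocDefects_subset hr, fun _ hX => Submodule.map_le_iff_le_comap.mpr
    fun _ hY => rhoX_mem hr hX hY⟩

theorem assocDefects_subset_J4 : assocDefects r ⊆ (J4 α β u v r : Set (FA R)) := fun _ hZ =>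
  Submodule.mem_sInf.mpr fun _ hP => hP.2.1 hZ

theorem rhoX_mem_J4 {X : Word} (hX : X ∈ S 4) {Y : FA R} (hY : Y ∈ J4 α β u v r) :
    rhoX r u v X Y ∈ J4 α β u v r :=
  Submodule.mem_sInf.mpr fun P hP =>
    hP.2.2 X hX (Submodule.mem_map_of_mem (Submodule.mem_sInf.mp hY P hP))

/-- Markov traces vanish on the left ideals generated by the shifts of `J4`: the elements with this
property for all shifts form a submodule which is stable under `rhoX`, since `rhoX X Y` is
computed by closing the last strand of `X * sh Y`. -/
theorem IsMarkov.J4_eq_zero (hr : IsReductionMap α β r) (h : ∀ n, IsMarkov α β u v T n) {Z : FA R}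
    (hZ : Z ∈ J4 α β u v r) (m : ℕ) (c : K α β (m + 4)) :
    T (m + 4) (c * cls α β (m + 4) (reidxA R (m + 4) 4 Z)) = 0 := by
  let P : Submodule R (FA R) :=
    { carrier := {Z | Z ∈ redSub α β 4 ∧ ∀ (m : ℕ) (c : K α β (m + 4)),
        T (m + 4) (c * cls α β (m + 4) (reidxA R (m + 4) 4 Z)) = 0}
      add_mem' := fun {a b} ha hb => ⟨add_mem ha.1 hb.1, fun m c => by
        rw [map_add, map_add, mul_add, map_add, ha.2, hb.2, add_zero]⟩
      zero_mem' := ⟨zero_mem _, by simp⟩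
      smul_mem' := fun a x hx => ⟨Submodule.smul_mem _ _ hx.1, fun m c => by
        rw [map_smul, map_smul, mul_smul_comm, map_smul, hx.2, smul_zero]⟩ }
  have hJ : J4 α β u v r ≤ P := by
    refine sInf_le ⟨fun Z hZ => hZ.1, fun Z hZ => ⟨assocDefects_subset hr hZ, ?_⟩, ?_⟩
    · obtain ⟨X₃, h3, X₂, h2, X₁, h1, rfl⟩ := hZ
      intro m c
      have hf : ∀ {W : Word}, InIdx (· < 3) W → InIdx (Fits (m + 4) 4 (m + 4)) W := fun h =>
        h.mono fun i hi => ⟨by omega, by omega⟩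
      have i1 := hf (inIdx_of_mem_sh_sh_S h1)
      have i2 := hf (inIdx_of_mem_sh_S h2)
      have i3 := hf (inIdx_of_mem_S h3.1)
      have hm : ∀ A B, InIdx (Fits (m + 4) 4 (m + 4)) A → InIdx (Fits (m + 4) 4 (m + 4)) B →
          InIdx (Fits (m + 4) 4 (m + 4)) (A * B) := fun A B hA hB => inIdx_mul.mpr ⟨hA, hB⟩
      have k1 := w_mem_Sp (R := R) (hm _ _ i3 i2)
      have k2 := w_mem_Sp (R := R) (hm _ _ i2 i1)
      have e1 := hr.lin_cls_reidx (Sp_mul hm (hr.lin_mem k1) (w_mem_Sp i1))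
      have e2 := hr.lin_cls_reidx (Sp_mul hm (w_mem_Sp i3) (hr.lin_mem k2))
      rw [map_sub, map_sub, e1, e2, map_mul (reidxA R _ _), map_mul (cls α β _),
        map_mul (reidxA R _ _), map_mul (cls α β _),
        hr.lin_cls_reidx k1, hr.lin_cls_reidx k2, ← map_mul, ← map_mul, ← map_mul, ← map_mul,
        ← w_mul, ← w_mul, mul_assoc, sub_self, mul_zero, map_zero]
    · intro X hX
      refine Submodule.map_le_iff_le_comap.mpr fun Z hZ => ⟨rhoX_mem hr hX hZ.1, fun m c => ?_⟩
      rw [rhoX_apply]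
      have h1 := (h (m + 3 + 2)).tauN hr (p := 5) (by norm_num) c (X := w R X * sh R Z)
        (Sp_mul (p := InIdx (· < 4)) (q := InIdx (· < 4)) (fun A B hA hB => ?_)
          (w_mem_Sp (inIdx_of_mem_S hX)) (sh_mem ?_))
      · have h2 := hZ.2 (m + 1) (kMap α β (Nat.le_succ (m + 3 + 1)) c *
          cls α β (m + 5) (reidxA R (m + 5) 5 (w R X)))
        rw [map_mul (reidxA R _ _), map_mul (cls α β _), reidxA_sh, ← mul_assoc, reidxA_succ _ 4 Z,
          reidxA_succ _ 4 (Funar.tauN r u v 5 _)] at h1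
        rw [← h1]
        exact h2
      · exact inIdx_mul.mpr ⟨hA.mono fun i hi => ⟨by omega, by omega⟩,
          hB.mono fun i hi => ⟨by omega, by omega⟩⟩
      · exact Sp_mono (fun W hW => hW.mono fun i hi => by omega) (mem_redSub.mp hZ.1).1
  exact (hJ hZ).2 m c

/-! ### The pairings on the tensor square -/

/-- The functional `p ⊗ q ↦ T(p b q d)`, where `p, q` stand for polynomials in the last generator
of `K (m + 2)`. -/
def pairT (T : ∀ n, K α β n →ₗ[R] X') (m : ℕ) (b d : K α β (m + 1)) :
    FA R ⊗[R] FA R →ₗ[R] X' :=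
  (T (m + 2)).comp (TensorProduct.lift ((LinearMap.mul R (K α β (m + 2))).compl₁₂
    ((LinearMap.mulRight R (kMap α β (Nat.le_succ (m + 1)) b)).comp
      ((cls α β (m + 2)).toLinearMap.comp (reidxA R (m + 2) 2).toLinearMap))
    ((LinearMap.mulRight R (kMap α β (Nat.le_succ (m + 1)) d)).comp
      ((cls α β (m + 2)).toLinearMap.comp (reidxA R (m + 2) 2).toLinearMap))))

theorem pairT_tmul (m : ℕ) (b d : K α β (m + 1)) (p q : FA R) :
    pairT T m b d (p ⊗ₜ q) = T (m + 2) (cls α β (m + 2) (reidxA R (m + 2) 2 p) *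
      kMap α β (Nat.le_succ (m + 1)) b * (cls α β (m + 2) (reidxA R (m + 2) 2 q) *
        kMap α β (Nat.le_succ (m + 1)) d)) := rfl

theorem rhoDelta_tmul (δ₁ δ₂ : SignType) (p q : FA R) : rhoDelta r u v δ₁ δ₂ (p ⊗ₜ q) =
    w R (genPow 0 δ₁) ⊗ₜ tauN r u v 3 (sh R p * w R (genPow 0 δ₂) * sh R q) := rfl

theorem mem_N_induction {P : Submodule R (FA R ⊗[R] FA R)}
    (h : ∀ p ∈ Sp R (InIdx (· < 1)), ∀ q ∈ Sp R (InIdx (· < 1)), p ⊗ₜ[R] q ∈ P) : N α β ≤ P := by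
  refine Submodule.map₂_le.mpr fun p hp q hq => h p ?_ q ?_
  · exact Sp_mono (fun W hW => hW.mono fun i hi => by omega) (mem_redSub.mp hp).1
  · exact Sp_mono (fun W hW => hW.mono fun i hi => by omega) (mem_redSub.mp hq).1

theorem cls_genPow_kMap (α β : R) {m n : ℕ} (h : m ≤ n) {i : ℕ} (hi : i + 1 < m) (e : SignType) :
    kMap α β h (cls α β m (w R (genPow i e))) = cls α β n (w R (genPow i e)) :=
  kMap_cls α β h (w_mem_Sp (inIdx_genPow hi))

/-- The maps `rhoDelta` compute the functionals `pairT` on one strand more: closing the last strand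
removes the outer generator from `x^e₁ y^δ₂ x^e₂`. -/
theorem IsMarkov.pairT_rhoDelta (hr : IsReductionMap α β r) {m : ℕ}
    (h : IsMarkov α β u v T (m + 3)) (b d : K α β (m + 1)) (δ₁ δ₂ : SignType)
    {Z : FA R ⊗[R] FA R} (hZ : Z ∈ N α β) :
    pairT T m b d (rhoDelta r u v δ₁ δ₂ Z) =
      pairT T (m + 1) (cls α β (m + 2) (w R (genPow m δ₂)))
        (kMap α β (Nat.le_succ (m + 1)) d * cls α β (m + 2) (w R (genPow m δ₁)) *
          kMap α β (Nat.le_succ (m + 1)) b) Z := by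
  refine (mem_N_induction (P := LinearMap.eqLocus ((pairT T m b d).comp (rhoDelta r u v δ₁ δ₂))
    (pairT T (m + 1) _ _)) fun p hp q hq => ?_) hZ
  rw [LinearMap.mem_eqLocus, LinearMap.comp_apply, rhoDelta_tmul, pairT_tmul, pairT_tmul]
  have hsh : ∀ {p : FA R}, p ∈ Sp R (InIdx (· < 1)) → sh R p ∈ Sp R (InIdx (· < 2)) := fun hp =>
    sh_mem (Sp_mono (fun W hW => hW.mono fun i hi => by omega) hp)
  have hm : ∀ A B, InIdx (· < 2) A → InIdx (· < 2) B → InIdx (· < 2) (A * B) := fun A B hA hB =>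
    inIdx_mul.mpr ⟨hA, hB⟩
  have h1 := h.tauN hr (m := m + 1) (p := 3) (by norm_num)
    (kMap α β (Nat.le_succ (m + 1)) d * cls α β (m + 2) (w R (genPow m δ₁)) *
      kMap α β (Nat.le_succ (m + 1)) b) (X := sh R p * w R (genPow 0 δ₂) * sh R q)
    (Sp_mono (fun W hW => hW.mono fun i hi => ⟨by omega, by omega⟩)
      (Sp_mul hm (Sp_mul hm (hsh hp) (w_mem_Sp (inIdx_genPow (by norm_num)))) (hsh hq)))
  rw [reidxA_succ _ 2 (Funar.tauN r u v 3 _)] at h1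
  simp only [map_mul (reidxA R _ _), reidxA_sh, reidxA_w, reidx_genPow, reidxA_succ _ 2,
    map_mul (cls α β _)] at h1 ⊢
  rw [show 0 + (m + 2) - 2 = m by omega] at h1 ⊢
  rw [← mul_assoc, h.trace _ (by omega), ← mul_assoc,
    ← mul_assoc, ← h1, h.trace _ le_rfl, cls_genPow_kMap α β _ (by omega)]
  simp only [mul_assoc]

theorem BasicRepl.two_le {U : Word} {V : FA R} (h : BasicRepl α β U V) : 2 ≤ U.length := by
  cases h <;> (simp [gen, FreeMonoid.length_mul]; try omega)

theorem wordReduced_of_length {W : Word} (h : W.length ≤ 1) : WordReduced α β W := by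
  rintro ⟨Y, A, U, B, V, hU, rfl, rfl⟩
  have := hU.two_le
  simp only [FreeMonoid.length_mul] at h
  omega

theorem genPow_mem_redSub (e : SignType) : w R (genPow 0 e) ∈ redSub α β 2 := by
  rw [redSub_eq]
  refine w_mem_Sp ⟨inIdx_genPow (S := fun i => i + 1 < 2) (by norm_num), wordReduced_of_length ?_⟩
  cases e <;> simp [genPow, gen]

theorem tauN_three_mem (hr : IsReductionMap α β r) {Y : FA R} (hY : Y ∈ Sp R (InIdx (· < 2))) :
    tauN r u v 3 Y ∈ redSub α β 2 :=
  mem_redSub.mpr ⟨Sp_mono (fun W hW => hW.mono fun i hi => by omega) (tauN_mem hr (N := 1)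
    (S := fun _ => True) (Sp_mono (fun W hW => hW.mono fun i hi => ⟨trivial, hi⟩) hY)),
    tauN_reduced hr 1 _⟩

theorem inIdx_three (e₁ e₂ e₃ : SignType) :
    InIdx (· < 2) (genPow 1 e₁ * genPow 0 e₂ * genPow 1 e₃) := by
  simp only [inIdx_mul]
  exact ⟨⟨inIdx_genPow (by norm_num), inIdx_genPow (by norm_num)⟩, inIdx_genPow (by norm_num)⟩

theorem pentagonDefects_subset (hr : IsReductionMap α β r) :
    pentagonDefects r u v ⊆ (N α β : Submodule R (FA R ⊗[R] FA R)) := by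
  rintro _ ⟨e₁, e₂, e₃, e₄, -, -, rfl⟩
  exact Submodule.sub_mem _
    (Submodule.apply_mem_map₂ _ (tauN_three_mem hr (w_mem_Sp (inIdx_three _ _ _)))
      (genPow_mem_redSub _))
    (Submodule.apply_mem_map₂ _ (genPow_mem_redSub _)
      (tauN_three_mem hr (w_mem_Sp (inIdx_three _ _ _))))

theorem rhoDelta_mem (hr : IsReductionMap α β r) (δ₁ δ₂ : SignType) :
    N α β ≤ (N α β).comap (rhoDelta r u v δ₁ δ₂) := by
  refine mem_N_induction fun p hp q hq => ?_
  rw [Submodule.mem_comap, rhoDelta_tmul]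
  have hsh : ∀ {p : FA R}, p ∈ Sp R (InIdx (· < 1)) → sh R p ∈ Sp R (InIdx (· < 2)) := fun hp =>
    sh_mem (Sp_mono (fun W hW => hW.mono fun i hi => by omega) hp)
  have hm : ∀ A B, InIdx (· < 2) A → InIdx (· < 2) B → InIdx (· < 2) (A * B) := fun A B hA hB =>
    inIdx_mul.mpr ⟨hA, hB⟩
  exact Submodule.apply_mem_map₂ _ (genPow_mem_redSub _) (tauN_three_mem hr
    (Sp_mul hm (Sp_mul hm (hsh hp) (w_mem_Sp (inIdx_genPow (by norm_num)))) (hsh hq)))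

theorem L_le_N (hr : IsReductionMap α β r) : L α β u v r ≤ N α β :=
  sInf_le ⟨le_rfl, pentagonDefects_subset hr, fun _ _ => Submodule.map_le_iff_le_comap.mpr
    (rhoDelta_mem hr _ _)⟩

theorem pentagonDefects_subset_L : pentagonDefects r u v ⊆ (L α β u v r : Set _) := fun _ hZ =>
  Submodule.mem_sInf.mpr fun _ hP => hP.2.1 hZ

theorem rhoDelta_mem_L (δ₁ δ₂ : SignType) {Z : FA R ⊗[R] FA R} (hZ : Z ∈ L α β u v r) :
    rhoDelta r u v δ₁ δ₂ Z ∈ L α β u v r :=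
  Submodule.mem_sInf.mpr fun P hP =>
    hP.2.2 δ₁ δ₂ (Submodule.mem_map_of_mem (Submodule.mem_sInf.mp hZ P hP))

theorem kMap_commute (α β : R) {n m : ℕ} (h : n ≤ m) (b : K α β n) {i : ℕ} (hi : n ≤ i)
    (e : SignType) : Commute (kMap α β h b) (cls α β m (w R (genPow i e))) := by
  have hb : b ∈ Submodule.span R {k | ∃ W, InIdx (fun i => i + 1 < n) W ∧
      k = cls α β n (w R W)} := by rw [span_cls]; trivial
  induction hb using Submodule.span_induction with
  | mem b hb =>
    obtain ⟨W, hW, rfl⟩ := hb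
    rw [kMap_cls α β h (w_mem_Sp hW)]
    exact cls_commute_of_lt α β m n hW (inIdx_genPow hi)
  | zero => rw [map_zero]; exact Commute.zero_left _
  | add x y _ _ hx hy => rw [map_add]; exact hx.add_left hy
  | smul a x _ hx => rw [map_smul]; exact hx.smul_left a

theorem kMap_kMap (α β : R) {l m n : ℕ} (h : l ≤ m) (h' : m ≤ n) (b : K α β l) :
    kMap α β h' (kMap α β h b) = kMap α β (h.trans h') b :=
  DirectedSystem.map_map (f := fun _ _ h => kMap α β h) h h' b

/-- Both sides are the value of `T` on `x^e₁ y^e₂ b x^e₃ y^e₄ d`, up to a cyclic permutation, where `x` is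
the last and `y` the second to last generator of `K (m + 3)`, and `b, d` commute with `x`. -/
theorem IsMarkov.pairT_pentagon (hr : IsReductionMap α β r) {m : ℕ}
    (h : IsMarkov α β u v T (m + 3)) (b d : K α β (m + 1)) (e₁ e₂ e₃ e₄ : SignType) :
    pairT T m b d (Funar.tauN r u v 3 (w R (genPow 1 e₁ * genPow 0 e₂ * genPow 1 e₃)) ⊗ₜ[R]
      w R (genPow 0 e₄)) = pairT T m b d (w R (genPow 0 e₂) ⊗ₜ[R]
        Funar.tauN r u v 3 (w R (genPow 1 e₃ * genPow 0 e₄ * genPow 1 e₁))) := by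
  have key : ∀ (c : K α β (m + 2)) e₁ e₂ e₃, T (m + 2) (c * cls α β (m + 2) (reidxA R (m + 2) 2
      (Funar.tauN r u v 3 (w R (genPow 1 e₁ * genPow 0 e₂ * genPow 1 e₃))))) =
      T (m + 3) (kMap α β (Nat.le_succ (m + 2)) c * (cls α β (m + 3) (w R (genPow (m + 1) e₁)) *
        cls α β (m + 3) (w R (genPow m e₂)) * cls α β (m + 3) (w R (genPow (m + 1) e₃)))) := by
    intro c e₁ e₂ e₃
    have h1 := h.tauN hr (m := m + 1) (p := 3) (by norm_num) c
      (X := w R (genPow 1 e₁ * genPow 0 e₂ * genPow 1 e₃))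
      (w_mem_Sp ((inIdx_three _ _ _).mono fun i hi => ⟨by omega, by omega⟩))
    rw [reidxA_succ _ 2 (Funar.tauN r u v 3 _)] at h1
    rw [← h1]
    simp only [reidxA_w, map_mul (reidx _ _), reidx_genPow, cls_mul]
    rw [show 0 + (m + 1 + 2) - 3 = m by omega, show 1 + (m + 1 + 2) - 3 = m + 1 by omega]
  rw [pairT_tmul, pairT_tmul]
  generalize hx : cls α β (m + 2) (reidxA R (m + 2) 2
      (Funar.tauN r u v 3 (w R (genPow 1 e₁ * genPow 0 e₂ * genPow 1 e₃)))) = x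
  generalize hx' : cls α β (m + 2) (reidxA R (m + 2) 2
      (Funar.tauN r u v 3 (w R (genPow 1 e₃ * genPow 0 e₄ * genPow 1 e₁)))) = x'
  rw [mul_assoc x, h.trace _ (by omega) x, ← mul_assoc _ x', h.trace _ (by omega) (_ * x'),
    ← mul_assoc _ _ x', ← hx, ← hx', key, key, h.trace _ le_rfl]
  simp only [reidxA_w, reidx_genPow, map_mul (kMap α β _), kMap_kMap,
    show 0 + (m + 2) - 2 = m by omega, cls_genPow_kMap α β _ (show m + 1 < m + 2 by omega)]
  have cd := (kMap_commute α β (show m + 1 ≤ m + 3 by omega) d le_rfl e₁).eq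
  have cb := (kMap_commute α β (show m + 1 ≤ m + 3 by omega) b le_rfl e₃).eq
  generalize kMap α β (show m + 1 ≤ m + 3 by omega) d = D at *
  generalize kMap α β (show m + 1 ≤ m + 3 by omega) b = B at *
  generalize cls α β (m + 3) (w R (genPow (m + 1) e₁)) = x₁ at *
  generalize cls α β (m + 3) (w R (genPow (m + 1) e₃)) = x₃ at *
  generalize cls α β (m + 3) (w R (genPow m e₂)) = y₂ at *
  generalize cls α β (m + 3) (w R (genPow m e₄)) = y₄ at *
  have l1 : x₁ * y₂ * x₃ * (B * (y₄ * D)) = x₁ * (y₂ * x₃ * B * y₄ * D) := by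
    simp only [mul_assoc]
  have l2 : D * (y₂ * B) * (x₃ * y₄ * x₁) = D * y₂ * (B * x₃) * y₄ * x₁ := by simp only [mul_assoc]
  rw [l1, h.trace _ le_rfl, l2, cb, mul_assoc _ D x₁, cd, ← mul_assoc, h.trace _ le_rfl _ D]
  simp only [mul_assoc]

/-- Markov traces vanish on `L`, in the form of the functionals `pairT`. -/
theorem IsMarkov.L_eq_zero (hr : IsReductionMap α β r) (h : ∀ n, IsMarkov α β u v T n)
    {Z : FA R ⊗[R] FA R} (hZ : Z ∈ L α β u v r) (m : ℕ) (b d : K α β (m + 1)) :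
    pairT T m b d Z = 0 := by
  let P : Submodule R (FA R ⊗[R] FA R) :=
    { carrier := {Z | Z ∈ N α β ∧ ∀ (m : ℕ) (b d : K α β (m + 1)), pairT T m b d Z = 0}
      add_mem' := fun {x y} hx hy => ⟨add_mem hx.1 hy.1, fun m b d => by
        rw [map_add, hx.2, hy.2, add_zero]⟩
      zero_mem' := ⟨zero_mem _, by simp⟩
      smul_mem' := fun a x hx => ⟨Submodule.smul_mem _ _ hx.1, fun m b d => by
        rw [map_smul, hx.2, smul_zero]⟩ }
  have hL : L α β u v r ≤ P := by
    refine sInf_le ⟨fun Z hZ => hZ.1, fun Z hZ => ⟨pentagonDefects_subset hr hZ, ?_⟩, ?_⟩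
    · obtain ⟨e₁, e₂, e₃, e₄, -, -, rfl⟩ := hZ
      intro m b d
      rw [map_sub, (h (m + 3)).pairT_pentagon hr, sub_self]
    · intro δ₁ δ₂
      refine Submodule.map_le_iff_le_comap.mpr fun Z hZ => ⟨rhoDelta_mem hr _ _ hZ.1,
        fun m b d => ?_⟩
      rw [(h (m + 3)).pairT_rhoDelta hr b d δ₁ δ₂ hZ.1, hZ.2]
  exact (hL hZ).2 m b d

/-- On `N`, the functional `pairT` without further factors is given by `tauTensor`. -/
theorem IsMarkov.pairT_zero (hr : IsReductionMap α β r) (h : IsMarkov α β u v T 2)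
    {Z : FA R ⊗[R] FA R} (hZ : Z ∈ N α β) :
    pairT T 0 1 1 Z = tauTensor r u v Z • T 0 1 := by
  refine (mem_N_induction (P := LinearMap.eqLocus (pairT T 0 1 1)
    ((LinearMap.toSpanSingleton R X' (T 0 1)).comp (tauTensor r u v))) fun p hp q hq => ?_) hZ
  rw [LinearMap.mem_eqLocus, pairT_tmul]
  simp only [map_one, mul_one, zero_add, reidxA_self]
  rw [← map_mul, h.tau hr (m := 1)]
  · rfl
  · exact Sp_mul (p := InIdx (· < 1)) (q := InIdx (· < 1)) (fun A B hA hB => inIdx_mul.mpr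
      ⟨hA.mono fun i hi => by omega, hB.mono fun i hi => by omega⟩) hp hq

end MarkovValues

/-! ### The universal trace -/

section Universal

variable {R : Type*} [CommRing R] (α β u v : R)

theorem ofK_mul (n : ℕ) (x y : K α β n) : ofK α β n (x * y) = ofK α β n x * ofK α β n y :=
  (DirectLimit.mul_def n x y).symm

theorem ofK_kMap {m n : ℕ} (h : m ≤ n) (x : K α β m) :
    ofK α β n (kMap α β h x) = ofK α β m x :=
  DirectLimit.Module.of_f (f := fun _ _ h => kMap α β h)

theorem sGen_eq (m : ℕ) (e : Bool) : sGen α β m e = ofK α β (m + 2) (sK α β (m + 2) m e) := by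
  unfold sGen sK
  congr 2
  cases e <;> simp [sigmaPow]

/-- The universal trace on `K n`. -/
def univT (n : ℕ) : K α β n →ₗ[R] MarkovModule α β u v :=
  (universalTrace α β u v).comp (ofK α β n)

theorem universalTrace_eq_of_sub {x y : KInf α β} (h : MarkovRel α β u v (x - y)) :
    universalTrace α β u v x = universalTrace α β u v y := by
  rw [← sub_eq_zero, ← map_sub]
  exact (Submodule.Quotient.mk_eq_zero _).mpr (Submodule.subset_span h)

theorem univT_isMarkov (n : ℕ) : IsMarkov α β u v (univT α β u v) n where
  trace j _ a b := by
    simp only [univT, LinearMap.comp_apply, ofK_mul]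
    exact universalTrace_eq_of_sub α β u v (MarkovRel.comm j a b)
  compat j _ a := by
    simp only [univT, LinearMap.comp_apply, ofK_kMap]
  markov m _ a e := by
    simp only [univT, LinearMap.comp_apply, ofK_mul, ofK_kMap, ← sGen_eq, ← map_smul]
    cases e
    · exact universalTrace_eq_of_sub α β u v (MarkovRel.neg m a)
    · exact universalTrace_eq_of_sub α β u v (MarkovRel.pos m a)

end Universal

end

end Funar

namespace Funar

noncomputable section

/-! ### Universal straightening of three factors -/

section Straightening

variable {R : Type*} [CommRing R]

/-- The coefficients of the right hand side of the relation for `y x⁻¹ y`, where `(a, h, b)` stands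
for `x^a y^h x^b` and where `x, y` have to be replaced by their inverses if `s = -1`. -/
def cubicCoeff (α β : R) (s : SignType) : SignType × SignType × SignType →₀ R :=
  let m : SignType → SignType → SignType → (SignType × SignType × SignType →₀ R) :=
    fun a h b => Finsupp.single (a, h, b) 1
  (2 * α - β ^ 2) • m 0 0 0 - (m s 0 0 + m 0 s 0) - (α ^ 2 - β) • (m (-s) 0 0 + m 0 (-s) 0)
    + β • (m s s 0 + m 0 s s) + α • (m s (-s) 0 + m 0 s (-s) + m (-s) s 0 + m 0 (-s) s)
    + (α * β - 1) • (m (-s) (-s) 0 + m 0 (-s) (-s))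
    - α • m s s s
    - (m (-s) s s + m s (-s) s + m s s (-s)) - β • (m (-s) (-s) s + m s (-s) (-s))
    + (α - β ^ 2) • m (-s) (-s) (-s)

/-- The coefficients of the expansion of `y^e x^d y^f` into terms `x^a y^h x^b`, given by one
elementary reduction if `e` and `f` are nonzero; `(a, h, b)` stands for `x^a y^h x^b`. -/
def straightCoeff (α β : R) :
    SignType → SignType → SignType → (SignType × SignType × SignType →₀ R)
  | .zero, d, f => Finsupp.single (d, f, 0) 1
  | e, d, .zero => Finsupp.single (0, e, d) 1
  | .pos, .zero, .pos => α • Finsupp.single (0, 1, 0) 1 - β • Finsupp.single (0, 0, 0) 1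
      + Finsupp.single (0, -1, 0) 1
  | .neg, .zero, .neg => β • Finsupp.single (0, -1, 0) 1 - α • Finsupp.single (0, 0, 0) 1
      + Finsupp.single (0, 1, 0) 1
  | .pos, .zero, .neg => Finsupp.single (0, 0, 0) 1
  | .neg, .zero, .pos => Finsupp.single (0, 0, 0) 1
  | .pos, .neg, .pos => cubicCoeff α β 1
  | .neg, .pos, .neg => cubicCoeff β α (-1)
  | e, d, f => Finsupp.single (f, d, e) 1

variable {X : Type*} [AddCommGroup X] [Module R X]

/-- The expansion of `y^e x^d y^f`, in which the terms `x^a y^h x^b` are replaced by `F a h b`. -/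
def straighten (α β : R) (e d f : SignType) (F : SignType → SignType → SignType → X) : X :=
  Finsupp.linearCombination R (fun t => F t.1 t.2.1 t.2.2) (straightCoeff α β e d f)

variable (α β : R)

theorem straighten_zero_left (d f : SignType) (F : SignType → SignType → SignType → X) :
    straighten α β 0 d f F = F d f 0 := by
  change Finsupp.linearCombination R _ (Finsupp.single (d, f, 0) 1) = _
  simp

theorem straighten_zero_right {e : SignType} (he : e ≠ 0) (d : SignType)
    (F : SignType → SignType → SignType → X) : straighten α β e d 0 F = F 0 e d := by
  have : straightCoeff α β e d 0 = Finsupp.single (0, e, d) 1 := by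
    cases e
    · exact absurd rfl he
    · rfl
    · rfl
  rw [straighten, this]
  simp

theorem straighten_map {X' : Type*} [AddCommGroup X'] [Module R X'] (g : X →ₗ[R] X')
    (e d f : SignType) (F : SignType → SignType → SignType → X) :
    g (straighten α β e d f F) = straighten α β e d f fun a h b => g (F a h b) := by
  simp only [straighten, Finsupp.linearCombination_apply, Finsupp.sum, map_sum, map_smul]

theorem straighten_zero_mid_zero {e f : SignType} (F G : SignType → SignType → SignType → X)
    (h : ∀ h, F 0 h 0 = G 0 h 0) : straighten α β e 0 f F = straighten α β e 0 f G := by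
  cases e <;> cases f <;> simp [straighten, straightCoeff, h]

theorem straighten_congr {e d f : SignType} {F G : SignType → SignType → SignType → X}
    (h : ∀ a h b, F a h b = G a h b) : straighten α β e d f F = straighten α β e d f G := by
  simp only [straighten, h]

theorem straighten_apply {X' : Type*} [AddCommGroup X'] [Module R X'] (e d f : SignType)
    (F : SignType → SignType → SignType → X →ₗ[R] X') (x : X) :
    straighten α β e d f F x = straighten α β e d f fun a h b => F a h b x :=
  straighten_map α β (LinearMap.applyₗ x) e d f F

theorem straighten_cubic {B : Type*} [Ring B] [Algebra R B] (G H : SignType → B)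
    (hG : G 0 = 1) (hH : H 0 = 1) :
    straighten α β 1 (-1) 1 (fun a h b => G a * H h * G b) =
      cubicRHS α β (G 1) (G (-1)) (H 1) (H (-1)) ∧
    straighten α β (-1) 1 (-1) (fun a h b => G a * H h * G b) =
      cubicRHS β α (G (-1)) (G 1) (H (-1)) (H 1) := by
  constructor
  · change Finsupp.linearCombination R _ (cubicCoeff α β 1) = _
    simp only [cubicCoeff, cubicRHS, map_add, map_sub, map_smul, Finsupp.linearCombination_single,
      one_smul, hG, hH, one_mul, mul_one]
  · change Finsupp.linearCombination R _ (cubicCoeff β α (-1)) = _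
    simp only [show -(-1 : SignType) = 1 from rfl, cubicCoeff, cubicRHS, map_add, map_sub, map_smul,
      Finsupp.linearCombination_single, one_smul, hG, hH, one_mul, mul_one]

theorem straighten_braid {e d f : SignType} (he : e ≠ 0) (hd : d ≠ 0) (hf : f ≠ 0)
    (h : d = e ∨ d = f) (F : SignType → SignType → SignType → X) :
    straighten α β e d f F = F f d e := by
  have : straightCoeff α β e d f = Finsupp.single (f, d, e) 1 := by
    cases e <;> cases d <;> cases f <;> first | rfl | (simp at he hd hf h)
  rw [straighten, this]
  simp

end Straightening

/-! ### Bilinear maps on spanning families -/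

/-- Linear maps in one variable for each member of a spanning family in the other one define a bilinear
map if they agree on pairs of members: linear relations between the members are then respected. -/
theorem exists_bilin {R P Q X ι κ : Type*} [CommRing R] [AddCommGroup P] [Module R P]
    [AddCommGroup Q] [Module R Q] [AddCommGroup X] [Module R X] {s : ι → P} {t : κ → Q}
    (hs : Submodule.span R (Set.range s) = ⊤) (ht : Submodule.span R (Set.range t) = ⊤)
    (F : ι → Q →ₗ[R] X) (G : κ → P →ₗ[R] X) (h : ∀ i j, F i (t j) = G j (s i)) :
    ∃ B : P →ₗ[R] Q →ₗ[R] X, (∀ i q, B (s i) q = F i q) ∧ ∀ p j, B p (t j) = G j p := by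
  have hsurj : Function.Surjective (Finsupp.linearCombination R s) := by
    rw [← LinearMap.range_eq_top, Finsupp.range_linearCombination, hs]
  have key : ∀ c j, Finsupp.linearCombination R F c (t j) = G j (Finsupp.linearCombination R s c) :=
    fun c j => by
      simp only [Finsupp.linearCombination_apply, Finsupp.sum, LinearMap.sum_apply,
        LinearMap.smul_apply, h, map_sum, map_smul]
  have hker : LinearMap.ker (Finsupp.linearCombination R s) ≤
      LinearMap.ker (Finsupp.linearCombination R F) := fun c hc => by
    rw [LinearMap.mem_ker] at hc ⊢
    refine LinearMap.ext_on_range ht fun j => ?_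
    rw [key, hc, map_zero, LinearMap.zero_apply]
  let B := ((LinearMap.ker (Finsupp.linearCombination R s)).liftQ _ hker).comp
    ((Finsupp.linearCombination R s).quotKerEquivOfSurjective hsurj).symm.toLinearMap
  have hB : ∀ c, B (Finsupp.linearCombination R s c) = Finsupp.linearCombination R F c := fun c => by
    have : ((Finsupp.linearCombination R s).quotKerEquivOfSurjective hsurj).symm
        (Finsupp.linearCombination R s c) = Submodule.Quotient.mk c := by
      rw [LinearEquiv.symm_apply_eq]
      rfl
    simp only [B, LinearMap.comp_apply, LinearEquiv.coe_coe, this, Submodule.liftQ_apply]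
  refine ⟨B, fun i q => ?_, fun p j => ?_⟩
  · have := hB (Finsupp.single i 1)
    simp only [Finsupp.linearCombination_single, one_smul] at this
    rw [this]
  · obtain ⟨c, rfl⟩ := hsurj p
    rw [hB, key]

/-! ### Two factors of the new generator -/

section Abstract

variable {R : Type*} [CommRing R] (α β u v : R) {A : Type*} [Ring A] [Algebra R A]
  (Y : SignType → A) (P : Subalgebra R A) {X : Type*} [AddCommGroup X] [Module R X]

/-- The expected conditional expectation of `x^e Y^d x^f`. -/
def condExp (e d f : SignType) : A :=
  straighten α β e d f fun a h b => mu u v h • (Y a * Y b)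

/-- `Θ e f b d` has the properties that are required of `T(x^e b x^f d)`, where `T` is an extension
of the trace to an algebra with one more generator `x`, which commutes with `P`. -/
structure IsTwoTrace (T : A →ₗ[R] X) (Θ : SignType → SignType → A →ₗ[R] A →ₗ[R] X) : Prop where
  symm : ∀ e f b d, Θ e f b d = Θ f e d b
  mul_left : ∀ e f, ∀ k ∈ P, ∀ b d, Θ e f (k * b) d = Θ e f b (d * k)
  zero_left : ∀ f b d, Θ 0 f b d = mu u v f • T (b * d)
  mid : ∀ e δ f d, Θ e f (Y δ) d = T (condExp α β u v Y e δ f * d)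

variable {α β u v Y P}

theorem IsTwoTrace.mul_right {T : A →ₗ[R] X} {Θ : SignType → SignType → A →ₗ[R] A →ₗ[R] X}
    (h : IsTwoTrace α β u v Y P T Θ) (e f : SignType) {k : A} (hk : k ∈ P) (b d : A) :
    Θ e f (b * k) d = Θ e f b (k * d) := by
  rw [h.symm, ← h.mul_left _ _ k hk, h.symm]

theorem IsTwoTrace.zero_right {T : A →ₗ[R] X} {Θ : SignType → SignType → A →ₗ[R] A →ₗ[R] X}
    (h : IsTwoTrace α β u v Y P T Θ) (e : SignType) (b d : A) (hT : ∀ a b, T (a * b) = T (b * a)) :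
    Θ e 0 b d = mu u v e • T (b * d) := by
  rw [h.symm, h.zero_left, hT]

theorem condExp_zero_left (d f : SignType) (hY : Y 0 = 1) :
    condExp α β u v Y 0 d f = mu u v f • Y d := by
  rw [condExp, straighten_zero_left, hY, mul_one]

theorem condExp_zero_right (e d : SignType) (hY : Y 0 = 1) :
    condExp α β u v Y e d 0 = mu u v e • Y d := by
  by_cases he : e = 0
  · subst he
    exact condExp_zero_left d 0 hY
  · rw [condExp, straighten_zero_right α β he, hY, one_mul]

/-- The family `k Y^d k'` with `k, k'` in `P`. -/
def sandwich (Y : SignType → A) (P : Subalgebra R A) (s : P × SignType × P) : A :=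
  s.1 * Y s.2.1 * s.2.2

theorem ext_sandwich (hspan : Submodule.span R (Set.range (sandwich Y P)) = ⊤) {f g : A →ₗ[R] X}
    (h : ∀ k ∈ P, ∀ d, ∀ k' ∈ P, f (k * Y d * k') = g (k * Y d * k')) : f = g :=
  LinearMap.ext_on_range hspan fun s => h _ s.1.2 _ _ s.2.2.2

/-- The values `T(x^e b x^f d)` are forced by the relations for `b = k Y^δ k'` with `k, k'` in `P`, since
`k` and `k'` can be moved across `x`, and symmetrically for `d`. Both ways to compute the value
agree by `hL`, which says that `T` vanishes on the pentagon defects. -/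
theorem exists_isTwoTrace (hspan : Submodule.span R (Set.range (sandwich Y P)) = ⊤) (hY : Y 0 = 1)
    {T : A →ₗ[R] X} (hT : ∀ a b, T (a * b) = T (b * a))
    (hL : ∀ e f δ η, e ≠ 0 → f ≠ 0 → ∀ b ∈ P, ∀ d ∈ P,
      T (condExp α β u v Y e δ f * b * (Y η * d)) =
        T (Y δ * b * (condExp α β u v Y f η e * d))) :
    ∃ Θ, IsTwoTrace α β u v Y P T Θ := by
  have hL' : ∀ e f δ η, ∀ b ∈ P, ∀ d ∈ P,
      T (condExp α β u v Y e δ f * b * (Y η * d)) =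
        T (Y δ * b * (condExp α β u v Y f η e * d)) := by
    intro e f δ η b hb d hd
    by_cases he : e = 0
    · subst he
      rw [condExp_zero_left _ _ hY, condExp_zero_right _ _ hY]
      simp
    by_cases hf : f = 0
    · subst hf
      rw [condExp_zero_left _ _ hY, condExp_zero_right _ _ hY]
      simp
    exact hL e f δ η he hf b hb d hd
  have hex : ∀ e f, ∃ Θ : A →ₗ[R] A →ₗ[R] X,
      (∀ s : P × SignType × P, ∀ d, Θ (sandwich Y P s) d =
        T (condExp α β u v Y e s.2.1 f * (s.2.2 * d * s.1))) ∧
      ∀ b, ∀ s : P × SignType × P, Θ b (sandwich Y P s) =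
        T (condExp α β u v Y f s.2.1 e * (s.2.2 * b * s.1)) := by
    intro e f
    refine exists_bilin hspan hspan
      (fun s => T.comp ((LinearMap.mulLeft R (condExp α β u v Y e s.2.1 f)).comp
        ((LinearMap.mulRight R (s.1 : A)).comp (LinearMap.mulLeft R (s.2.2 : A)))))
      (fun s => T.comp ((LinearMap.mulLeft R (condExp α β u v Y f s.2.1 e)).comp
        ((LinearMap.mulRight R (s.1 : A)).comp (LinearMap.mulLeft R (s.2.2 : A))))) fun s t => ?_
    have h1 := hL' e f s.2.1 t.2.1 (s.2.2 * t.1) (P.mul_mem s.2.2.2 t.1.2) (t.2.2 * s.1)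
      (P.mul_mem t.2.2.2 s.1.2)
    rw [hT (Y s.2.1 * _)] at h1
    simpa only [LinearMap.comp_apply, LinearMap.mulLeft_apply, LinearMap.mulRight_apply, sandwich,
      mul_assoc] using h1
  choose Θ h1 h2 using hex
  have g1 : ∀ e f, ∀ k ∈ P, ∀ δ, ∀ k' ∈ P, ∀ d, Θ e f (k * Y δ * k') d =
      T (condExp α β u v Y e δ f * (k' * d * k)) := fun e f k hk δ k' hk' d =>
    h1 e f (⟨k, hk⟩, δ, ⟨k', hk'⟩) d
  refine ⟨Θ, ⟨fun e f b d => ?_, fun e f k hk b d => ?_, fun f b d => ?_, fun e δ f d => ?_⟩⟩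
  · have : Θ e f = (Θ f e).flip := LinearMap.ext_on_range hspan fun s => by
      ext d
      rw [h1, LinearMap.flip_apply, h2]
    rw [this, LinearMap.flip_apply]
  · have : (Θ e f).flip d ∘ₗ LinearMap.mulLeft R k = (Θ e f).flip (d * k) :=
      ext_sandwich hspan fun k1 hk1 δ k2 hk2 => by
        simp only [LinearMap.comp_apply, LinearMap.mulLeft_apply, LinearMap.flip_apply]
        rw [g1 e f k1 hk1 δ k2 hk2, show k * (k1 * Y δ * k2) = (k * k1) * Y δ * k2 by
          simp only [mul_assoc], g1 e f _ (P.mul_mem hk hk1) δ k2 hk2]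
        simp only [mul_assoc]
    exact DFunLike.congr_fun this b
  · have : (Θ 0 f).flip d = mu u v f • (T ∘ₗ LinearMap.mulRight R d) :=
      ext_sandwich hspan fun k1 hk1 δ k2 hk2 => by
        simp only [LinearMap.comp_apply, LinearMap.mulRight_apply, LinearMap.flip_apply,
          LinearMap.smul_apply]
        rw [g1 0 f k1 hk1 δ k2 hk2, condExp_zero_left _ _ hY, smul_mul_assoc, map_smul,
          ← mul_assoc (Y δ), hT _ k1]
        simp only [mul_assoc]
    exact DFunLike.congr_fun this b
  · have := g1 e f 1 P.one_mem δ 1 P.one_mem d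
    simpa using this

variable (α β Y P)

/-- `C h d a` and `B e f b d a` have the properties that are required of a functional on the words
`a x^h d` and `a x^e b x^f d`. -/
structure IsTwoEval (C : SignType → A →ₗ[R] A →ₗ[R] X)
    (B : SignType → SignType → A →ₗ[R] A →ₗ[R] A →ₗ[R] X) : Prop where
  c_zero : ∀ d a, C 0 d a = C 0 1 (a * d)
  c_mul : ∀ e, ∀ k ∈ P, ∀ d a, C e (k * d) a = C e d (a * k)
  b_left : ∀ e f, ∀ k ∈ P, ∀ b d a, B e f (k * b) d a = B e f b d (a * k)
  b_right : ∀ e f, ∀ k ∈ P, ∀ b d a, B e f (b * k) d a = B e f b (k * d) a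
  zero_right : ∀ e b d a, B e 0 b d a = C e (b * d) a
  zero_left : ∀ f b d a, B 0 f b d a = C f d (a * b)
  mid : ∀ e δ f d a, B e f (Y δ) d a = straighten α β e δ f fun p h q => C h (Y q * d) (a * Y p)

/-- The two ways to straighten `a x^e Y^δ k x^g Y^η x^f d` have the same value. -/
def StraightAssoc (B : SignType → SignType → A →ₗ[R] A →ₗ[R] A →ₗ[R] X) (e δ g η f : SignType)
    (k d a : A) : Prop :=
  straighten α β e δ g (fun p h q => B h f (Y q * k * Y η) d (a * Y p)) =
    straighten α β g η f (fun p h q => B e h (Y δ * k * Y p) (Y q * d) a)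

variable {α β Y P}

/-- The straightenings agree for formal reasons if one of the three powers of `x` is trivial. -/
theorem IsTwoEval.assoc_of_zero (hY : Y 0 = 1) {C : SignType → A →ₗ[R] A →ₗ[R] X}
    {B : SignType → SignType → A →ₗ[R] A →ₗ[R] A →ₗ[R] X} (h : IsTwoEval α β Y P C B)
    {e g f : SignType} (δ η : SignType) (h0 : e = 0 ∨ g = 0 ∨ f = 0) {k : A} (hk : k ∈ P) (d a : A) :
    StraightAssoc α β Y B e δ g η f k d a := by
  unfold StraightAssoc
  by_cases he : e = 0
  · subst he
    rw [straighten_zero_left, hY, one_mul, h.b_left _ _ k hk, h.mid]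
    exact straighten_congr α β fun p j q => by rw [h.zero_left]; simp only [mul_assoc]
  by_cases hg : g = 0
  · subst hg
    rw [straighten_zero_left, straighten_zero_right α β he, hY]
    simp
  · obtain rfl : f = 0 := by tauto
    rw [straighten_zero_right α β hg, hY, mul_one, h.b_right _ _ k hk, h.mid]
    exact straighten_congr α β fun p j q => by rw [h.zero_right]; simp only [mul_assoc]

/-- The values `T(a x^h d D)` for the expected extension `T` of the trace. -/
def closeC (u v : R) (T : A →ₗ[R] X) (D : A) (h : SignType) : A →ₗ[R] A →ₗ[R] X :=
  mu u v h • (LinearMap.mul R A).compr₂ T ∘ₗ LinearMap.mulRight R D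

/-- The values `T(a x^e b x^f d D)` for the expected extension `T` of the trace. -/
def closeB (Θ : SignType → SignType → A →ₗ[R] A →ₗ[R] X) (D : A) (e f : SignType) :
    A →ₗ[R] A →ₗ[R] A →ₗ[R] X :=
  LinearMap.mk₂ R (fun b d => (Θ e f b) ∘ₗ LinearMap.mulLeft R (d * D))
    (fun b b' d => by ext; simp) (fun c b d => by ext; simp)
    (fun b d d' => by ext; simp [add_mul, mul_assoc]) (fun c b d => by ext; simp [mul_assoc])

@[simp] theorem closeC_apply (T : A →ₗ[R] X) (D : A) (h : SignType) (d a : A) :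
    closeC u v T D h d a = mu u v h • T (d * D * a) := rfl

@[simp] theorem closeB_apply (Θ : SignType → SignType → A →ₗ[R] A →ₗ[R] X) (D : A)
    (e f : SignType) (b d a : A) : closeB Θ D e f b d a = Θ e f b (d * D * a) := rfl

/-- Closing a word by `D` on the right satisfies the rules for words with at most two factors `x`. -/
theorem IsTwoTrace.isTwoEval {T : A →ₗ[R] X} {Θ : SignType → SignType → A →ₗ[R] A →ₗ[R] X}
    (h : IsTwoTrace α β u v Y P T Θ) (hT : ∀ a b, T (a * b) = T (b * a)) (D : A) :
    IsTwoEval α β Y P (closeC u v T D) (closeB Θ D) where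
  c_zero d a := by
    simp only [closeC_apply, one_mul]
    rw [mul_assoc d, hT d, mul_assoc]
  c_mul e k hk d a := by
    simp only [closeC_apply]
    rw [mul_assoc k, mul_assoc k, hT k, mul_assoc _ a]
  b_left e f k hk b d a := by
    simp only [closeB_apply]
    rw [h.mul_left e f k hk, mul_assoc _ a]
  b_right e f k hk b d a := by
    simp only [closeB_apply]
    rw [h.mul_right e f hk, mul_assoc k, mul_assoc k]
  zero_right e b d a := by
    simp only [closeB_apply, closeC_apply]
    rw [h.zero_right e _ _ hT, mul_assoc b, mul_assoc b]
  zero_left e b d a := by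
    simp only [closeB_apply, closeC_apply]
    rw [h.zero_left, hT, mul_assoc _ a]
  mid e δ f d a := by
    simp only [closeB_apply, closeC_apply]
    rw [h.mid]
    have := straighten_map α β (T ∘ₗ LinearMap.mulRight R (d * D * a)) e δ f
      (fun a h b => mu u v h • (Y a * Y b))
    rw [LinearMap.comp_apply, LinearMap.mulRight_apply] at this
    rw [condExp, this]
    refine straighten_congr α β fun p h q => ?_
    simp only [LinearMap.comp_apply, LinearMap.mulRight_apply, map_smul]
    rw [mul_assoc, hT]
    simp only [mul_assoc]

/-! ### Three factors of the new generator -/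

/-- `Ω g f e c b a` has the properties that are required of `T(x^g c x^f a x^e b)`. -/
structure IsThreeTrace (Θ : SignType → SignType → A →ₗ[R] A →ₗ[R] X)
    (Ω : SignType → SignType → SignType → A →ₗ[R] A →ₗ[R] A →ₗ[R] X) : Prop where
  cyclic : ∀ g f e c b a, Ω g f e c b a = Ω e g f b a c
  mul_left : ∀ g f e, ∀ k ∈ P, ∀ c b a, Ω g f e (k * c) b a = Ω g f e c (b * k) a
  mul_right : ∀ g f e, ∀ k ∈ P, ∀ c b a, Ω g f e (c * k) b a = Ω g f e c b (k * a)
  zero_left : ∀ f e c b a, Ω 0 f e c b a = Θ f e a (b * c)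
  zero_mid : ∀ g e c b a, Ω g 0 e c b a = Θ g e (c * a) b
  mid : ∀ g η f e b a, Ω g f e (Y η) b a = straighten α β g η f fun p h q => Θ h e (Y q * a) (b * Y p)

end Abstract

end

end Funar

namespace Funar

noncomputable section

/-! ### Existence of the values on three factors -/

section Abstract

variable {R : Type*} [CommRing R] {α β u v : R} {A : Type*} [Ring A] [Algebra R A]
  {Y : SignType → A} {P : Subalgebra R A} {X : Type*} [AddCommGroup X] [Module R X]

/-- The value of `T(x^g c x^f a x^e b)` is computed by straightening `x^g c x^f` or `x^f a x^e`; the two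
results agree if straightening is associative under the trace. By cyclic permutation this provides
all three ways to straighten. -/
theorem exists_isThreeTrace (hspan : Submodule.span R (Set.range (sandwich Y P)) = ⊤) (hY : Y 0 = 1)
    {T : A →ₗ[R] X} (hT : ∀ a b, T (a * b) = T (b * a))
    {Θ : SignType → SignType → A →ₗ[R] A →ₗ[R] X} (h : IsTwoTrace α β u v Y P T Θ)
    (hA : ∀ D e δ g η f, ∀ k ∈ P, StraightAssoc α β Y (closeB Θ D) e δ g η f k 1 1) :
    ∃ Ω, IsThreeTrace (α := α) (β := β) (Y := Y) (P := P) Θ Ω := by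
  have hex : ∀ g f e, ∃ Ω : A →ₗ[R] A →ₗ[R] A →ₗ[R] X,
      (∀ (s : P × SignType × P) b a, Ω (sandwich Y P s) b a =
        straighten α β g s.2.1 f fun p h q => Θ h e (Y q * s.2.2 * a) (b * (s.1 * Y p))) ∧
      ∀ c (s : P × SignType × P) a, Ω c (sandwich Y P s) a =
        straighten α β e s.2.1 g fun p h q => Θ h f (Y q * s.2.2 * c) (a * (s.1 * Y p)) := by
    intro g f e
    have h1 : ∀ (s : P × SignType × P) b a,
        (straighten α β g s.2.1 f fun p h q => (Θ h e).flip.compl₁₂ (LinearMap.mulRight R (s.1 * Y p))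
          (LinearMap.mulLeft R (Y q * s.2.2))) b a =
        straighten α β g s.2.1 f fun p h q => Θ h e (Y q * s.2.2 * a) (b * (s.1 * Y p)) :=
      fun s b a => by
        rw [straighten_apply, straighten_apply]
        rfl
    have h2 : ∀ (s : P × SignType × P) c a,
        (straighten α β e s.2.1 g fun p h q => (Θ h f).compl₁₂ (LinearMap.mulLeft R (Y q * s.2.2))
          (LinearMap.mulRight R (s.1 * Y p))) c a =
        straighten α β e s.2.1 g fun p h q => Θ h f (Y q * s.2.2 * c) (a * (s.1 * Y p)) :=
      fun s b a => by
        rw [straighten_apply, straighten_apply]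
        rfl
    obtain ⟨Ω, hΩ1, hΩ2⟩ := exists_bilin hspan hspan
      (fun s => straighten α β g s.2.1 f fun p h q => (Θ h e).flip.compl₁₂
        (LinearMap.mulRight R (s.1 * Y p)) (LinearMap.mulLeft R (Y q * s.2.2)))
      (fun s => straighten α β e s.2.1 g fun p h q => (Θ h f).compl₁₂
        (LinearMap.mulLeft R (Y q * s.2.2)) (LinearMap.mulRight R (s.1 * Y p))) (fun s t => by
        ext a
        rw [h1, h2]
        have h3 := hA (s.2.2 * a * t.1) e t.2.1 g s.2.1 f _ (P.mul_mem t.2.2.2 s.1.2)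
        simp only [StraightAssoc, closeB_apply, one_mul, mul_one] at h3
        have e1 : ∀ p j q, Θ j e (Y q * s.2.2 * a) (sandwich Y P t * (s.1 * Y p)) =
            Θ e j (Y t.2.1 * (t.2.2 * s.1 : A) * Y p) (Y q * (s.2.2 * a * t.1)) := fun p j q => by
          rw [h.symm, show sandwich Y P t * (s.1 * Y p) =
            t.1 * (Y t.2.1 * (t.2.2 * s.1 : A) * Y p) by simp only [sandwich, mul_assoc],
            h.mul_left _ _ _ t.1.2]
          simp only [mul_assoc]
        have e2 : ∀ p j q, Θ j f (Y q * t.2.2 * sandwich Y P s) (a * (t.1 * Y p)) =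
            Θ j f (Y q * (t.2.2 * s.1 : A) * Y s.2.1) (s.2.2 * a * t.1 * Y p) := fun p j q => by
          rw [show Y q * t.2.2 * sandwich Y P s =
            (Y q * (t.2.2 * s.1 : A) * Y s.2.1) * s.2.2 by simp only [sandwich, mul_assoc],
            h.mul_right _ _ s.2.2.2]
          simp only [mul_assoc]
        rw [straighten_congr α β e1, straighten_congr α β e2]
        exact h3.symm)
    exact ⟨Ω, fun s b a => by rw [hΩ1, h1], fun c s a => by rw [hΩ2, h2]⟩
  choose Ω h1 h2 using hex
  have g1 : ∀ g f e, ∀ k ∈ P, ∀ η, ∀ k' ∈ P, ∀ b a, Ω g f e (k * Y η * k') b a =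
      straighten α β g η f fun p h q => Θ h e (Y q * k' * a) (b * (k * Y p)) :=
    fun g f e k hk η k' hk' b a => h1 g f e (⟨k, hk⟩, η, ⟨k', hk'⟩) b a
  refine ⟨Ω, ⟨?_, ?_, ?_, ?_, ?_, ?_⟩⟩
  · intro g f e c b a
    have : (Ω g f e c).flip a = ((Ω e g f).flip a).flip c :=
      LinearMap.ext_on_range hspan fun s => by
        simp only [LinearMap.flip_apply, h1, h2]
    exact DFunLike.congr_fun this b
  · intro g f e k hk c b a
    have : ((Ω g f e).flip b).flip a ∘ₗ LinearMap.mulLeft R k = ((Ω g f e).flip (b * k)).flip a :=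
      ext_sandwich hspan fun k1 hk1 η k2 hk2 => by
        simp only [LinearMap.comp_apply, LinearMap.mulLeft_apply, LinearMap.flip_apply]
        rw [g1 g f e k1 hk1 η k2 hk2, show k * (k1 * Y η * k2) = (k * k1) * Y η * k2 by
          simp only [mul_assoc], g1 g f e _ (P.mul_mem hk hk1) η k2 hk2]
        simp only [mul_assoc]
    exact DFunLike.congr_fun this c
  · intro g f e k hk c b a
    have : ((Ω g f e).flip b).flip a ∘ₗ LinearMap.mulRight R k = ((Ω g f e).flip b).flip (k * a) :=
      ext_sandwich hspan fun k1 hk1 η k2 hk2 => by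
        simp only [LinearMap.comp_apply, LinearMap.mulRight_apply, LinearMap.flip_apply]
        rw [g1 g f e k1 hk1 η k2 hk2, mul_assoc _ k2,  g1 g f e k1 hk1 η _ (P.mul_mem hk2 hk)]
        simp only [mul_assoc]
    exact DFunLike.congr_fun this c
  · intro f e c b a
    have : ((Ω 0 f e).flip b).flip a = (Θ f e a) ∘ₗ LinearMap.mulLeft R b :=
      ext_sandwich hspan fun k1 hk1 η k2 hk2 => by
        simp only [LinearMap.comp_apply, LinearMap.mulLeft_apply, LinearMap.flip_apply]
        rw [g1 0 f e k1 hk1 η k2 hk2, straighten_zero_left, hY, one_mul, h.mul_left _ _ k2 hk2]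
        simp only [mul_assoc]
    exact DFunLike.congr_fun this c
  · intro g e c b a
    have : ((Ω g 0 e).flip b).flip a = ((Θ g e).flip b) ∘ₗ LinearMap.mulRight R a :=
      ext_sandwich hspan fun k1 hk1 η k2 hk2 => by
        simp only [LinearMap.comp_apply, LinearMap.mulRight_apply, LinearMap.flip_apply]
        rw [g1 g 0 e k1 hk1 η k2 hk2]
        by_cases hg : g = 0
        · subst hg
          rw [straighten_zero_left, hY, h.zero_left, h.zero_left, one_mul, hT,
            hT (k1 * Y η * k2 * a)]
          simp only [mul_assoc]
        · rw [straighten_zero_right α β hg, hY, mul_one, mul_assoc k1, mul_assoc k1,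
            h.mul_left _ _ k1 hk1]
    exact DFunLike.congr_fun this c
  · intro g η f e b a
    have := g1 g f e 1 P.one_mem η 1 P.one_mem b a
    simpa using this

/-- The values `T(a x^h d a' x^e b')`. -/
def actC (Θ : SignType → SignType → A →ₗ[R] A →ₗ[R] X) (a' : A) (e' : SignType) (b' : A)
    (h : SignType) : A →ₗ[R] A →ₗ[R] X :=
  (Θ h e').compl₁₂ (LinearMap.mulRight R a') (LinearMap.mulLeft R b')

/-- The values `T(a x^e c x^f d a' x^{e'} b')`. -/
def actB (Ω : SignType → SignType → SignType → A →ₗ[R] A →ₗ[R] A →ₗ[R] X) (a' : A)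
    (e' : SignType) (b' : A) (e f : SignType) : A →ₗ[R] A →ₗ[R] A →ₗ[R] X :=
  LinearMap.mk₂ R (fun c d => (Ω e f e' c).flip (d * a') ∘ₗ LinearMap.mulLeft R b')
    (fun b b' d => by ext; simp) (fun c b d => by ext; simp)
    (fun b d d' => by ext; simp [add_mul]) (fun c b d => by ext; simp)

@[simp] theorem actC_apply (Θ : SignType → SignType → A →ₗ[R] A →ₗ[R] X) (a' : A) (e' : SignType)
    (b' : A) (h : SignType) (d a : A) : actC Θ a' e' b' h d a = Θ h e' (d * a') (b' * a) := rfl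

@[simp] theorem actB_apply (Ω : SignType → SignType → SignType → A →ₗ[R] A →ₗ[R] A →ₗ[R] X)
    (a' : A) (e' : SignType) (b' : A) (e f : SignType) (c d a : A) :
    actB Ω a' e' b' e f c d a = Ω e f e' c (b' * a) (d * a') := rfl

variable {T : A →ₗ[R] X} {Θ : SignType → SignType → A →ₗ[R] A →ₗ[R] X}
  {Ω : SignType → SignType → SignType → A →ₗ[R] A →ₗ[R] A →ₗ[R] X}

/-- Closing a word by `a' x^e' b'` satisfies the rules for words with at most two factors `x`. -/
theorem IsThreeTrace.isTwoEval (hΩ : IsThreeTrace (α := α) (β := β) (Y := Y) (P := P) Θ Ω)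
    (h : IsTwoTrace α β u v Y P T Θ) (hT : ∀ a b, T (a * b) = T (b * a)) (a' : A) (e' : SignType)
    (b' : A) : IsTwoEval α β Y P (actC Θ a' e' b') (actB Ω a' e' b') where
  c_zero d a := by
    simp only [actC_apply, h.zero_left, one_mul]
    rw [mul_assoc, hT]
    simp only [mul_assoc]
  c_mul e k hk d a := by
    simp only [actC_apply, mul_assoc, h.mul_left _ _ k hk]
  b_left e f k hk b d a := by
    simp only [actB_apply, mul_assoc, hΩ.mul_left _ _ _ k hk]
  b_right e f k hk b d a := by
    simp only [actB_apply, mul_assoc, hΩ.mul_right _ _ _ k hk]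
  zero_right e b d a := by
    simp only [actB_apply, actC_apply, mul_assoc, hΩ.zero_mid]
  zero_left f b d a := by
    simp only [actB_apply, actC_apply, mul_assoc, hΩ.zero_left]
  mid e δ f d a := by
    simp only [actB_apply, actC_apply, mul_assoc, hΩ.mid]

/-! ### The regular representation of the extended algebra -/

/-- The pairing of `c x^f d` with `a x^e b`, on formal combinations of such expressions. -/
def formalPair (Θ : SignType → SignType → A →ₗ[R] A →ₗ[R] X) :
    (A × SignType × A →₀ R) →ₗ[R] (A × SignType × A →₀ R) →ₗ[R] X :=
  Finsupp.linearCombination R fun s => Finsupp.linearCombination R fun t =>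
    Θ s.2.1 t.2.1 (s.2.2 * t.1) (t.2.2 * s.1)

/-- Formal combinations of expressions `c x^f d` modulo the kernel of the pairing. -/
abbrev Reg (Θ : SignType → SignType → A →ₗ[R] A →ₗ[R] X) : Type _ :=
  (A × SignType × A →₀ R) ⧸ LinearMap.ker (formalPair Θ)

/-- The functional `T(· a x^e b)`. -/
def regVal (Θ : SignType → SignType → A →ₗ[R] A →ₗ[R] X) (e : SignType) (a b : A) :
    Reg Θ →ₗ[R] X :=
  (LinearMap.ker (formalPair Θ)).liftQ ((formalPair Θ).flip (Finsupp.single (a, e, b) 1))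
    fun m hm => by
      rw [LinearMap.mem_ker] at hm
      rw [LinearMap.mem_ker, LinearMap.flip_apply, hm, LinearMap.zero_apply]

theorem regVal_mk (e : SignType) (a b : A) (m : A × SignType × A →₀ R) :
    regVal Θ e a b (Submodule.Quotient.mk m) = formalPair Θ m (Finsupp.single (a, e, b) 1) := rfl

theorem formalPair_single (s t : A × SignType × A) :
    formalPair Θ (Finsupp.single s 1) (Finsupp.single t 1) =
      Θ s.2.1 t.2.1 (s.2.2 * t.1) (t.2.2 * s.1) := by
  simp [formalPair]

theorem reg_ext {q q' : Reg Θ} (h : ∀ e a b, regVal Θ e a b q = regVal Θ e a b q') : q = q' := by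
  obtain ⟨m, rfl⟩ := Submodule.Quotient.mk_surjective _ q
  obtain ⟨m', rfl⟩ := Submodule.Quotient.mk_surjective _ q'
  rw [Submodule.Quotient.eq, LinearMap.mem_ker]
  ext t
  have := h t.2.1 t.1 t.2.2
  rw [regVal_mk, regVal_mk] at this
  simpa [sub_eq_zero] using this

/-- The class of `c x^f d`. -/
def regCl (Θ : SignType → SignType → A →ₗ[R] A →ₗ[R] X) (f : SignType) : A →ₗ[R] A →ₗ[R] Reg Θ :=
  LinearMap.mk₂ R (fun c d => Submodule.Quotient.mk (Finsupp.single (c, f, d) 1))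
    (fun c c' d => reg_ext fun e a b => by
      simp only [map_add, regVal_mk, formalPair_single, mul_add])
    (fun r c d => reg_ext fun e a b => by
      simp only [map_smul, regVal_mk, formalPair_single, mul_smul_comm])
    (fun c d d' => reg_ext fun e a b => by
      simp only [map_add, regVal_mk, formalPair_single, add_mul, LinearMap.add_apply])
    (fun r c d => reg_ext fun e a b => by
      simp only [map_smul, regVal_mk, formalPair_single, smul_mul_assoc, LinearMap.smul_apply])

@[simp] theorem regVal_regCl (e f : SignType) (a b c d : A) :
    regVal Θ e a b (regCl Θ f c d) = Θ f e (d * a) (b * c) :=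
  formalPair_single _ _

theorem reg_hom_ext {X' : Type*} [AddCommGroup X'] [Module R X'] {φ ψ : Reg Θ →ₗ[R] X'}
    (h : ∀ f c d, φ (regCl Θ f c d) = ψ (regCl Θ f c d)) : φ = ψ := by
  refine Submodule.linearMap_qext _ (Finsupp.lhom_ext' fun s => ?_)
  ext
  exact h s.2.1 s.1 s.2.2

/-- There is an endomorphism of `Reg` for which the images of `c x^f d` have prescribed pairings with
`a x^e b` as soon as, for fixed `f, c, d`, these are the pairings of an element and, for fixed
`e, a, b`, the values of a functional. -/
theorem exists_regEnd (g : SignType → A → A → SignType → A → A → X)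
    (hl : ∀ f c d, ∃ q : Reg Θ, ∀ e a b, regVal Θ e a b q = g f c d e a b)
    (hr : ∀ e a b, ∃ φ : Reg Θ →ₗ[R] X, ∀ f c d, φ (regCl Θ f c d) = g f c d e a b) :
    ∃ l : Reg Θ →ₗ[R] Reg Θ, ∀ f c d e a b, regVal Θ e a b (l (regCl Θ f c d)) = g f c d e a b := by
  choose q hq using hl
  choose φ hφ using hr
  have key : ∀ m e a b, regVal Θ e a b
      (Finsupp.linearCombination R (fun s : A × SignType × A => q s.2.1 s.1 s.2.2) m) =
      φ e a b (Submodule.Quotient.mk m) := by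
    intro m e a b
    have : (regVal Θ e a b) ∘ₗ
        (Finsupp.linearCombination R fun s : A × SignType × A => q s.2.1 s.1 s.2.2) =
        (φ e a b) ∘ₗ (LinearMap.ker (formalPair Θ)).mkQ := by
      refine Finsupp.lhom_ext' fun s => ?_
      ext
      simp only [LinearMap.comp_apply, Finsupp.lsingle_apply, Finsupp.linearCombination_single,
        one_smul, hq, Submodule.mkQ_apply]
      exact (hφ e a b s.2.1 s.1 s.2.2).symm
    exact DFunLike.congr_fun this m
  refine ⟨(LinearMap.ker (formalPair Θ)).liftQ
    (Finsupp.linearCombination R fun s : A × SignType × A => q s.2.1 s.1 s.2.2) fun m hm => ?_,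
    fun f c d e a b => ?_⟩
  · rw [LinearMap.mem_ker]
    refine reg_ext fun e a b => ?_
    rw [key, (Submodule.Quotient.mk_eq_zero _).mpr hm, map_zero, map_zero]
  · rw [regCl, LinearMap.mk₂_apply, Submodule.liftQ_apply, Finsupp.linearCombination_single,
      one_smul, hq]

end Abstract

end

end Funar

namespace Funar

noncomputable section

/-! ### The action of the generators on the regular representation -/

section Abstract

variable {R : Type*} [CommRing R] {α β u v : R} {A : Type*} [Ring A] [Algebra R A]
  {Y : SignType → A} {P : Subalgebra R A} {X : Type*} [AddCommGroup X] [Module R X]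
  {T : A →ₗ[R] X} {Θ : SignType → SignType → A →ₗ[R] A →ₗ[R] X}
  {Ω : SignType → SignType → SignType → A →ₗ[R] A →ₗ[R] A →ₗ[R] X}

/-- The given algebra acts on `Reg` by multiplication from the left. -/
theorem exists_regLeft (Θ : SignType → SignType → A →ₗ[R] A →ₗ[R] X) :
    ∃ ρ : A →ₐ[R] Module.End R (Reg Θ), ∀ k f c d, ρ k (regCl Θ f c d) = regCl Θ f (k * c) d := by
  have hex : ∀ k : A, ∃ l : Reg Θ →ₗ[R] Reg Θ, ∀ f c d, l (regCl Θ f c d) = regCl Θ f (k * c) d := by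
    intro k
    obtain ⟨l, hl⟩ := exists_regEnd (Θ := Θ) (fun f c d e a b => Θ f e (d * a) (b * (k * c)))
      (fun f c d => ⟨regCl Θ f (k * c) d, fun e a b => regVal_regCl ..⟩)
      (fun e a b => ⟨regVal Θ e a (b * k), fun f c d => by rw [regVal_regCl, mul_assoc]⟩)
    exact ⟨l, fun f c d => reg_ext fun e a b => by rw [hl, regVal_regCl]⟩
  choose l hl using hex
  refine ⟨AlgHom.ofLinearMap
    { toFun := l
      map_add' := fun k k' => reg_hom_ext fun f c d => by
        simp only [LinearMap.add_apply, hl, add_mul, map_add]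
      map_smul' := fun r k => reg_hom_ext fun f c d => by
        simp only [LinearMap.smul_apply, hl, smul_mul_assoc, map_smul, RingHom.id_apply] }
    (reg_hom_ext fun f c d => ?_) fun k k' => reg_hom_ext fun f c d => ?_, hl⟩
  · exact (hl 1 f c d).trans (by rw [one_mul]; rfl)
  · exact (hl (k * k') f c d).trans (by
      rw [Module.End.mul_apply]
      exact (by rw [mul_assoc, ← hl k, ← hl k'] : regCl Θ f (k * k' * c) d = l k (l k' _)))

/-- The action of powers of the new generator, where `ρ` is the action of the given algebra. -/
structure IsRegAction (α β : R) (Y : SignType → A) (P : Subalgebra R A)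
    (Θ : SignType → SignType → A →ₗ[R] A →ₗ[R] X) (ρ : A →ₐ[R] Module.End R (Reg Θ))
    (l : SignType → Module.End R (Reg Θ)) : Prop where
  left : ∀ k f c d, ρ k (regCl Θ f c d) = regCl Θ f (k * c) d
  zero : l 0 = 1
  cl_zero : ∀ g c d, l g (regCl Θ 0 c d) = regCl Θ g 1 (c * d)
  comm : ∀ g, ∀ k ∈ P, l g * ρ k = ρ k * l g
  rel : ∀ g δ h, l g * ρ (Y δ) * l h = straighten α β g δ h fun p j q => ρ (Y p) * l j * ρ (Y q)
  val : ∀ e a b q, regVal Θ 0 1 1 (ρ a (l e (ρ b q))) = regVal Θ e a b q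

/-- The generator `x` acts on `Reg` by straightening `x^g c x^f`. This satisfies the relations since
straightening is associative under all pairings with `a' x^e' b'`. -/
theorem exists_regAction (hspan : Submodule.span R (Set.range (sandwich Y P)) = ⊤)
    (h : IsTwoTrace α β u v Y P T Θ)
    (hΩ : IsThreeTrace (α := α) (β := β) (Y := Y) (P := P) Θ Ω)
    (hA : ∀ a' e' b' e δ g η f, ∀ k ∈ P, ∀ d,
      StraightAssoc α β Y (actB Ω a' e' b') e δ g η f k d 1) :
    ∃ ρ l, IsRegAction α β Y P Θ ρ l := by
  obtain ⟨ρ, hρ⟩ := exists_regLeft Θ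
  have hex : ∀ g, ∃ l : Reg Θ →ₗ[R] Reg Θ, ∀ f c d e a b,
      regVal Θ e a b (l (regCl Θ f c d)) = Ω g f e c b (d * a) := by
    intro g
    refine exists_regEnd (fun f c d e a b => Ω g f e c b (d * a)) (fun f c d => ?_)
      fun e a b => ?_
    · have hc : c ∈ Submodule.span R (Set.range (sandwich Y P)) := by rw [hspan]; trivial
      induction hc using Submodule.span_induction with
      | mem c hc =>
        obtain ⟨⟨⟨k, hk⟩, η, ⟨k', hk'⟩⟩, rfl⟩ := hc
        refine ⟨straighten α β g η f fun p j q => regCl Θ j (k * Y p) (Y q * k' * d),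
          fun e a b => ?_⟩
        simp only [straighten_map, regVal_regCl, sandwich]
        rw [hΩ.mul_right _ _ _ _ hk', hΩ.mul_left _ _ _ _ hk, hΩ.mid]
        simp only [mul_assoc]
      | zero => exact ⟨0, by simp⟩
      | add x y _ _ hx hy =>
        obtain ⟨q, hq⟩ := hx
        obtain ⟨q', hq'⟩ := hy
        exact ⟨q + q', by simp [hq, hq']⟩
      | smul r x _ hx =>
        obtain ⟨q, hq⟩ := hx
        exact ⟨r • q, by simp [hq]⟩
    · have hb : b ∈ Submodule.span R (Set.range (sandwich Y P)) := by rw [hspan]; trivial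
      induction hb using Submodule.span_induction with
      | mem c hc =>
        obtain ⟨⟨⟨k, hk⟩, δ, ⟨k', hk'⟩⟩, rfl⟩ := hc
        refine ⟨straighten α β e δ g fun p j q => regVal Θ j (a * k * Y p) (Y q * k'),
          fun f c d => ?_⟩
        simp only [straighten_apply, regVal_regCl, sandwich]
        rw [hΩ.cyclic, hΩ.mul_right _ _ _ _ hk', hΩ.mul_left _ _ _ _ hk, hΩ.mid]
        refine straighten_congr α β fun p j q => ?_
        rw [h.symm]
        simp only [mul_assoc]
      | zero => exact ⟨0, by simp⟩
      | add x y _ _ hx hy =>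
        obtain ⟨q, hq⟩ := hx
        obtain ⟨q', hq'⟩ := hy
        exact ⟨q + q', by simp [hq, hq']⟩
      | smul r x _ hx =>
        obtain ⟨q, hq⟩ := hx
        exact ⟨r • q, by simp [hq]⟩
  choose l hl using hex
  have hleft : ∀ k e a b q, regVal Θ e a b (ρ k q) = regVal Θ e a (b * k) q := by
    intro k e a b q
    have : regVal Θ e a b ∘ₗ ρ k = regVal Θ e a (b * k) := reg_hom_ext fun f c d => by
      rw [LinearMap.comp_apply, hρ, regVal_regCl, regVal_regCl, mul_assoc]
    exact DFunLike.congr_fun this q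
  have hexp : ∀ g f, ∀ k ∈ P, ∀ η, ∀ k' ∈ P, ∀ d, l g (regCl Θ f (k * Y η * k') d) =
      straighten α β g η f fun p j q => regCl Θ j (k * Y p) (Y q * k' * d) := by
    intro g f k hk η k' hk' d
    refine reg_ext fun e a b => ?_
    rw [hl, straighten_map, hΩ.mul_right _ _ _ _ hk', hΩ.mul_left _ _ _ _ hk, hΩ.mid]
    simp only [regVal_regCl, mul_assoc]
  refine ⟨ρ, l, hρ, ?_, ?_, ?_, ?_, ?_⟩
  · exact reg_hom_ext fun f c d => reg_ext fun e a b => by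
      rw [hl, hΩ.zero_left, Module.End.one_apply, regVal_regCl]
  · intro g c d
    refine reg_ext fun e a b => ?_
    rw [hl, hΩ.zero_mid, regVal_regCl, mul_one, mul_assoc]
  · intro g k hk
    refine reg_hom_ext fun f c d => reg_ext fun e a b => ?_
    rw [Module.End.mul_apply, Module.End.mul_apply, hρ, hl, hleft, hl, hΩ.mul_left _ _ _ _ hk]
  · intro g δ h'
    refine reg_hom_ext fun f c d => ?_
    suffices hs : ((l g * ρ (Y δ) * l h') ∘ₗ (regCl Θ f).flip d) =
        (straighten α β g δ h' fun p j q => ρ (Y p) * l j * ρ (Y q)) ∘ₗ (regCl Θ f).flip d from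
      DFunLike.congr_fun hs c
    refine ext_sandwich hspan fun k hk η k' hk' => reg_ext fun e a b => ?_
    simp only [LinearMap.comp_apply, LinearMap.flip_apply, Module.End.mul_apply, hexp _ _ _ hk _ _ hk',
      straighten_map, straighten_apply, hρ, hl, hleft]
    have h3 := hA a e b g δ h' η f k hk (k' * d)
    simp only [StraightAssoc, actB_apply, mul_one, one_mul] at h3
    refine Eq.trans ?_ (h3.symm.trans ?_)
    · refine straighten_congr α β fun p j q => ?_
      simp only [mul_assoc]
    · refine straighten_congr α β fun p j q => ?_
      rw [← mul_assoc, ← mul_assoc, hΩ.mul_right _ _ _ _ hk']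
      simp only [mul_assoc]
  · intro e a b q
    have : regVal Θ 0 1 1 ∘ₗ (ρ a * l e * ρ b) = regVal Θ e a b := reg_hom_ext fun f c d => by
      rw [LinearMap.comp_apply, Module.End.mul_apply, Module.End.mul_apply, hρ, hleft, hl, hΩ.cyclic,
        hΩ.zero_left, regVal_regCl, h.symm, one_mul, mul_one]
    exact DFunLike.congr_fun this q

end Abstract

end

end Funar

namespace Funar

noncomputable section

/-! ### Extension of the trace by a matrix coefficient -/

section Extend

variable {R : Type*} [CommRing R] {α β u v : R} {X : Type*} [AddCommGroup X] [Module R X]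

/-- A sign as an element of `SignType`. -/
def sg (e : Bool) : SignType := bif e then 1 else -1

theorem genPow_sg (i : ℕ) (e : Bool) : genPow i (sg e) = gen i e := by cases e <;> rfl

theorem mu_sg (u v : R) (e : Bool) : mu u v (sg e) = bif e then u else v := by cases e <;> rfl

theorem sg_ne_zero (e : Bool) : sg e ≠ 0 := by cases e <;> decide

theorem exists_sg {e : SignType} (he : e ≠ 0) : ∃ b, e = sg b := by
  cases e
  · exact absurd rfl he
  · exact ⟨false, rfl⟩
  · exact ⟨true, rfl⟩

/-- The powers of the last generator of `K (m + 2)`. -/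
def lastPow (α β : R) (m : ℕ) (δ : SignType) : K α β (m + 2) := cls α β (m + 2) (w R (genPow m δ))

/-- The image of `K (m + 1)` in `K (m + 2)`. -/
def prevK (α β : R) (m : ℕ) : Subalgebra R (K α β (m + 2)) := (kMap α β (Nat.le_succ (m + 1))).range

theorem lastPow_zero (m : ℕ) : lastPow α β m 0 = 1 := cls_one ..

theorem lastPow_sg (m : ℕ) (e : Bool) : lastPow α β m (sg e) = sK α β (m + 2) m e := by
  rw [lastPow, genPow_sg, cls_gen]

theorem cls_mem_prevK {m : ℕ} {W : Word} (h : InIdx (· < m) W) :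
    cls α β (m + 2) (w R W) ∈ prevK α β m :=
  ⟨cls α β (m + 1) (w R W), kMap_cls α β _ (w_mem_Sp (h.mono fun i hi => by omega))⟩

/-- `K (m + 2)` is spanned by the products `k x^e k'`, where `x` is its last generator and `k, k'` belong
to the image of `K (m + 1)`. -/
theorem span_sandwich {r : Word → FA R} (hr : IsReductionMap α β r) (m : ℕ) :
    Submodule.span R (Set.range (sandwich (lastPow α β m) (prevK α β m))) = ⊤ := by
  rw [eq_top_iff, ← span_cls α β (m + 2), Submodule.span_le]
  rintro _ ⟨W, hW, rfl⟩
  refine Submodule.span_mono ?_ (cls_mem_span_mid hr (n := m + 2) (j := m) (by omega)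
    (hW.mono fun i hi => by omega))
  rintro _ ⟨A, B, e, hA, hB, rfl⟩
  exact ⟨(⟨_, cls_mem_prevK hA⟩, e, ⟨_, cls_mem_prevK hB⟩), by
    rw [cls_mul, cls_mul]
    rfl⟩

/-- The extension of the trace is the matrix coefficient of `K (m + 3)` acting on `Reg`: its value at `k`
is the pairing of `k • 1` with `1`. It is a trace since the pairing is symmetric. -/
theorem IsRegAction.exists_extension {r : Word → FA R} (hr : IsReductionMap α β r) {m : ℕ}
    {T : K α β (m + 2) →ₗ[R] X} {Θ : SignType → SignType → K α β (m + 2) →ₗ[R] K α β (m + 2) →ₗ[R] X}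
    {ρ : K α β (m + 2) →ₐ[R] Module.End R (Reg Θ)} {l : SignType → Module.End R (Reg Θ)}
    (h : IsTwoTrace α β u v (lastPow α β m) (prevK α β m) T Θ)
    (hl : IsRegAction α β (lastPow α β m) (prevK α β m) Θ ρ l) :
    ∃ T' : K α β (m + 3) →ₗ[R] X, (∀ a b, T' (a * b) = T' (b * a)) ∧
      (∀ a, T' (kMap α β (Nat.le_succ (m + 2)) a) = T a) ∧
      ∀ a e, T' (kMap α β (Nat.le_succ (m + 2)) a * sK α β (m + 3) (m + 1) e) =
        (bif e then u else v) • T a := by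
  have hl1 : l 1 * l (-1) = 1 := by
    have := hl.rel 1 0 (-1)
    rw [lastPow_zero, map_one, mul_one] at this
    rw [this]
    change Finsupp.linearCombination R _ (Finsupp.single (0, 0, 0) 1) = _
    simp [lastPow_zero, hl.zero]
  have hl2 : l (-1) * l 1 = 1 := by
    have := hl.rel (-1) 0 1
    rw [lastPow_zero, map_one, mul_one] at this
    rw [this]
    change Finsupp.linearCombination R _ (Finsupp.single (0, 0, 0) 1) = _
    simp [lastPow_zero, hl.zero]
  -- The images of the generators of `K (m + 3)` and of their inverses.
  let G : ℕ → Bool → Module.End R (Reg Θ) := fun i e =>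
    if i < m + 1 then ρ (sK α β (m + 2) i e) else l (sg e)
  have hG : ∀ i e, i < m + 1 → G i e = ρ (sK α β (m + 2) i e) := fun i e hi => if_pos hi
  have hG' : ∀ e, G (m + 1) e = l (sg e) := fun e => if_neg (lt_irrefl _)
  have hinv : ∀ i e, G i e * G i (!e) = 1 := by
    intro i e
    by_cases hi : i < m + 1
    · rw [hG _ _ hi, hG _ _ hi, ← map_mul, sK_mul_not, map_one]
    · cases e
      · simp only [G, if_neg hi]
        exact hl2
      · simp only [G, if_neg hi]
        exact hl1
  have hlast : ∀ e, G m e = ρ (lastPow α β m (sg e)) := fun e => by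
    rw [hG _ _ (by omega), lastPow_sg]
  let g : GenIdx (m + 3) → (Module.End R (Reg Θ))ˣ := fun i =>
    ⟨G i.1 true, G i.1 false, hinv _ _, hinv _ _⟩
  refine Exists.elim (exists_K_lift (α := α) (β := β) g ?_ ?_ ?_ ?_) fun F hF => ?_
  rotate_left 4
  · have hF1 : ∀ a, F (kMap α β (Nat.le_succ (m + 2)) a) = ρ a := by
      intro a
      have : F.comp (kMap α β (Nat.le_succ (m + 2))) = ρ := K.algHom_ext fun i => by
        rw [AlgHom.comp_apply, kMap_toK, braidMap_sigma, (hF _).1]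
        have hi : i.1 < m + 1 := by have := i.2; omega
        change G i.1 true = _
        rw [hG _ _ hi, sK, sigmaPow, dif_pos i.2]
        rfl
      exact DFunLike.congr_fun this a
    have hF2 : ∀ e, F (sK α β (m + 3) (m + 1) e) = l (sg e) := by
      intro e
      have := hF ⟨m + 1, by omega⟩
      rw [sK, sigmaPow, dif_pos (by omega), ← hG']
      cases e
      · exact this.2
      · exact this.1
    have hF3 : ∀ e, F (cls α β (m + 3) (w R (genPow (m + 1) e))) = l e := by
      intro e
      by_cases he : e = 0
      · subst he
        rw [hl.zero, ← map_one F]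
        exact congrArg F (cls_one ..)
      · obtain ⟨b, rfl⟩ := exists_sg he
        rw [genPow_sg, cls_gen, hF2]
    have hspan : Submodule.span R {k | ∃ a e b, k = kMap α β (Nat.le_succ (m + 2)) a *
        cls α β (m + 3) (w R (genPow (m + 1) e)) * kMap α β (Nat.le_succ (m + 2)) b} = ⊤ := by
      rw [eq_top_iff, ← span_cls α β (m + 3), Submodule.span_le]
      rintro _ ⟨W, hW, rfl⟩
      refine Submodule.span_mono ?_ (cls_mem_span_mid hr (n := m + 3) (j := m + 1) (by omega)
        (hW.mono fun i hi => by omega))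
      rintro _ ⟨A, B, e, hA, hB, rfl⟩
      refine ⟨cls α β (m + 2) (w R A), e, cls α β (m + 2) (w R B), ?_⟩
      rw [kMap_cls α β _ (w_mem_Sp (hA.mono fun i hi => by omega)),
        kMap_cls α β _ (w_mem_Sp (hB.mono fun i hi => by omega)), cls_mul, cls_mul]
    have hval : ∀ a e b q, regVal Θ 0 1 1 (F (kMap α β (Nat.le_succ (m + 2)) a *
        cls α β (m + 3) (w R (genPow (m + 1) e)) * kMap α β (Nat.le_succ (m + 2)) b) q) =
        regVal Θ e a b q := by
      intro a e b q
      rw [map_mul, map_mul, hF1, hF1, hF3, Module.End.mul_apply, Module.End.mul_apply, hl.val]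
    have hcl : ∀ a e b, F (kMap α β (Nat.le_succ (m + 2)) a *
        cls α β (m + 3) (w R (genPow (m + 1) e)) * kMap α β (Nat.le_succ (m + 2)) b)
        (regCl Θ 0 1 1) = regCl Θ e a b := by
      intro a e b
      rw [map_mul, map_mul, hF1, hF1, hF3, Module.End.mul_apply, Module.End.mul_apply, hl.left,
        hl.cl_zero, hl.left]
      simp
    let T' : K α β (m + 3) →ₗ[R] X :=
      regVal Θ 0 1 1 ∘ₗ LinearMap.applyₗ (regCl Θ 0 1 1) ∘ₗ F.toLinearMap
    have hT' : ∀ k, T' k = regVal Θ 0 1 1 (F k (regCl Θ 0 1 1)) := fun _ => rfl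
    have hmid : ∀ a e b, T' (kMap α β (Nat.le_succ (m + 2)) a *
        cls α β (m + 3) (w R (genPow (m + 1) e)) * kMap α β (Nat.le_succ (m + 2)) b) =
        Θ 0 e a b := by
      intro a e b
      rw [hT', hcl, regVal_regCl, h.symm]
      simp
    refine ⟨T', ?_, ?_, ?_⟩
    · have : (LinearMap.mul R (K α β (m + 3))).compr₂ T' =
          ((LinearMap.mul R (K α β (m + 3))).compr₂ T').flip := by
        refine LinearMap.ext_on hspan ?_
        rintro _ ⟨a, e, b, rfl⟩
        refine LinearMap.ext_on hspan ?_
        rintro _ ⟨a', e', b', rfl⟩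
        simp only [LinearMap.compr₂_apply, LinearMap.flip_apply, LinearMap.mul_apply']
        rw [hT', hT', map_mul, map_mul F (kMap _ _ _ a' * _ * _), Module.End.mul_apply,
          Module.End.mul_apply, hval, hval, hcl, hcl, regVal_regCl, regVal_regCl, h.symm]
      exact fun a b => DFunLike.congr_fun (DFunLike.congr_fun this a) b
    · intro a
      have := hmid a 0 1
      rw [map_one, mul_one, h.zero_left, mul_one, show mu u v 0 = 1 from rfl, one_smul] at this
      rw [← this]
      congr 1
      exact (mul_one _).symm.trans (congrArg _ (cls_one ..).symm)
    · intro a e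
      have := hmid a (sg e) 1
      rwa [map_one, mul_one, h.zero_left, mul_one, mu_sg, genPow_sg, cls_gen] at this
  · rintro ⟨i, hi⟩ ⟨j, hj⟩ hij
    obtain rfl : i + 1 = j := hij
    refine Units.ext ?_
    change G i true * G (i + 1) true * G i true = G (i + 1) true * G i true * G (i + 1) true
    by_cases him : i = m
    · subst him
      rw [hlast, hG', hl.rel, straighten_braid α β (sg_ne_zero _) (sg_ne_zero _) (sg_ne_zero _)
        (Or.inl rfl)]
    · rw [hG _ _ (by omega), hG _ _ (by omega), ← map_mul, ← map_mul, ← map_mul, ← map_mul]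
      simp only [sK, ← toK_mul, sigmaPow_braid (show i + 2 < m + 2 by omega)]
  · rintro ⟨i, hi⟩ ⟨j, hj⟩ hij
    refine Units.ext ?_
    change G i true * G j true = G j true * G i true
    have hij' : i + 1 < j := hij
    by_cases hjm : j = m + 1
    · subst hjm
      rw [hG', hG _ _ (by omega), hl.comm]
      rw [← cls_gen]
      exact cls_mem_prevK (by simpa using hij')
    · rw [hG _ _ (by omega), hG _ _ (by omega), ← map_mul, ← map_mul, (sK_comm α β _ hij' _ _).eq]
  · intro h0
    change G 0 true * G 0 true = α • G 0 true - β • 1 + G 0 false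
    rw [hG _ _ (by omega), hG _ _ (by omega), ← map_mul, sK_sq α β (by omega)]
    simp
  · intro h0 h1
    change G 1 true * G 0 false * G 1 true =
      cubicRHS α β (G 0 true) (G 0 false) (G 1 true) (G 1 false)
    by_cases hm : m = 0
    · subst hm
      rw [hlast, hlast, hG', hG', hl.rel]
      exact (straighten_cubic α β (fun e => ρ (lastPow α β 0 e)) l
        (by rw [lastPow_zero, map_one]) hl.zero).1
    · simp only [hG _ _ (show 0 < m + 1 by omega), hG _ _ (show 1 < m + 1 by omega)]
      rw [← map_mul, ← map_mul, sK_funar α β (by omega), map_cubicRHS]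

end Extend

end

end Funar

namespace Funar

noncomputable section

/-! ### The shape of elementary reductions with respect to the last generator -/

section Shape

variable {R : Type*} [CommRing R] {α β : R}

/-- The expansion of `x_{i+1}^e x_i^d x_{i+1}^f` as an element of the free algebra. -/
def straightFA (α β : R) (i : ℕ) (e d f : SignType) : FA R :=
  straighten α β e d f fun a h b => w R (genPow i a * genPow (i + 1) h * genPow i b)

theorem TripleRepl.eq_straightFA {i : ℕ} {e d f : Bool} {V : FA R} (h : TripleRepl α β i e d f V) :
    V = straightFA α β i (sg e) (sg d) (sg f) := by
  have hw : straightFA α β i = fun e d f => straighten α β e d f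
      fun a h b => w R (genPow i a) * w R (genPow (i + 1) h) * w R (genPow i b) := by
    funext e d f
    simp only [straightFA, w_mul]
  cases h with
  | braid e₁ e₂ e₃ h =>
    rw [straightFA, straighten_braid α β (sg_ne_zero _) (sg_ne_zero _) (sg_ne_zero _)]
    · simp only [genPow_sg]
    · exact h.imp (congrArg sg) (congrArg sg)
  | pos =>
    rw [hw]
    exact (straighten_cubic α β (fun a => w R (genPow i a)) (fun a => w R (genPow (i + 1) a))
      w_one w_one).1.symm
  | neg =>
    rw [hw]
    exact (straighten_cubic α β (fun a => w R (genPow i a)) (fun a => w R (genPow (i + 1) a))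
      w_one w_one).2.symm

theorem straightFA_zero_mid (i : ℕ) :
    straightFA α β i 1 0 1 = α • w R (gen (i + 1) true) - β • (1 : FA R) + w R (gen (i + 1) false) ∧
    straightFA α β i (-1) 0 (-1) =
      β • w R (gen (i + 1) false) - α • (1 : FA R) + w R (gen (i + 1) true) ∧
    straightFA α β i 1 0 (-1) = 1 ∧ straightFA α β i (-1) 0 1 = 1 := by
  have h1 : genPow i 0 * genPow (i + 1) 1 * genPow i 0 = gen (i + 1) true := mul_one _
  have h2 : genPow i 0 * genPow (i + 1) (-1) * genPow i 0 = gen (i + 1) false := mul_one _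
  have h3 : w R (genPow i 0 * genPow (i + 1) 0 * genPow i 0) = 1 := w_one
  refine ⟨?_, ?_, ?_, ?_⟩
  · change Finsupp.linearCombination R _ (α • Finsupp.single (0, 1, 0) 1
      - β • Finsupp.single (0, 0, 0) 1 + Finsupp.single (0, -1, 0) 1) = _
    simp only [map_add, map_sub, map_smul, Finsupp.linearCombination_single, one_smul, h1, h2, h3]
  · change Finsupp.linearCombination R _ (β • Finsupp.single (0, -1, 0) 1
      - α • Finsupp.single (0, 0, 0) 1 + Finsupp.single (0, 1, 0) 1) = _
    simp only [map_add, map_sub, map_smul, Finsupp.linearCombination_single, one_smul, h1, h2, h3]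
  · change Finsupp.linearCombination R _ (Finsupp.single (0, 0, 0) 1) = _
    simp only [Finsupp.linearCombination_single, one_smul, h3]
  · change Finsupp.linearCombination R _ (Finsupp.single (0, 0, 0) 1) = _
    simp only [Finsupp.linearCombination_single, one_smul, h3]

/-- A basic replacement does not involve the last generator, moves it across a distant letter, or
straightens two occurrences of it; the case `δ = 0` are squares and cancellations. -/
theorem BasicRepl.classify {m : ℕ} {U : Word} {V : FA R} (h : BasicRepl α β U V)
    (hU : InIdx (· < m + 2) U) : xc (m + 1) U = 0 ∨
      (∃ e i e', i < m ∧ U = gen (m + 1) e * gen i e' ∧ V = w R (gen i e' * gen (m + 1) e)) ∨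
      ∃ e δ W f, InIdx (· < m) W ∧ U = gen (m + 1) e * (genPow m δ * W) * gen (m + 1) f ∧
        V = straightFA α β m (sg e) δ (sg f) * w R W := by
  obtain ⟨z1, z2, z3, z4⟩ := straightFA_zero_mid (α := α) (β := β) m
  have hz : ∀ A B : Word, A * (genPow m 0 * 1) * B = A * B := fun A B => by
    change A * (1 * 1) * B = _
    simp
  cases h with
  | cancel i e =>
    simp only [inIdx_mul, inIdx_gen] at hU
    by_cases hi : i = m + 1
    · subst hi
      refine Or.inr (Or.inr ⟨e, 0, 1, !e, inIdx_one _, (hz _ _).symm, ?_⟩)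
      cases e
      · exact (z4.symm).trans (by rw [w_one, mul_one]; rfl)
      · exact (z3.symm).trans (by rw [w_one, mul_one]; rfl)
    · exact Or.inl (by simp [xc_gen, hi])
  | sq i =>
    by_cases hi : i = m + 1
    · subst hi
      exact Or.inr (Or.inr ⟨true, 0, 1, true, inIdx_one _, (hz _ _).symm, by
        rw [w_one, mul_one]; exact z1.symm⟩)
    · exact Or.inl (by simp [xc_gen, hi])
  | sqInv i =>
    by_cases hi : i = m + 1
    · subst hi
      exact Or.inr (Or.inr ⟨false, 0, 1, false, inIdx_one _, (hz _ _).symm, by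
        rw [w_one, mul_one]; exact z2.symm⟩)
    · exact Or.inl (by simp [xc_gen, hi])
  | triple i e₁ e₂ e₃ V h =>
    simp only [inIdx_mul, inIdx_gen] at hU
    by_cases hi : i = m
    · subst hi
      exact Or.inr (Or.inr ⟨e₁, sg e₂, 1, e₃, inIdx_one _, by rw [genPow_sg, mul_one], by
        rw [w_one, mul_one]; exact h.eq_straightFA⟩)
    · exact Or.inl (by simp [xc_gen]; omega)
  | tripleFar i e₁ e₂ e₃ V h W hW =>
    simp only [inIdx_mul, inIdx_gen] at hU
    by_cases hi : i = m
    · subst hi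
      exact Or.inr (Or.inr ⟨e₁, sg e₂, W, e₃, hW, by rw [genPow_sg, mul_assoc (gen (i + 1) e₁)], by
        rw [h.eq_straightFA]⟩)
    · refine Or.inl ?_
      have : xc (m + 1) W = 0 := xc_eq_zero_of (S := (· < i)) hW fun j hj => by omega
      simp [xc_gen, this]
      omega
  | comm i j h e₁ e₂ =>
    simp only [inIdx_mul, inIdx_gen] at hU
    by_cases hj : j = m + 1
    · subst hj
      exact Or.inr (Or.inl ⟨e₁, i, e₂, by omega, rfl, rfl⟩)
    · exact Or.inl (by simp [xc_gen]; omega)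

theorem xc_straight_term (m : ℕ) (a h b : SignType) :
    xc (m + 1) (genPow m a * genPow (m + 1) h * genPow m b) ≤ 1 := by
  rw [xc_mul, xc_mul, xc_genPow_ne (show m ≠ m + 1 by omega) a,
    xc_genPow_ne (show m ≠ m + 1 by omega) b]
  cases h <;> simp [genPow]

theorem straighten_mem {X : Type*} [AddCommGroup X] [Module R X] {S : Submodule R X}
    {e d f : SignType} {F : SignType → SignType → SignType → X} (h : ∀ a h b, F a h b ∈ S) :
    straighten α β e d f F ∈ S := by
  rw [straighten, Finsupp.linearCombination_apply]
  exact Submodule.sum_mem _ fun t _ => Submodule.smul_mem _ _ (h _ _ _)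

/-- Elementary reductions do not raise the number of occurrences of the last generator. -/
theorem WordStep.xc_le {m : ℕ} {W : Word} {Z : FA R} (h : WordStep α β W Z)
    (hW : InIdx (· < m + 2) W) : Z ∈ Sp R fun W' => xc (m + 1) W' ≤ xc (m + 1) W := by
  obtain ⟨A, U, B, V, hUV, rfl, rfl⟩ := h
  simp only [inIdx_mul] at hW
  have key : V ∈ Sp R fun V' => xc (m + 1) V' ≤ xc (m + 1) U := by
    rcases hUV.classify hW.1.2 with h0 | ⟨e, i, e', hi, rfl, rfl⟩ | ⟨e, δ, W, f, hW', rfl, rfl⟩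
    · exact Sp_mono (fun W' hW' => (xc_eq_zero_of hW' fun i hi => hi.ne).trans_le (Nat.zero_le _))
        (hUV.mem (inIdx_lt_of_xc hW.1.2 h0))
    · exact w_mem_Sp (by simp [add_comm])
    · refine Sp_mul (p := fun V' => xc (m + 1) V' ≤ 1) (q := fun V' => xc (m + 1) V' = 0)
        (fun A B hA hB => ?_) (straighten_mem fun a h b => w_mem_Sp (xc_straight_term m a h b))
        (w_mem_Sp (xc_eq_zero_of hW' fun i hi => by omega))
      simp only [xc_mul, xc_gen_self, hB]
      omega
  refine Sp_mul (p := fun A' => xc (m + 1) A' ≤ xc (m + 1) (A * U)) (q := fun B' => B' = B)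
    (fun A' B' hA' hB' => ?_) (Sp_mul (p := fun A' => A' = A)
      (q := fun V' => xc (m + 1) V' ≤ xc (m + 1) U) (fun A' V' hA' hV' => ?_) (w_mem_Sp rfl) key)
      (w_mem_Sp rfl)
  · subst hB'
    simp only [xc_mul] at hA' ⊢
    omega
  · subst hA'
    simp only [xc_mul] at hV' ⊢
    omega

theorem split_unique {N : ℕ} {A A' B B' : Word} {e e' : Bool}
    (h : A * gen N e * B = A' * gen N e' * B') (hA : xc N A = 0) (hA' : xc N A' = 0) :
    A = A' ∧ e = e' ∧ B = B' := by
  induction A using word_induction generalizing A' with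
  | h1 =>
    rcases word_cases A' with rfl | ⟨i, b, A', rfl⟩
    · have h1 : FreeMonoid.toList (1 * gen N e * B) = FreeMonoid.toList (1 * gen N e' * B') := by rw [h]
      simp [gen] at h1
      exact ⟨rfl, h1.1, h1.2⟩
    · have h1 : FreeMonoid.toList (1 * gen N e * B) =
        FreeMonoid.toList (gen i b * A' * gen N e' * B') := by rw [h]
      simp [gen] at h1
      simp [h1.1.1] at hA'
  | h j c A ih =>
    rcases word_cases A' with rfl | ⟨i, b, A', rfl⟩
    · have h1 : FreeMonoid.toList (gen j c * A * gen N e * B) =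
        FreeMonoid.toList (1 * gen N e' * B') := by rw [h]
      simp [gen] at h1
      simp [h1.1.1] at hA
    · have h1 : FreeMonoid.toList (gen j c * A * gen N e * B) =
        FreeMonoid.toList (gen i b * A' * gen N e' * B') := by rw [h]
      simp [gen] at h1
      obtain ⟨⟨rfl, rfl⟩, h2⟩ := h1
      rw [xc_mul] at hA hA'
      have h3 : A * gen N e * B = A' * gen N e' * B' := by
        apply FreeMonoid.toList.injective
        simpa [gen] using h2
      obtain ⟨rfl, rfl, rfl⟩ := ih h3 (by omega) (by omega)
      exact ⟨rfl, rfl, rfl⟩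

theorem genPow_mul_unique {m : ℕ} {δ δ' : SignType} {W W' : Word} (hW : InIdx (· < m) W)
    (hW' : InIdx (· < m) W') (h : genPow m δ * W = genPow m δ' * W') : δ = δ' ∧ W = W' := by
  have x0 : ∀ {W}, InIdx (· < m) W → xc m W = 0 := fun h => xc_eq_zero_of h fun i hi => hi.ne
  have hx : ∀ e, xc m (gen m e * W) = 1 := fun e => by simp [x0 hW]
  have hx' : ∀ e, xc m (gen m e * W') = 1 := fun e => by simp [x0 hW']
  by_cases h1 : δ = 0
  · by_cases h2 : δ' = 0
    · subst h1 h2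
      exact ⟨rfl, h⟩
    · obtain ⟨b, rfl⟩ := exists_sg h2
      subst h1
      have : xc m W = 1 := by rw [← hx' b, ← genPow_sg, ← h]; rfl
      rw [x0 hW] at this
      exact absurd this (by omega)
  · obtain ⟨a, rfl⟩ := exists_sg h1
    by_cases h2 : δ' = 0
    · subst h2
      have : xc m W' = 1 := by rw [← hx a, ← genPow_sg, h]; rfl
      rw [x0 hW'] at this
      exact absurd this (by omega)
    · obtain ⟨b, rfl⟩ := exists_sg h2
      rw [genPow_sg, genPow_sg] at h
      obtain ⟨-, rfl, rfl⟩ := split_unique (N := m) (A := 1) (A' := 1) (by simpa using h) rfl rfl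
      exact ⟨rfl, rfl⟩

/-- In words of this shape exactly one elementary reduction is possible. -/
theorem WordStep.eq_of_two {m : ℕ} {e f : Bool} {δ : SignType} {W C : Word} {Z : FA R}
    (h : WordStep α β (gen (m + 1) e * (genPow m δ * W) * gen (m + 1) f * C) Z)
    (hW : InIdx (· < m) W) (hδ : δ = 0 → W = 1) (hD : WordReduced α β (genPow m δ * W))
    (hC : InIdx (· = m) C) (hC' : WordReduced α β C) :
    Z = straightFA α β m (sg e) δ (sg f) * w R W * w R C := by
  obtain ⟨A, U, B, V, hUV, h, rfl⟩ := h
  have hxW : xc (m + 1) (genPow m δ * W) = 0 := by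
    rw [xc_mul, xc_genPow_ne (by omega), xc_eq_zero_of hW fun i hi => by omega]
  have hxC : xc (m + 1) C = 0 := xc_eq_zero_of hC fun i hi => by omega
  have hx := congrArg (xc (m + 1)) h
  simp only [xc_mul (m + 1) _ C, xc_mul (m + 1) _ (gen _ f), xc_mul (m + 1) (gen _ e), hxW, hxC,
    xc_gen_self, xc_mul (m + 1) _ B, xc_mul (m + 1) A] at hx
  have hU : InIdx (· < m + 2) U := by
    have : InIdx (· < m + 2) (A * U * B) := by
      rw [← h]
      simp only [inIdx_mul, inIdx_gen]
      exact ⟨⟨⟨by omega, inIdx_genPow (by omega), hW.mono fun i hi => by omega⟩, by omega⟩,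
        hC.mono fun i hi => by omega⟩
    simp only [inIdx_mul] at this
    exact this.1.2
  have h' : 1 * gen (m + 1) e * (genPow m δ * W * gen (m + 1) f * C) = A * U * B := by
    rw [← h]
    simp only [mul_assoc, one_mul]
  have two := hUV.two_le
  rcases hUV.classify hU with h0 | ⟨a, i, b, hi, rfl, rfl⟩ | ⟨a, δ', W', b, hW', rfl, rfl⟩
  · exfalso
    rcases Nat.eq_zero_or_pos (xc (m + 1) A) with hA | hA
    · obtain ⟨B1, b1, B2, rfl, hB1, hB⟩ := exists_split (N := m + 1) (W := B) (by omega)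
      have := (split_unique (h'.trans (show A * U * (B1 * gen (m + 1) b1 * B2) =
        (A * U * B1) * gen (m + 1) b1 * B2 by simp only [mul_assoc])) rfl
          (by simp only [xc_mul]; omega)).1
      have := congrArg FreeMonoid.length this
      simp only [FreeMonoid.length_mul, FreeMonoid.length_one] at this
      omega
    · obtain ⟨A1, a1, A2, rfl, hA1, hA⟩ := exists_split hA
      obtain ⟨-, -, h2⟩ := split_unique (h'.trans (show A1 * gen (m + 1) a1 * A2 * U * B =
        A1 * gen (m + 1) a1 * (A2 * U * B) by simp only [mul_assoc])) rfl hA1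
      rcases Nat.eq_zero_or_pos (xc (m + 1) A2) with hA2 | hA2
      · obtain ⟨B1, b1, B2, rfl, hB1, hB⟩ := exists_split (N := m + 1) (W := B) (by omega)
        have h3 := (split_unique (h2.trans (show A2 * U * (B1 * gen (m + 1) b1 * B2) =
          (A2 * U * B1) * gen (m + 1) b1 * B2 by simp only [mul_assoc])) hxW
            (by simp only [xc_mul]; omega)).1
        rw [h3] at hD
        exact wordReduced_not_basic hD hUV
      · obtain ⟨A3, a3, A4, rfl, hA3, hA4⟩ := exists_split hA2
        have h3 := (split_unique (h2.trans (show A3 * gen (m + 1) a3 * A4 * U * B =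
          A3 * gen (m + 1) a3 * (A4 * U * B) by simp only [mul_assoc])) hxW hA3).2.2
        rw [h3] at hC'
        exact wordReduced_not_basic hC' hUV
  · exfalso
    have hxi : xc (m + 1) (gen i b) = 0 := by rw [xc_gen, if_neg (by omega)]
    rw [xc_mul, xc_gen_self, hxi] at hx
    rcases Nat.eq_zero_or_pos (xc (m + 1) A) with hA | hA
    · obtain ⟨-, -, h2⟩ := split_unique (h'.trans (show A * (gen (m + 1) a * gen i b) * B =
        A * gen (m + 1) a * (gen i b * B) by simp only [mul_assoc])) rfl hA
      have h3 := congrArg FreeMonoid.toList h2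
      by_cases h0 : δ = 0
      · obtain rfl := hδ h0
        subst h0
        have : genPow m 0 * 1 = 1 := rfl
        rw [this] at h3
        simp [gen] at h3
        omega
      · obtain ⟨d, rfl⟩ := exists_sg h0
        rw [genPow_sg] at h3
        simp [gen] at h3
        omega
    · obtain ⟨A1, a1, A2, rfl, hA1, hA⟩ := exists_split hA
      obtain ⟨-, -, h2⟩ := split_unique (h'.trans
        (show A1 * gen (m + 1) a1 * A2 * (gen (m + 1) a * gen i b) * B =
        A1 * gen (m + 1) a1 * (A2 * (gen (m + 1) a * gen i b) * B) by simp only [mul_assoc])) rfl hA1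
      have h3 := (split_unique (h2.trans (show A2 * (gen (m + 1) a * gen i b) * B =
        A2 * gen (m + 1) a * (gen i b * B) by simp only [mul_assoc])) hxW (by omega)).2.2
      rw [h3] at hC
      simp only [inIdx_mul, inIdx_gen] at hC
      omega
  · have hxW' : xc (m + 1) (genPow m δ' * W') = 0 := by
      rw [xc_mul, xc_genPow_ne (by omega), xc_eq_zero_of hW' fun i hi => by omega]
    rw [xc_mul, xc_mul, xc_gen_self, xc_gen_self, hxW'] at hx
    obtain ⟨rfl, rfl, h2⟩ := split_unique (h'.trans
      (show A * (gen (m + 1) a * (genPow m δ' * W') * gen (m + 1) b) * B =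
        A * gen (m + 1) a * (genPow m δ' * W' * gen (m + 1) b * B) by simp only [mul_assoc])) rfl
        (by omega)
    obtain ⟨h3, rfl, rfl⟩ := split_unique h2 hxW hxW'
    obtain ⟨rfl, rfl⟩ := genPow_mul_unique hW hW' h3
    rw [w_one, one_mul]

/-- If a word admits exactly one elementary reduction, then the value of an invariant functional on
its reduced form can be computed after this reduction. -/
theorem IsReductionMap.eq_of_unique_step {r : Word → FA R} (hr : IsReductionMap α β r) {W : Word}
    {V : FA R} (hex : ∃ Z, WordStep α β W Z) (huniq : ∀ Z, WordStep α β W Z → Z = V)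
    {p : Word → Prop} (hV : V ∈ Sp R p) {X : Type*} [AddCommGroup X] [Module R X] {f : FA R →ₗ[R] X}
    (hp : ∀ W Z, p W → WordStep α β W Z → Z ∈ Sp R p ∧ f Z = f (w R W)) :
    r W ∈ Sp R p ∧ f (r W) = f V := by
  rcases subsingleton_or_nontrivial R with hR | hR
  · have : Subsingleton (FA R) := Module.subsingleton R _
    rw [Subsingleton.elim (r W) V]
    exact ⟨hV, rfl⟩
  obtain ⟨h1, h2⟩ := hr W
  rcases Relation.ReflTransGen.cases_head h1 with h3 | ⟨Z, ⟨W', V', hc, hs, rfl⟩, h3⟩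
  · obtain ⟨Z, hZ⟩ := hex
    refine absurd ⟨_, W, Z, ?_, hZ, rfl⟩ h2
    rw [← h3, w_eq_single]
    simp
  · have : W' = W := by
      by_contra hne
      rw [w_eq_single] at hc
      simp [Ne.symm hne] at hc
    subst this
    have h4 : (w R W').coeff W' = 1 := by rw [w_eq_single]; simp
    rw [h4, one_smul, one_smul, sub_self, zero_add, huniq _ hs] at h3
    exact reduction_invariant hp hV h3

end Shape

end

end Funar

namespace Funar

noncomputable section

/-! ### Functionals on words with at most two occurrences of the last generator -/

section Functionals

variable {R : Type*} [CommRing R] {α β u v : R}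

/-- The words in the last generator `x` and elements of an algebra, with at most two occurrences of
`x`; all words with more occurrences are identified. -/
inductive XWord (A : Type*) : Type _
  | zero (a : A)
  | one (a : A) (e : Bool) (b : A)
  | two (a : A) (e : Bool) (b : A) (f : Bool) (c : A)
  | many

namespace XWord

variable {A : Type*} [Ring A] [Algebra R A]

/-- Multiplication from the left by an element of the algebra. -/
def lmul (k : A) : XWord A → XWord A
  | zero a => zero (k * a)
  | one a e b => one (k * a) e b
  | two a e b f c => two (k * a) e b f c
  | many => many

/-- Multiplication from the left by a power of `x`. -/
def lx (e : Bool) : XWord A → XWord A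
  | zero a => one 1 e a
  | one a f b => two 1 e a f b
  | two _ _ _ _ _ => many
  | many => many

theorem lmul_one (s : XWord A) : lmul 1 s = s := by cases s <;> simp [lmul]

theorem lmul_lmul (k k' : A) (s : XWord A) : lmul k (lmul k' s) = lmul (k * k') s := by
  cases s <;> simp [lmul, mul_assoc]

variable {X : Type*} [AddCommGroup X] [Module R X]

/-- The value of a functional given by `C` and `B`. -/
def val (C : SignType → A →ₗ[R] A →ₗ[R] X) (B : SignType → SignType → A →ₗ[R] A →ₗ[R] A →ₗ[R] X) :
    XWord A → X
  | zero a => C 0 1 a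
  | one a e b => C (sg e) b a
  | two a e b f c => B (sg e) (sg f) b c a
  | many => 0

/-- Families of words that depend linearly on one entry. -/
inductive LinFam (R : Type*) [CommRing R] {A : Type*} [Ring A] [Algebra R A] :
    (A → XWord A) → Prop
  | zero (g : A →ₗ[R] A) : LinFam R fun k => XWord.zero (g k)
  | one₁ (g : A →ₗ[R] A) (e : Bool) (b : A) : LinFam R fun k => XWord.one (g k) e b
  | one₂ (g : A →ₗ[R] A) (a : A) (e : Bool) : LinFam R fun k => XWord.one a e (g k)
  | two₁ (g : A →ₗ[R] A) (e : Bool) (b : A) (f : Bool) (c : A) :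
      LinFam R fun k => XWord.two (g k) e b f c
  | two₂ (g : A →ₗ[R] A) (a : A) (e : Bool) (f : Bool) (c : A) :
      LinFam R fun k => XWord.two a e (g k) f c
  | two₃ (g : A →ₗ[R] A) (a : A) (e : Bool) (b : A) (f : Bool) :
      LinFam R fun k => XWord.two a e b f (g k)
  | many : LinFam R fun _ => XWord.many

theorem LinFam.lmul {s : A → XWord A} (h : LinFam R s) (a : A) :
    LinFam R fun k => (s k).lmul a := by
  cases h with
  | zero g => exact LinFam.zero ((LinearMap.mulLeft R a).comp g)
  | one₁ g e b => exact LinFam.one₁ ((LinearMap.mulLeft R a).comp g) e b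
  | one₂ g a' e => exact LinFam.one₂ g (a * a') e
  | two₁ g e b f c => exact LinFam.two₁ ((LinearMap.mulLeft R a).comp g) e b f c
  | two₂ g a' e f c => exact LinFam.two₂ g (a * a') e f c
  | two₃ g a' e b f => exact LinFam.two₃ g (a * a') e b f
  | many => exact LinFam.many

theorem LinFam.lx {s : A → XWord A} (h : LinFam R s) (e : Bool) :
    LinFam R fun k => (s k).lx e := by
  cases h with
  | zero g => exact LinFam.one₂ g 1 e
  | one₁ g f b => exact LinFam.two₂ g 1 e f b
  | one₂ g a f => exact LinFam.two₃ g 1 e a f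
  | two₁ g _ b f c => exact LinFam.many
  | two₂ g a _ f c => exact LinFam.many
  | two₃ g a _ b f => exact LinFam.many
  | many => exact LinFam.many

theorem LinFam.exists_val {s : A → XWord A} (h : LinFam R s) (C : SignType → A →ₗ[R] A →ₗ[R] X)
    (B : SignType → SignType → A →ₗ[R] A →ₗ[R] A →ₗ[R] X) :
    ∃ F : A →ₗ[R] X, ∀ k, val C B (s k) = F k := by
  cases h with
  | zero g => exact ⟨C 0 1 ∘ₗ g, fun k => rfl⟩
  | one₁ g e b => exact ⟨C (sg e) b ∘ₗ g, fun k => rfl⟩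
  | one₂ g a e => exact ⟨(C (sg e)).flip a ∘ₗ g, fun k => rfl⟩
  | two₁ g e b f c => exact ⟨B (sg e) (sg f) b c ∘ₗ g, fun k => rfl⟩
  | two₂ g a e f c => exact ⟨((B (sg e) (sg f)).flip c).flip a ∘ₗ g, fun k => rfl⟩
  | two₃ g a e b f => exact ⟨(B (sg e) (sg f) b).flip a ∘ₗ g, fun k => rfl⟩
  | many => exact ⟨0, fun k => rfl⟩

/-- Words that differ by moving an element of `P` across an occurrence of `x`. -/
inductive Moved {A : Type*} [Ring A] (P : Set A) : XWord A → XWord A → Prop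
  | one (k : A) (hk : k ∈ P) (a : A) (e : Bool) (b : A) :
      Moved P (XWord.one (a * k) e b) (XWord.one a e (k * b))
  | two₁ (k : A) (hk : k ∈ P) (a : A) (e : Bool) (b : A) (f : Bool) (c : A) :
      Moved P (XWord.two (a * k) e b f c) (XWord.two a e (k * b) f c)
  | two₂ (k : A) (hk : k ∈ P) (a : A) (e : Bool) (b : A) (f : Bool) (c : A) :
      Moved P (XWord.two a e (b * k) f c) (XWord.two a e b f (k * c))
  | many : Moved P XWord.many XWord.many

theorem Moved.lmul {P : Set A} {s t : XWord A} (h : Moved P s t) (a : A) :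
    Moved P (s.lmul a) (t.lmul a) := by
  cases h with
  | one k hk a' e b =>
    have := Moved.one k hk (a * a') e b
    rwa [mul_assoc] at this
  | two₁ k hk a' e b f c =>
    have := Moved.two₁ k hk (a * a') e b f c
    rwa [mul_assoc] at this
  | two₂ k hk a' e b f c => exact Moved.two₂ k hk (a * a') e b f c
  | many => exact Moved.many

theorem Moved.lx {P : Set A} {s t : XWord A} (h : Moved P s t) (e : Bool) :
    Moved P (s.lx e) (t.lx e) := by
  cases h with
  | one k hk a f b => exact Moved.two₂ k hk 1 e a f b
  | two₁ k hk a _ b f c => exact Moved.many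
  | two₂ k hk a _ b f c => exact Moved.many
  | many => exact Moved.many

theorem moved_lx_lmul {P : Set A} {k : A} (hk : k ∈ P) (e : Bool) (s : XWord A) :
    Moved P ((s.lx e).lmul k) ((s.lmul k).lx e) := by
  cases s with
  | zero a =>
    have := Moved.one k hk 1 e a
    rw [one_mul] at this
    simpa [XWord.lx, XWord.lmul] using this
  | one a f b =>
    have := Moved.two₁ k hk 1 e a f b
    rw [one_mul] at this
    simpa [XWord.lx, XWord.lmul] using this
  | two a _ b f c => exact Moved.many
  | many => exact Moved.many

end XWord

/-- Multiplication of a word from the left by a word in the generators, where the letters with index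
`m + 1` stand for `x` and all other letters for elements of `K (m + 2)`. -/
def xpre (α β : R) (m : ℕ) (W : Word) (s : XWord (K α β (m + 2))) : XWord (K α β (m + 2)) :=
  W.toList.foldr (fun l s => if l.1 = m + 1 then s.lx l.2 else s.lmul (sK α β (m + 2) l.1 l.2)) s

@[simp] theorem xpre_one (m : ℕ) (s : XWord (K α β (m + 2))) : xpre α β m 1 s = s := rfl

theorem xpre_mul (m : ℕ) (W W' : Word) (s : XWord (K α β (m + 2))) :
    xpre α β m (W * W') s = xpre α β m W (xpre α β m W' s) := by
  simp [xpre]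

theorem xpre_gen (m i : ℕ) (e : Bool) (s : XWord (K α β (m + 2))) : xpre α β m (gen i e) s =
    if i = m + 1 then s.lx e else s.lmul (sK α β (m + 2) i e) := rfl

theorem xpre_free {m : ℕ} {W : Word} (h : xc (m + 1) W = 0) (s : XWord (K α β (m + 2))) :
    xpre α β m W s = s.lmul (cls α β (m + 2) (w R W)) := by
  induction W using word_induction with
  | h1 => rw [cls_one, XWord.lmul_one, xpre_one]
  | h i e W ih =>
    rw [xc_mul] at h
    have hi : i ≠ m + 1 := fun hi => by simp [hi] at h
    rw [xpre_mul, ih (by omega), xpre_gen, if_neg hi, XWord.lmul_lmul, cls_mul, cls_gen]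

theorem xpre_linFam {m : ℕ} (W : Word) {s : K α β (m + 2) → XWord (K α β (m + 2))}
    (h : XWord.LinFam R s) : XWord.LinFam R fun k => xpre α β m W (s k) := by
  induction W using word_induction with
  | h1 => exact h
  | h i e W ih =>
    simp only [xpre_mul, xpre_gen]
    split_ifs
    · exact ih.lx e
    · exact ih.lmul _

theorem xpre_moved {m : ℕ} (W : Word) {P : Set (K α β (m + 2))} {s t : XWord (K α β (m + 2))}
    (h : XWord.Moved P s t) : XWord.Moved P (xpre α β m W s) (xpre α β m W t) := by
  induction W using word_induction with
  | h1 => exact h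
  | h i e W ih =>
    simp only [xpre_mul, xpre_gen]
    split_ifs
    · exact ih.lx e
    · exact ih.lmul _

variable {X : Type*} [AddCommGroup X] [Module R X] {m : ℕ}
  {C : SignType → K α β (m + 2) →ₗ[R] K α β (m + 2) →ₗ[R] X}
  {B : SignType → SignType → K α β (m + 2) →ₗ[R] K α β (m + 2) →ₗ[R] K α β (m + 2) →ₗ[R] X}

variable (C B) in
/-- The functional on the free algebra given by `C` and `B`. -/
def phi : FA R →ₗ[R] X := wlin fun W => (xpre α β m W (XWord.zero 1)).val C B

theorem phi_w (W : Word) : phi C B (w R W) = (xpre α β m W (XWord.zero 1)).val C B := wlin_w _ _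

theorem phi_two_sg {D E F : Word} (hD : xc (m + 1) D = 0) (hE : xc (m + 1) E = 0)
    (hF : xc (m + 1) F = 0) (e f : Bool) :
    phi C B (w R (D * gen (m + 1) e * E * gen (m + 1) f * F)) =
      B (sg e) (sg f) (cls α β (m + 2) (w R E)) (cls α β (m + 2) (w R F))
        (cls α β (m + 2) (w R D)) := by
  rw [phi_w]
  simp only [xpre_mul, xpre_free hD, xpre_free hE, xpre_free hF, xpre_gen, if_true, XWord.lmul,
    XWord.lx, XWord.val, mul_one]

theorem phi_one (hc : ∀ d a, C 0 d a = C 0 1 (a * d)) {D E : Word} (hD : xc (m + 1) D = 0)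
    (hE : xc (m + 1) E = 0) (e : SignType) : phi C B (w R (D * genPow (m + 1) e * E)) =
      C e (cls α β (m + 2) (w R E)) (cls α β (m + 2) (w R D)) := by
  by_cases he : e = 0
  · subst he
    have : D * genPow (m + 1) 0 * E = D * E := congrArg (· * E) (mul_one D)
    rw [this, phi_w, xpre_free (by simp [hD, hE]), hc, ← cls_mul]
    simp [XWord.lmul, XWord.val]
  · obtain ⟨b, rfl⟩ := exists_sg he
    rw [genPow_sg, phi_w]
    simp only [xpre_mul, xpre_free hD, xpre_free hE, xpre_gen, if_true, XWord.lmul,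
      XWord.lx, XWord.val, mul_one]

theorem IsTwoEval.phi_two (h : IsTwoEval α β (lastPow α β m) (prevK α β m) C B) {D E F : Word}
    (hD : xc (m + 1) D = 0) (hE : xc (m + 1) E = 0) (hF : xc (m + 1) F = 0) (e f : SignType) :
    phi C B (w R (D * genPow (m + 1) e * E * genPow (m + 1) f * F)) =
      B e f (cls α β (m + 2) (w R E)) (cls α β (m + 2) (w R F)) (cls α β (m + 2) (w R D)) := by
  have h1 : ∀ W : Word, W * genPow (m + 1) 0 = W := mul_one
  by_cases he : e = 0
  · subst he
    rw [h1, phi_one h.c_zero (by simp [hD, hE]) hF, h.zero_left, cls_mul]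
  by_cases hf : f = 0
  · subst hf
    rw [h1, mul_assoc, phi_one h.c_zero hD (by simp [hE, hF]), h.zero_right, cls_mul]
  obtain ⟨e, rfl⟩ := exists_sg he
  obtain ⟨f, rfl⟩ := exists_sg hf
  rw [genPow_sg, genPow_sg, phi_two_sg hD hE hF]

/-- The functional `phi` is invariant under elementary reductions. -/
theorem phi_wordStep (hc : ∀ e, ∀ k ∈ prevK α β m, ∀ d a, C e (k * d) a = C e d (a * k))
    (hl : ∀ e f, ∀ k ∈ prevK α β m, ∀ b d a, B e f (k * b) d a = B e f b d (a * k))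
    (hr : ∀ e f, ∀ k ∈ prevK α β m, ∀ b d a, B e f (b * k) d a = B e f b (k * d) a)
    {W : Word} (hW : InIdx (· < m + 2) W)
    (h2 : xc (m + 1) W ≤ 1 ∨
      xc (m + 1) W ≤ 2 ∧ IsTwoEval α β (lastPow α β m) (prevK α β m) C B)
    {Z : FA R} (h : WordStep α β W Z) : phi C B Z = phi C B (w R W) := by
  obtain ⟨D, U, E, V, hUV, rfl, rfl⟩ := h
  simp only [inIdx_mul] at hW
  rcases hUV.classify hW.1.2 with h0 | ⟨e, i, e', hi, rfl, rfl⟩ | ⟨e, δ, W, f, hW', rfl, rfl⟩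
  · have hfam : XWord.LinFam R fun k => (xpre α β m E (XWord.zero 1)).lmul k := by
      cases xpre α β m E (XWord.zero 1) with
      | zero a => exact XWord.LinFam.zero (LinearMap.mulRight R a)
      | one a e b => exact XWord.LinFam.one₁ (LinearMap.mulRight R a) e b
      | two a e b f c => exact XWord.LinFam.two₁ (LinearMap.mulRight R a) e b f c
      | many => exact XWord.LinFam.many
    obtain ⟨F, hF⟩ := (xpre_linFam D hfam).exists_val C B
    have key : ∀ {Z : FA R}, Z ∈ Sp R (InIdx (· < m + 1)) →
        phi C B (w R D * Z * w R E) = F (cls α β (m + 2) Z) := by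
      intro Z hZ
      refine Sp_eqOn (f := (phi C B).comp ((LinearMap.mulRight R (w R E)).comp
        (LinearMap.mulLeft R (w R D)))) (g := F.comp (cls α β (m + 2)).toLinearMap)
        (fun W hW => ?_) hZ
      simp only [LinearMap.comp_apply, LinearMap.mulRight_apply, LinearMap.mulLeft_apply, ← w_mul,
        phi_w, AlgHom.toLinearMap_apply]
      rw [xpre_mul, xpre_mul, xpre_free (xc_eq_zero_of hW fun i hi => hi.ne), hF]
    have hU := inIdx_lt_of_xc hW.1.2 h0
    rw [w_mul, w_mul, key (hUV.mem hU), key (w_mem_Sp hU),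
      cls_basic hUV (hU.mono fun i hi => by omega)]
  · rw [← w_mul, ← w_mul, phi_w, phi_w]
    have hk : cls α β (m + 2) (w R (gen i e')) ∈ (prevK α β m : Set (K α β (m + 2))) :=
      cls_mem_prevK (by simpa using hi)
    have h3 := xpre_moved D (XWord.moved_lx_lmul hk e (xpre α β m E (XWord.zero 1)))
    have e1 : xpre α β m (D * (gen i e' * gen (m + 1) e) * E) (XWord.zero 1) =
        xpre α β m D (((xpre α β m E (XWord.zero 1)).lx e).lmul
          (cls α β (m + 2) (w R (gen i e')))) := by
      simp only [xpre_mul, xpre_gen, if_true, if_neg (show i ≠ m + 1 by omega), cls_gen]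
    have e2 : xpre α β m (D * (gen (m + 1) e * gen i e') * E) (XWord.zero 1) =
        xpre α β m D (((xpre α β m E (XWord.zero 1)).lmul
          (cls α β (m + 2) (w R (gen i e')))).lx e) := by
      simp only [xpre_mul, xpre_gen, if_true, if_neg (show i ≠ m + 1 by omega), cls_gen]
    rw [e1, e2]
    generalize xpre α β m D _ = s at h3 ⊢
    generalize xpre α β m D _ = t at h3 ⊢
    cases h3 with
    | one k hk a e b => exact (hc _ k hk b a).symm
    | two₁ k hk a e b f c => exact (hl _ _ k hk b c a).symm
    | two₂ k hk a e b f c => exact hr _ _ k hk b c a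
    | many => rfl
  · have hxW : xc (m + 1) W = 0 := xc_eq_zero_of hW' fun i hi => by omega
    have hxy : ∀ δ, xc (m + 1) (genPow m δ) = 0 := xc_genPow_ne (by omega)
    simp only [xc_mul, xc_gen_self, hxW, hxy] at h2
    obtain ⟨hx, h⟩ := h2.resolve_left (by omega)
    have hD : xc (m + 1) D = 0 := by omega
    have hE : xc (m + 1) E = 0 := by omega
    have e1 : w R D * (straightFA α β m (sg e) δ (sg f) * w R W) * w R E =
        straighten α β (sg e) δ (sg f) fun a j b =>
          w R ((D * genPow m a) * genPow (m + 1) j * (genPow m b * W * E)) := by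
      have := straighten_map α β ((LinearMap.mulRight R (w R E)).comp
        ((LinearMap.mulLeft R (w R D)).comp (LinearMap.mulRight R (w R W)))) (sg e) δ (sg f)
        fun a j b => w R (genPow m a * genPow (m + 1) j * genPow m b)
      simp only [LinearMap.comp_apply, LinearMap.mulRight_apply, LinearMap.mulLeft_apply,
        ← w_mul] at this
      refine this.trans (straighten_congr α β fun a j b => ?_)
      simp only [mul_assoc]
    have e2 : D * (gen (m + 1) e * (genPow m δ * W) * gen (m + 1) f) * E =
        D * gen (m + 1) e * (genPow m δ * W) * gen (m + 1) f * E := by simp only [mul_assoc]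
    rw [e1, straighten_map, e2, phi_two_sg hD (by simp [hxy, hxW]) hE, cls_mul,
      h.b_right _ _ _ (cls_mem_prevK hW'), show cls α β (m + 2) (w R (genPow m δ)) =
        lastPow α β m δ from rfl, h.mid]
    refine straighten_congr α β fun a j b => ?_
    rw [phi_one h.c_zero (by simp [hD, hxy]) (by simp [hE, hxW, hxy])]
    simp only [cls_mul, lastPow, mul_assoc]

end Functionals

end

end Funar

namespace Funar

noncomputable section

/-! ### Functionals on reindexed words -/

section Reindexed

variable {R : Type*} [CommRing R] {α β u v : R} {X : Type*} [AddCommGroup X] [Module R X]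

/-- The indices `i < N + 2` which `reidx m N` sends to indices `i + m - N`. -/
def Rng (m N i : ℕ) : Prop := N ≤ i + m ∧ i < N + 2

theorem xc_reidx {m N : ℕ} {W : Word} (h : InIdx (Rng m N) W) :
    xc (m + 1) (reidx m N W) = xc (N + 1) W := by
  induction W using word_induction with
  | h1 => rfl
  | h i e W ih =>
    simp only [inIdx_mul, inIdx_gen] at h
    obtain ⟨⟨h1, h2⟩, h3⟩ := h
    rw [map_mul, reidx_gen, xc_mul, xc_mul, ih h3, xc_gen, xc_gen]
    congr 1
    by_cases hi : i = N + 1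
    · rw [if_pos hi, if_pos (by omega)]
    · rw [if_neg hi, if_neg (by omega)]

variable {m : ℕ} {C : SignType → K α β (m + 2) →ₗ[R] K α β (m + 2) →ₗ[R] X}
  {B : SignType → SignType → K α β (m + 2) →ₗ[R] K α β (m + 2) →ₗ[R] K α β (m + 2) →ₗ[R] X}

theorem phi_reidx_invariant
    (hc : ∀ e, ∀ k ∈ prevK α β m, ∀ d a, C e (k * d) a = C e d (a * k))
    (hl : ∀ e f, ∀ k ∈ prevK α β m, ∀ b d a, B e f (k * b) d a = B e f b d (a * k))
    (hr : ∀ e f, ∀ k ∈ prevK α β m, ∀ b d a, B e f (b * k) d a = B e f b (k * d) a)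
    {d : ℕ} (hd : d ≤ 1 ∨ d ≤ 2 ∧ IsTwoEval α β (lastPow α β m) (prevK α β m) C B) (N : ℕ)
    (W : Word) (Z : FA R) (hW : InIdx (Rng m N) W ∧ xc (N + 1) W ≤ d) (h : WordStep α β W Z) :
    Z ∈ Sp R (fun W => InIdx (Rng m N) W ∧ xc (N + 1) W ≤ d) ∧
      phi C B (reidxA R m N Z) = phi C B (reidxA R m N (w R W)) := by
  refine ⟨Sp_inf (h.mem hW.1) (Sp_mono (fun W' hW' => hW'.trans hW.2)
    (h.xc_le (hW.1.mono fun i hi => hi.2))), ?_⟩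
  rw [reidxA_w]
  have hx := xc_reidx hW.1
  refine phi_wordStep hc hl hr (inIdx_reidx.mpr (hW.1.mono fun i hi => ?_)) ?_
    (h.reidx (hW.1.mono fun i hi => hi.1))
  · obtain ⟨h1, h2⟩ := hi
    omega
  · rw [hx]
    exact hd.imp hW.2.trans fun h => ⟨hW.2.trans h.1, h.2⟩

/-- The conditional expectation of words in which the last generator occurs once. -/
def expC (u v : R) (m : ℕ) (h : SignType) :
    K α β (m + 2) →ₗ[R] K α β (m + 2) →ₗ[R] K α β (m + 2) :=
  mu u v h • (LinearMap.mul R (K α β (m + 2))).flip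

theorem expC_apply (h : SignType) (d a : K α β (m + 2)) :
    expC u v m h d a = mu u v h • (a * d) := rfl

theorem reidx_split {N : ℕ} {D E : Word} {e : SignType}
    (hW : InIdx (Rng m N) (D * genPow (N + 1) e * E)) (hD : xc (N + 1) D = 0)
    (hE : xc (N + 1) E = 0) : reidx m N (D * genPow (N + 1) e * E) =
      reidx m N D * genPow (m + 1) e * reidx m N E ∧ xc (m + 1) (reidx m N D) = 0 ∧
      xc (m + 1) (reidx m N E) = 0 := by
  simp only [inIdx_mul] at hW
  refine ⟨?_, by rw [xc_reidx hW.1.1, hD], by rw [xc_reidx hW.2, hE]⟩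
  rw [map_mul, map_mul, reidx_genPow, show N + 1 + m - N = m + 1 by omega]

theorem expC_zero (d a : K α β (m + 2)) :
    expC u v m 0 d a = expC u v m (0 : SignType) 1 (a * d) := by
  simp [expC_apply]

/-- Closing the last strand is compatible with `tauWord`. -/
theorem phi_expC {r : Word → FA R} (hr : IsReductionMap α β r) {N : ℕ} {Y : FA R}
    (hY : Y ∈ Sp R fun W => InIdx (Rng m N) W ∧ xc (N + 1) W ≤ 1) :
    phi (expC u v m) 0 (reidxA R m N Y) =
      cls α β (m + 2) (reidxA R m N (lin (tauWord r u v (N + 3)) Y)) := by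
  refine Sp_eqOn (f := (phi (expC u v m) 0).comp (reidxA R m N).toLinearMap)
    (g := (cls α β (m + 2)).toLinearMap.comp ((reidxA R m N).toLinearMap.comp
      (lin (tauWord r u v (N + 3))))) (fun W hW => ?_) hY
  simp only [LinearMap.comp_apply, AlgHom.toLinearMap_apply, lin_w, reidxA_w]
  obtain ⟨D, e, E, rfl, hD, hE⟩ := exists_genPow_split hW.2
  obtain ⟨h1, h2, h3⟩ := reidx_split hW.1 hD hE
  rw [h1, phi_one (fun d a => expC_zero d a) h2 h3, expC_apply]
  by_cases he : e = 0
  · subst he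
    have h0 : D * genPow (N + 1) 0 * E = D * E := congrArg (· * E) (mul_one D)
    rw [h0, tauWord_free r u v (by simp [hD, hE]), reidxA_w, map_mul, cls_mul,
      show mu u v 0 = 1 from rfl, one_smul]
  · obtain ⟨b, rfl⟩ := exists_sg he
    have hDE : InIdx (Fits m N (m + 2)) (D * E) := by
      have h4 := hW.1
      simp only [inIdx_mul] at h4 ⊢
      refine ⟨fun l hl => ?_, fun l hl => ?_⟩
      · have h5 := h4.1.1 l hl
        have h6 := xc_eq_zero.mp hD l hl
        simp only [Rng, Fits] at *
        omega
      · have h5 := h4.2 l hl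
        have h6 := xc_eq_zero.mp hE l hl
        simp only [Rng, Fits] at *
        omega
    rw [genPow_sg, tauWord_mid r u v hD, map_smul, map_smul, hr.cls_reidx hDE, map_mul, cls_mul,
      mu_sg]

/-- Closing the last strand computes the functionals given by `closeC` and `closeB`. -/
theorem IsTwoTrace.phi_eq_tauN {r : Word → FA R} (hr : IsReductionMap α β r)
    {T : K α β (m + 2) →ₗ[R] X} {Θ : SignType → SignType → K α β (m + 2) →ₗ[R] K α β (m + 2) →ₗ[R] X}
    (h : IsTwoTrace α β u v (lastPow α β m) (prevK α β m) T Θ) (hT : ∀ a b, T (a * b) = T (b * a))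
    (D : K α β (m + 2)) {N : ℕ} {Y : FA R}
    (hY : Y ∈ Sp R fun W => InIdx (Rng m N) W ∧ xc (N + 1) W ≤ 2) :
    phi (closeC u v T D) (closeB Θ D) (reidxA R m N Y) =
      T (D * cls α β (m + 2) (reidxA R m N (tauN r u v (N + 3) Y))) := by
  have h2 := h.isTwoEval hT D
  have key : ∀ {Y : FA R}, Y ∈ Sp R (fun W => InIdx (Rng m N) W ∧ xc (N + 1) W ≤ 1) →
      phi (closeC u v T D) (closeB Θ D) (reidxA R m N Y) =
        T (D * phi (expC u v m) 0 (reidxA R m N Y)) := by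
    intro Y hY
    refine Sp_eqOn (f := (phi (closeC u v T D) (closeB Θ D)).comp (reidxA R m N).toLinearMap)
      (g := T.comp ((LinearMap.mulLeft R D).comp ((phi (expC u v m) 0).comp
        (reidxA R m N).toLinearMap))) (fun W hW => ?_) hY
    simp only [LinearMap.comp_apply, AlgHom.toLinearMap_apply, reidxA_w, LinearMap.mulLeft_apply]
    obtain ⟨A, e, E, rfl, hA, hE⟩ := exists_genPow_split hW.2
    obtain ⟨h1, h3, h4⟩ := reidx_split hW.1 hA hE
    rw [h1, phi_one h2.c_zero h3 h4, phi_one (fun d a => expC_zero d a) h3 h4, expC_apply,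
      closeC_apply, mul_smul_comm, map_smul, mul_assoc, hT, mul_assoc]
  refine Sp_eqOn (f := (phi (closeC u v T D) (closeB Θ D)).comp (reidxA R m N).toLinearMap)
    (g := T.comp ((LinearMap.mulLeft R D).comp ((cls α β (m + 2)).toLinearMap.comp
      ((reidxA R m N).toLinearMap.comp (tauN r u v (N + 3)))))) (fun W hW => ?_) hY
  simp only [LinearMap.comp_apply, AlgHom.toLinearMap_apply, LinearMap.mulLeft_apply]
  have h3 := (hr.invariant (f := (phi (closeC u v T D) (closeB Θ D)).comp
    (reidxA R m N).toLinearMap) (phi_reidx_invariant h2.c_mul h2.b_left h2.b_right (d := 2)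
      (Or.inr ⟨le_rfl, h2⟩) N) hW).2
  have h4 : r W ∈ Sp R fun W => InIdx (Rng m N) W ∧ xc (N + 1) W ≤ 1 :=
    Sp_inf (hr.mem hW.1) (hr.top (hW.1.mono fun i hi => hi.2))
  simp only [LinearMap.comp_apply, AlgHom.toLinearMap_apply] at h3
  rw [← h3, key h4, phi_expC hr h4, tauN_w]

theorem reidxA_straightFA (m N : ℕ) (e d f : SignType) :
    reidxA R m N (straightFA α β N e d f) = straightFA α β m e d f := by
  have := straighten_map α β (reidxA R m N).toLinearMap e d f
    fun a h b => w R (genPow N a * genPow (N + 1) h * genPow N b)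
  refine this.trans (straighten_congr α β fun a h b => ?_)
  simp only [AlgHom.toLinearMap_apply, reidxA_w, map_mul, reidx_genPow]
  rw [show N + m - N = m by omega, show N + 1 + m - N = m + 1 by omega]

theorem straightFA_mem (m N : ℕ) (e d f : SignType) :
    straightFA α β N e d f ∈ Sp R fun W => InIdx (Rng m N) W ∧ xc (N + 1) W ≤ 1 := by
  refine straighten_mem fun a h b => w_mem_Sp ⟨?_, xc_straight_term N a h b⟩
  simp only [inIdx_mul]
  exact ⟨⟨inIdx_genPow ⟨by omega, by omega⟩, inIdx_genPow ⟨by omega, by omega⟩⟩,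
    inIdx_genPow ⟨by omega, by omega⟩⟩

theorem genPow_length_le (i : ℕ) (e : SignType) : (genPow i e).length ≤ 1 := by
  cases e <;> simp [genPow, gen]

theorem wordStep_two {N : ℕ} (e f : Bool) (δ : SignType) {W : Word} (hW : InIdx (· < N) W)
    (hδ : δ = 0 → W = 1) (C : Word) :
    ∃ Z, WordStep α β (gen (N + 1) e * (genPow N δ * W) * gen (N + 1) f * C) Z := by
  by_cases h0 : δ = 0
  · obtain rfl := hδ h0
    subst h0
    have : ∀ V, BasicRepl α β (gen (N + 1) e * gen (N + 1) f) V →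
        ∃ Z, WordStep α β (gen (N + 1) e * (genPow N 0 * 1) * gen (N + 1) f * C) Z := fun V hV =>
      ⟨_, 1, _, C, V, hV, rfl, rfl⟩
    cases e <;> cases f
    · exact this _ (BasicRepl.sqInv _)
    · exact this _ (BasicRepl.cancel _ false)
    · exact this _ (BasicRepl.cancel _ true)
    · exact this _ (BasicRepl.sq _)
  · obtain ⟨d, rfl⟩ := exists_sg h0
    obtain ⟨V, hV⟩ := exists_tripleRepl α β N e d f
    refine ⟨_, 1, _, C, _, BasicRepl.tripleFar N e d f V hV W hW, ?_, rfl⟩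
    rw [genPow_sg]
    simp only [mul_assoc, one_mul]

/-- The class of `tauN` of `x^e y^δ x^f` is given by a single straightening, whatever reductions `r` uses. -/
theorem condExp_eq {r : Word → FA R} (hr : IsReductionMap α β r) (m : ℕ) {e f : SignType}
    (he : e ≠ 0) (hf : f ≠ 0) (δ : SignType) :
    condExp α β u v (lastPow α β m) e δ f = cls α β (m + 2) (reidxA R m 0
      (tauN r u v 3 (w R (genPow 1 e * genPow 0 δ * genPow 1 f)))) := by
  obtain ⟨e, rfl⟩ := exists_sg he
  obtain ⟨f, rfl⟩ := exists_sg hf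
  have hW : genPow 1 (sg e) * genPow 0 δ * genPow 1 (sg f) =
      gen (0 + 1) e * (genPow 0 δ * 1) * gen (0 + 1) f * 1 := by
    rw [genPow_sg, genPow_sg, mul_one, mul_one]
  have hr1 : WordReduced α β (1 : Word) := wordReduced_of_length (by simp)
  rw [tauN_w, hW]
  have hinv := hr.eq_of_unique_step (p := fun W => InIdx (Rng m 0) W ∧ xc (0 + 1) W ≤ 1)
    (f := (phi (expC u v m) 0).comp (reidxA R m 0).toLinearMap)
    (wordStep_two (N := 0) e f δ (inIdx_one _) (fun _ => rfl) 1)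
    (fun Z hZ => hZ.eq_of_two (inIdx_one _) (fun _ => rfl)
      (wordReduced_of_length (by simpa using genPow_length_le 0 δ)) (inIdx_one _) hr1)
    (by rw [w_one, mul_one, mul_one]; exact straightFA_mem _ _ _ _ _)
    (phi_reidx_invariant (fun e k _ d a => by simp [expC_apply, mul_assoc]) (by simp) (by simp)
      (d := 1) (Or.inl le_rfl) 0)
  rw [← phi_expC hr hinv.1]
  have h2 := hinv.2
  simp only [LinearMap.comp_apply, AlgHom.toLinearMap_apply] at h2
  rw [h2, w_one, mul_one, mul_one, reidxA_straightFA, straightFA, straighten_map, condExp]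
  refine straighten_congr α β fun a h b => ?_
  have hxy : ∀ δ, xc (m + 1) (genPow m δ) = 0 := xc_genPow_ne (by omega)
  rw [phi_one (fun d a => expC_zero d a) (hxy _) (hxy _), expC_apply]
  rfl

theorem gen_mul_mem_S {i : ℕ} {W : Word} (h : W ∈ S i) (e : Bool) : gen i e * W ∈ S (i + 1) := by
  right
  simp only [Set.mem_iUnion, Finset.mem_Icc]
  rcases h with h | h
  · rw [Set.mem_singleton_iff] at h
    subst h
    refine ⟨i + 1, ⟨by omega, le_rfl⟩, ?_⟩
    change List.map _ _ = _
    rw [show i + 1 + 1 - (i + 1) = 1 by omega]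
    simp [gen]
  · simp only [Set.mem_iUnion, Finset.mem_Icc] at h
    obtain ⟨j, hj, h⟩ := h
    refine ⟨j, ⟨hj.1, by omega⟩, ?_⟩
    change List.map _ _ = _
    change List.map _ _ = _ at h
    rw [show i + 1 + 1 - j = (i + 1 - j) + 1 by omega, List.range'_concat, List.reverse_append,
      ← h]
    simp [gen]
    omega

theorem genPow_mul_mem_S {i : ℕ} {W : Word} (h : W ∈ S i) {e : SignType} (he : e = 0 → W = 1) :
    genPow i e * W ∈ S (i + 1) := by
  by_cases h0 : e = 0
  · rw [he h0, h0]
    exact one_mem_S _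
  · obtain ⟨b, rfl⟩ := exists_sg h0
    rw [genPow_sg]
    exact gen_mul_mem_S h b

theorem gen_mul_ne_one (i : ℕ) (e : Bool) (W : Word) : gen i e * W ≠ 1 := by
  intro h
  have := congrArg FreeMonoid.length h
  simp [gen, FreeMonoid.length_mul] at this

theorem wordReduced_pair (δ θ : SignType) :
    WordReduced α β (genPow 1 δ * genPow 0 θ) := by
  rintro ⟨Y, A, U, B, V, hU, h, rfl⟩
  have h1 := hU.two_le
  have h2 := congrArg FreeMonoid.length h
  simp only [FreeMonoid.length_mul] at h2
  have h3 := genPow_length_le 1 δ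
  have h4 := genPow_length_le 0 θ
  have hA : A = 1 := FreeMonoid.length_eq_zero.mp (by omega)
  have hB : B = 1 := FreeMonoid.length_eq_zero.mp (by omega)
  subst hA hB
  have hδ : δ ≠ 0 := by
    rintro rfl
    change 0 + _ = _ at h2
    omega
  have hθ : θ ≠ 0 := by
    rintro rfl
    change _ + 0 = _ at h2
    omega
  obtain ⟨d, rfl⟩ := exists_sg hδ
  obtain ⟨t, rfl⟩ := exists_sg hθ
  rw [genPow_sg, genPow_sg] at h
  have h5 := congrArg FreeMonoid.toList h
  clear h h1 h2 h3 h4 hδ hθ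
  cases hU <;> simp [gen] at h5 <;> omega

end Reindexed

end

end Funar

namespace Funar

noncomputable section

/-! ### Associativity of straightening from the vanishing of the associativity defects -/

section Assoc

variable {R : Type*} [CommRing R] {α β u v : R} {X : Type*} [AddCommGroup X] [Module R X] {m : ℕ}
  {C : SignType → K α β (m + 2) →ₗ[R] K α β (m + 2) →ₗ[R] X}
  {B : SignType → SignType → K α β (m + 2) →ₗ[R] K α β (m + 2) →ₗ[R] K α β (m + 2) →ₗ[R] X}

theorem reidx_genPow_one (m : ℕ) (e : SignType) : reidx m 1 (genPow 2 e) = genPow (m + 1) e ∧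
    reidx m 1 (genPow 1 e) = genPow m e ∧ reidx m 1 (genPow 0 e) = genPow (m - 1) e := by
  refine ⟨?_, ?_, ?_⟩ <;> rw [reidx_genPow] <;> congr 1 <;> omega

/-- The words `X₃ = x^e y^δ z^θ`, `X₂ = x^g y^η` and `X₁ = x^f`, in the last three generators, have an
associativity defect whose value compares both ways of straightening.
The first reduction of `X₃ X₂` and of `X₂ X₁` is forced to be a straightening, and all further ones
preserve the value, so that the choice of the reductions does not matter. -/
theorem IsTwoEval.assoc_of_defect {r : Word → FA R} (hr : IsReductionMap α β r)
    (h : IsTwoEval α β (lastPow α β m) (prevK α β m) C B)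
    (hv : ∀ Z ∈ assocDefects r, Z ∈ Sp R (InIdx (Rng m 1)) → phi C B (reidxA R m 1 Z) = 0)
    (e g f : Bool) {δ θ : SignType} (η : SignType) (hδ : δ = 0 → θ = 0) (hθ : m = 0 → θ = 0) :
    StraightAssoc α β (lastPow α β m) B (sg e) δ (sg g) η (sg f)
      (cls α β (m + 2) (w R (genPow (m - 1) θ))) 1 1 := by
  have i2 : ∀ e, InIdx (Rng m 1) (gen 2 e) := fun e => inIdx_gen.mpr ⟨by omega, by omega⟩
  have i1 : ∀ δ, InIdx (Rng m 1) (genPow 1 δ) := fun e => inIdx_genPow ⟨by omega, by omega⟩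
  have i0 : InIdx (Rng m 1) (genPow 0 θ) := by
    rcases Nat.eq_zero_or_pos m with hm | hm
    · rw [hθ hm]
      exact inIdx_one _
    · exact inIdx_genPow ⟨by omega, by omega⟩
  have hδ' : δ = 0 → genPow 0 θ = 1 := fun h0 => by rw [hδ h0]; rfl
  set X₃ : Word := gen 2 e * (genPow 1 δ * genPow 0 θ) with hX₃
  set X₂ : Word := gen 2 g * genPow 1 η with hX₂
  set X₁ : Word := gen 2 f with hX₁
  have j3 : InIdx (Rng m 1) X₃ := by simp only [hX₃, inIdx_mul]; exact ⟨i2 _, i1 _, i0⟩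
  have j2 : InIdx (Rng m 1) X₂ := by simp only [hX₂, inIdx_mul]; exact ⟨i2 _, i1 _⟩
  have j1 : InIdx (Rng m 1) X₁ := i2 _
  have x1 : ∀ δ, xc (1 + 1) (genPow 1 δ) = 0 := xc_genPow_ne (by omega)
  have x0 : ∀ δ, xc (1 + 1) (genPow 0 δ) = 0 := xc_genPow_ne (by omega)
  have x2 : ∀ e, xc (1 + 1) (gen 2 e) = 1 := xc_gen_self 2
  have y3 : xc (1 + 1) X₃ = 1 := by simp only [hX₃, xc_mul, x1, x0, x2]
  have y2 : xc (1 + 1) X₂ = 1 := by simp only [hX₂, xc_mul, x1, x2]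
  have y1 : xc (1 + 1) X₁ = 1 := x2 _
  have hdef := hv _ ⟨X₃, ⟨?_, gen_mul_ne_one _ _ _⟩, X₂, ⟨⟨gen 1 g * genPow 0 η, ?_, ?_⟩,
    gen_mul_ne_one _ _ _⟩, X₁, ⟨⟨gen 1 f, ⟨gen 0 f, ?_, rfl⟩, rfl⟩, ?_⟩, rfl⟩ ?_
  rotate_left
  · exact gen_mul_mem_S (genPow_mul_mem_S (W := genPow 0 θ) (i := 1) (by
      simpa using genPow_mul_mem_S (one_mem_S 0) (e := θ) fun _ => rfl) hδ') e
  · exact gen_mul_mem_S (by simpa using genPow_mul_mem_S (one_mem_S 0) (e := η) fun _ => rfl) g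
  · rw [map_mul, shWord_gen, shWord_genPow]
  · simpa using gen_mul_mem_S (one_mem_S 0) f
  · simpa using gen_mul_ne_one 2 f 1
  · obtain ⟨ha, hb⟩ := assocDefects_mem hr j1 j2 j3
    exact Submodule.sub_mem _ ha hb
  obtain ⟨Φ, hΦ⟩ : ∃ Φ : FA R →ₗ[R] X, ∀ Z, Φ Z = phi C B (reidxA R m 1 Z) :=
    ⟨(phi C B).comp (reidxA R m 1).toLinearMap, fun _ => rfl⟩
  have hinv : ∀ d ≤ 2, ∀ W Z, (InIdx (Rng m 1) W ∧ xc (1 + 1) W ≤ d) → WordStep α β W Z →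
      Z ∈ Sp R (fun W => InIdx (Rng m 1) W ∧ xc (1 + 1) W ≤ d) ∧ Φ Z = Φ (w R W) := by
    intro d hd W Z hW hs
    rw [hΦ, hΦ]
    exact phi_reidx_invariant h.c_mul h.b_left h.b_right (Or.inr ⟨hd, h⟩) 1 W Z hW hs
  have hlin : ∀ Y ∈ Sp R (fun W => InIdx (Rng m 1) W ∧ xc (1 + 1) W ≤ 2), Φ (lin r Y) = Φ Y := by
    intro Y hY
    refine Sp_eqOn (f := Φ.comp (lin r)) (g := Φ) (fun W hW => ?_) hY
    rw [LinearMap.comp_apply, lin_w]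
    exact (hr.invariant (hinv 2 le_rfl) hW).2
  have hstep : ∀ {A W D : Word} {Z : FA R}, WordStep α β W Z →
      WordStep α β (A * W * D) (w R A * Z * w R D) := by
    rintro A W D Z ⟨A', U, D', V, hUV, rfl, rfl⟩
    exact ⟨A * A', U, D' * D, V, hUV, by simp only [mul_assoc], by simp only [w_mul, mul_assoc]⟩
  -- Multiplication by `X₃` or `X₁` turns `Φ` into a functional on words with one letter `x`.
  have hinv' : ∀ A D : Word, InIdx (Rng m 1) A → InIdx (Rng m 1) D →
      xc (1 + 1) A + xc (1 + 1) D = 1 → ∀ W Z, (InIdx (Rng m 1) W ∧ xc (1 + 1) W ≤ 1) →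
      WordStep α β W Z → Z ∈ Sp R (fun W => InIdx (Rng m 1) W ∧ xc (1 + 1) W ≤ 1) ∧
        (Φ.comp ((LinearMap.mulRight R (w R D)).comp (LinearMap.mulLeft R (w R A)))) Z =
        (Φ.comp ((LinearMap.mulRight R (w R D)).comp (LinearMap.mulLeft R (w R A)))) (w R W) := by
    intro A D hA hD hx W Z hW hs
    refine ⟨(hinv 1 (by omega) W Z hW hs).1, ?_⟩
    simp only [LinearMap.comp_apply, LinearMap.mulRight_apply, LinearMap.mulLeft_apply, ← w_mul]
    refine (hinv 2 le_rfl _ _ ⟨?_, ?_⟩ (hstep hs)).2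
    · simp only [inIdx_mul]
      exact ⟨⟨hA, hW.1⟩, hD⟩
    · simp only [xc_mul]
      omega
  have hq1 : ∀ W : Word, InIdx (Rng m 1) W → r W ∈ Sp R fun W =>
      InIdx (Rng m 1) W ∧ xc (1 + 1) W ≤ 1 := fun W hW =>
    Sp_inf (hr.mem hW) (hr.top (hW.mono fun i hi => hi.2))
  have hred1 : ∀ δ, WordReduced α β (genPow 1 δ) := fun δ =>
    wordReduced_of_length (genPow_length_le 1 δ)
  have hwmul : ∀ {a b : Word}, InIdx (Rng m 1) a → InIdx (Rng m 1) b →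
      InIdx (Rng m 1) (a * b) := fun ha hb => inIdx_mul.mpr ⟨ha, hb⟩
  have l1 : Φ (lin r (lin r (w R (X₃ * X₂)) * w R X₁)) =
      Φ (straightFA α β 1 (sg e) δ (sg g) * w R (genPow 0 θ) * w R (genPow 1 η) * w R X₁) := by
    rw [lin_w, hlin _ (Sp_mul (fun a b ha hb => ⟨hwmul ha.1 hb.1, ?_⟩) (hq1 _ (hwmul j3 j2))
      (w_mem_Sp (p := fun W => InIdx (Rng m 1) W ∧ xc (1 + 1) W ≤ 1) ⟨j1, y1.le⟩))]
    · have h1 := (hr.eq_of_unique_step (W := X₃ * X₂)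
        (V := straightFA α β 1 (sg e) δ (sg g) * w R (genPow 0 θ) * w R (genPow 1 η)) ?_ ?_ ?_
        (hinv' 1 X₁ (inIdx_one _) j1 (by rw [y1]; rfl))).2
      · simpa only [LinearMap.comp_apply, LinearMap.mulRight_apply, LinearMap.mulLeft_apply, w_one,
          one_mul] using h1
      · rw [hX₃, hX₂, ← mul_assoc]
        exact wordStep_two (N := 1) e g δ (inIdx_genPow (by omega)) hδ' _
      · intro Z hZ
        rw [hX₃, hX₂, ← mul_assoc] at hZ
        exact hZ.eq_of_two (m := 1) (inIdx_genPow (by omega)) hδ' (wordReduced_pair δ θ)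
          (inIdx_genPow rfl) (hred1 η)
      · refine Sp_mul (p := fun W => InIdx (Rng m 1) W ∧ xc (1 + 1) W ≤ 1)
          (q := fun W => InIdx (Rng m 1) W ∧ xc (1 + 1) W = 0)
          (fun a b ha hb => ⟨hwmul ha.1 hb.1, ?_⟩)
          (Sp_mul (p := fun W => InIdx (Rng m 1) W ∧ xc (1 + 1) W ≤ 1)
            (q := fun W => InIdx (Rng m 1) W ∧ xc (1 + 1) W = 0)
            (fun a b ha hb => ⟨hwmul ha.1 hb.1, ?_⟩) (straightFA_mem m 1 _ _ _)
            (w_mem_Sp ⟨i0, x0 _⟩)) (w_mem_Sp ⟨i1 _, x1 _⟩)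
        · rw [xc_mul, hb.2]; exact ha.2
        · rw [xc_mul, hb.2]; exact ha.2
    · rw [xc_mul]
      have := ha.2
      have := hb.2
      omega
  have l2 : Φ (lin r (w R X₃ * lin r (w R (X₂ * X₁)))) =
      Φ (w R X₃ * straightFA α β 1 (sg g) η (sg f)) := by
    rw [lin_w, hlin _ (Sp_mul (fun a b ha hb => ⟨hwmul ha.1 hb.1, ?_⟩)
      (w_mem_Sp (p := fun W => InIdx (Rng m 1) W ∧ xc (1 + 1) W ≤ 1) ⟨j3, y3.le⟩)
      (hq1 _ (hwmul j2 j1)))]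
    · have e1 : X₂ * X₁ = gen (1 + 1) g * (genPow 1 η * 1) * gen (1 + 1) f * 1 := by
        rw [hX₂, hX₁, mul_one, mul_one]
      have h1 := (hr.eq_of_unique_step (W := X₂ * X₁)
        (V := straightFA α β 1 (sg g) η (sg f)) ?_ ?_ (straightFA_mem m 1 _ _ _)
        (hinv' X₃ 1 j3 (inIdx_one _) (by rw [y3]; rfl))).2
      · simpa only [LinearMap.comp_apply, LinearMap.mulRight_apply, LinearMap.mulLeft_apply, w_one,
          mul_one] using h1
      · rw [e1]
        exact wordStep_two (N := 1) g f η (inIdx_one _) (fun _ => rfl) _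
      · intro Z hZ
        rw [e1] at hZ
        have := hZ.eq_of_two (m := 1) (inIdx_one _) (fun _ => rfl) (by rw [mul_one]; exact hred1 η)
          (inIdx_one _) (wordReduced_of_length (by simp))
        rw [this, w_one, mul_one, mul_one]
    · rw [xc_mul]
      have := ha.2
      have := hb.2
      omega
  have z1 : ∀ δ, xc (m + 1) (genPow m δ) = 0 := xc_genPow_ne (by omega)
  have z0 : ∀ δ, xc (m + 1) (genPow (m - 1) δ) = 0 := xc_genPow_ne (by omega)
  rw [← hΦ, map_sub, l1, l2, sub_eq_zero, hΦ, hΦ] at hdef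
  simp only [map_mul (reidxA R m 1), reidxA_straightFA, reidxA_w] at hdef
  rw [straightFA, straightFA] at hdef
  have s1 := straighten_map α β ((phi C B).comp
    (LinearMap.mulRight R (w R (reidx m 1 (genPow 0 θ)) * w R (reidx m 1 (genPow 1 η)) *
      w R (reidx m 1 X₁)))) (sg e) δ (sg g)
    fun a h b => w R (genPow m a * genPow (m + 1) h * genPow m b)
  have s2 := straighten_map α β ((phi C B).comp
    (LinearMap.mulLeft R (w R (reidx m 1 X₃)))) (sg g) η (sg f)
    fun a h b => w R (genPow m a * genPow (m + 1) h * genPow m b)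
  simp only [LinearMap.comp_apply, LinearMap.mulRight_apply, LinearMap.mulLeft_apply,
    ← mul_assoc] at s1 s2
  rw [s1, s2] at hdef
  have t1 : reidx m 1 X₁ = genPow (m + 1) (sg f) := by
    rw [hX₁, ← genPow_sg, (reidx_genPow_one m _).1]
  have t3 : reidx m 1 X₃ = genPow (m + 1) (sg e) * (genPow m δ * genPow (m - 1) θ) := by
    rw [hX₃, ← genPow_sg, map_mul, map_mul, (reidx_genPow_one m _).1, (reidx_genPow_one m _).2.1,
      (reidx_genPow_one m _).2.2]
  unfold StraightAssoc
  refine (Eq.trans ?_ hdef).trans ?_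
  · refine straighten_congr α β fun a j b => ?_
    have : genPow m a * genPow (m + 1) j * genPow m b * reidx m 1 (genPow 0 θ) *
        reidx m 1 (genPow 1 η) * reidx m 1 X₁ = genPow m a * genPow (m + 1) j *
          (genPow m b * genPow (m - 1) θ * genPow m η) * genPow (m + 1) (sg f) * 1 := by
      rw [t1, (reidx_genPow_one m _).2.1, (reidx_genPow_one m _).2.2]
      simp only [mul_assoc, mul_one]
    rw [← w_mul, ← w_mul, ← w_mul, this, h.phi_two (z1 _) (by simp [z1, z0]) rfl, cls_one, one_mul,
      cls_mul, cls_mul]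
    rfl
  · refine straighten_congr α β fun a j b => ?_
    have : reidx m 1 X₃ * (genPow m a * genPow (m + 1) j * genPow m b) = 1 * genPow (m + 1) (sg e) *
        (genPow m δ * genPow (m - 1) θ * genPow m a) * genPow (m + 1) j * genPow m b := by
      rw [t3]
      simp only [mul_assoc, one_mul]
    rw [← w_mul, this, h.phi_two rfl (by simp [z1, z0]) (z1 _), cls_one, mul_one,
      cls_mul, cls_mul]
    rfl

end Assoc

end

end Funar

namespace Funar

noncomputable section

/-! ### Associativity of straightening with arbitrary outer factors -/

section AssocGeneral

variable {R : Type*} [CommRing R] {α β : R} {A : Type*} [Ring A] [Algebra R A]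
  {Y : SignType → A} {P : Subalgebra R A} {X : Type*} [AddCommGroup X] [Module R X]

/-- The functional on `a x^h d` given by the value of `C` on `a₀ a x^h d d₀`. -/
def shiftC (C : SignType → A →ₗ[R] A →ₗ[R] X) (d₀ a₀ : A) (h : SignType) : A →ₗ[R] A →ₗ[R] X :=
  (C h).compl₁₂ (LinearMap.mulRight R d₀) (LinearMap.mulLeft R a₀)

/-- The functional on `a x^e b x^f d` given by the value of `B` on `a₀ a x^e b x^f d d₀`. -/
def shiftB (B : SignType → SignType → A →ₗ[R] A →ₗ[R] A →ₗ[R] X) (d₀ a₀ : A) (e f : SignType) :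
    A →ₗ[R] A →ₗ[R] A →ₗ[R] X :=
  LinearMap.mk₂ R (fun b d => (B e f b (d * d₀)) ∘ₗ LinearMap.mulLeft R a₀)
    (fun b b' d => by ext; simp) (fun c b d => by ext; simp)
    (fun b d d' => by ext; simp [add_mul]) (fun c b d => by ext; simp)

@[simp] theorem shiftC_apply (C : SignType → A →ₗ[R] A →ₗ[R] X) (d₀ a₀ : A) (h : SignType)
    (d a : A) : shiftC C d₀ a₀ h d a = C h (d * d₀) (a₀ * a) := rfl

@[simp] theorem shiftB_apply (B : SignType → SignType → A →ₗ[R] A →ₗ[R] A →ₗ[R] X) (d₀ a₀ : A)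
    (e f : SignType) (b d a : A) : shiftB B d₀ a₀ e f b d a = B e f b (d * d₀) (a₀ * a) := rfl

theorem IsTwoEval.shift {C : SignType → A →ₗ[R] A →ₗ[R] X}
    {B : SignType → SignType → A →ₗ[R] A →ₗ[R] A →ₗ[R] X} (h : IsTwoEval α β Y P C B) (d₀ a₀ : A) :
    IsTwoEval α β Y P (shiftC C d₀ a₀) (shiftB B d₀ a₀) where
  c_zero d a := by
    simp only [shiftC_apply]
    rw [h.c_zero, h.c_zero (1 * d₀)]
    simp only [mul_assoc, one_mul]
  c_mul e k hk d a := by simp only [shiftC_apply, mul_assoc, h.c_mul e k hk]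
  b_left e f k hk b d a := by simp only [shiftB_apply, mul_assoc, h.b_left e f k hk]
  b_right e f k hk b d a := by simp only [shiftB_apply, mul_assoc, h.b_right e f k hk]
  zero_right e b d a := by simp only [shiftC_apply, shiftB_apply, mul_assoc, h.zero_right]
  zero_left f b d a := by simp only [shiftC_apply, shiftB_apply, mul_assoc, h.zero_left]
  mid e δ f d a := by simp only [shiftC_apply, shiftB_apply, mul_assoc, h.mid]

/-- The elements `k` for which the two straightenings agree form a submodule. -/
theorem straightAssoc_of_span {B : SignType → SignType → A →ₗ[R] A →ₗ[R] A →ₗ[R] X}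
    {e δ g η f : SignType} {d a k : A} {s : Set A} (hk : k ∈ Submodule.span R s)
    (h : ∀ k ∈ s, StraightAssoc α β Y B e δ g η f k d a) :
    StraightAssoc α β Y B e δ g η f k d a := by
  obtain ⟨F, hF⟩ : ∃ F : A →ₗ[R] X, ∀ k, F k =
      straighten α β e δ g (fun p h q => B h f (Y q * k * Y η) d (a * Y p)) :=
    ⟨straighten α β e δ g fun p h q => (((B h f).flip d).flip (a * Y p)).comp
      ((LinearMap.mulRight R (Y η)).comp (LinearMap.mulLeft R (Y q))), fun k => by
        rw [straighten_apply]; rfl⟩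
  obtain ⟨G, hG⟩ : ∃ G : A →ₗ[R] X, ∀ k, G k =
      straighten α β g η f (fun p h q => B e h (Y δ * k * Y p) (Y q * d) a) :=
    ⟨straighten α β g η f fun p h q => (((B e h).flip (Y q * d)).flip a).comp
      ((LinearMap.mulRight R (Y p)).comp (LinearMap.mulLeft R (Y δ))), fun k => by
        rw [straighten_apply]; rfl⟩
  have : Set.EqOn F G s := fun k hk => by
    rw [hF, hG]
    exact h k hk
  have := LinearMap.eqOn_span this hk
  rwa [hF, hG] at this

/-- Factors of `k` that commute with all powers of the second to last generator can be moved to the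
outside. -/
theorem IsTwoEval.assoc_of_mid {C : SignType → A →ₗ[R] A →ₗ[R] X}
    {B : SignType → SignType → A →ₗ[R] A →ₗ[R] A →ₗ[R] X} (h : IsTwoEval α β Y P C B)
    {e δ g η f : SignType} {k k₁ k₂ d a : A} (hk₁ : k₁ ∈ P) (hk₂ : k₂ ∈ P)
    (c₁ : ∀ δ, Commute k₁ (Y δ)) (c₂ : ∀ δ, Commute k₂ (Y δ))
    (hk : StraightAssoc α β Y B e δ g η f k (k₂ * d) (a * k₁)) :
    StraightAssoc α β Y B e δ g η f (k₁ * k * k₂) d a := by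
  unfold StraightAssoc at hk ⊢
  refine (Eq.trans ?_ hk).trans ?_
  · refine straighten_congr α β fun p j q => ?_
    rw [show Y q * (k₁ * k * k₂) * Y η = (Y q * k₁) * k * (k₂ * Y η) by simp only [mul_assoc],
      ← (c₁ q).eq, (c₂ η).eq, show k₁ * Y q * k * (Y η * k₂) = k₁ * (Y q * k * Y η * k₂) by
      simp only [mul_assoc], h.b_left _ _ _ hk₁, h.b_right _ _ _ hk₂, mul_assoc a,
      mul_assoc a, (c₁ p).eq]
  · refine straighten_congr α β fun p j q => ?_
    rw [show Y δ * (k₁ * k * k₂) * Y p = (Y δ * k₁) * k * (k₂ * Y p) by simp only [mul_assoc],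
      ← (c₁ δ).eq, (c₂ p).eq, show k₁ * Y δ * k * (Y p * k₂) = k₁ * (Y δ * k * Y p * k₂) by
      simp only [mul_assoc], h.b_left _ _ _ hk₁, h.b_right _ _ _ hk₂, ← mul_assoc k₂,
      (c₂ q).eq, mul_assoc (Y q)]

end AssocGeneral

section Assoc

variable {R : Type*} [CommRing R] {α β u v : R} {X : Type*} [AddCommGroup X] [Module R X] {m : ℕ}
  {C : SignType → K α β (m + 2) →ₗ[R] K α β (m + 2) →ₗ[R] X}
  {B : SignType → SignType → K α β (m + 2) →ₗ[R] K α β (m + 2) →ₗ[R] K α β (m + 2) →ₗ[R] X}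

theorem cls_commute_lastPow {W : Word} (h : InIdx (· + 1 < m) W) (δ : SignType) :
    Commute (cls α β (m + 2) (w R W)) (lastPow α β m δ) :=
  cls_commute_of_lt α β (m + 2) m h (inIdx_genPow le_rfl)

/-- `prevK` is spanned by the products `k₁ z^θ k₂`, where `z` is its last generator and `k₁, k₂`
commute with the last generator of `K (m + 2)`. -/
theorem prevK_span {r : Word → FA R} (hr : IsReductionMap α β r) {k : K α β (m + 2)}
    (hk : k ∈ prevK α β m) : k ∈ Submodule.span R {k | ∃ D θ E, InIdx (· + 1 < m) D ∧
      InIdx (· + 1 < m) E ∧ (m = 0 → θ = 0) ∧ k = cls α β (m + 2) (w R D) *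
        cls α β (m + 2) (w R (genPow (m - 1) θ)) * cls α β (m + 2) (w R E)} := by
  obtain ⟨k, rfl⟩ := hk
  have hk : k ∈ Submodule.span R {k | ∃ W, InIdx (fun i => i + 1 < m + 1) W ∧
      k = cls α β (m + 1) (w R W)} := by rw [span_cls]; trivial
  refine Submodule.span_induction (p := fun k _ => kMap α β (Nat.le_succ (m + 1)) k ∈
    Submodule.span R _) ?_ ?_ ?_ ?_ hk
  · rintro _ ⟨W, hW, rfl⟩
    rw [kMap_cls α β _ (w_mem_Sp hW)]
    rcases Nat.eq_zero_or_pos m with hm | hm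
    · subst hm
      obtain rfl := eq_one_of_inIdx (by simp) hW
      refine Submodule.subset_span ⟨1, 0, 1, inIdx_one _, inIdx_one _, fun _ => rfl, ?_⟩
      rw [show genPow (0 - 1) 0 = 1 from rfl, cls_one, mul_one, mul_one]
    · obtain ⟨j, rfl⟩ : ∃ j, m = j + 1 := ⟨m - 1, by omega⟩
      refine Submodule.span_mono ?_ (cls_mem_span_mid hr (n := j + 1 + 2) (j := j) (by omega)
        (hW.mono fun i hi => by omega))
      rintro _ ⟨D, E, θ, hD, hE, rfl⟩
      refine ⟨D, θ, E, hD.mono fun i hi => by omega, hE.mono fun i hi => by omega, by simp, ?_⟩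
      rw [cls_mul, cls_mul]
      rfl
  · rw [map_zero]
    exact Submodule.zero_mem _
  · intro x y _ _ hx hy
    rw [map_add]
    exact Submodule.add_mem _ hx hy
  · intro c x _ hx
    rw [map_smul]
    exact Submodule.smul_mem _ _ hx

/-- If all shifts of the functional vanish on the associativity defects, then straightening is
associative. -/
theorem IsTwoEval.straightAssoc {r : Word → FA R} (hr : IsReductionMap α β r)
    (h : IsTwoEval α β (lastPow α β m) (prevK α β m) C B)
    (hv : ∀ Z ∈ assocDefects r, Z ∈ Sp R (InIdx (Rng m 1)) → ∀ d a,
      phi (shiftC C d a) (shiftB B d a) (reidxA R m 1 Z) = 0)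
    (e δ g η f : SignType) {k : K α β (m + 2)} (hk : k ∈ prevK α β m) (d a : K α β (m + 2)) :
    StraightAssoc α β (lastPow α β m) B e δ g η f k d a := by
  by_cases h0 : e = 0 ∨ g = 0 ∨ f = 0
  · exact h.assoc_of_zero (lastPow_zero m) δ η h0 hk d a
  push Not at h0
  obtain ⟨he, hg, hf⟩ := h0
  obtain ⟨e, rfl⟩ := exists_sg he
  obtain ⟨g, rfl⟩ := exists_sg hg
  obtain ⟨f, rfl⟩ := exists_sg hf
  have core : ∀ θ, (δ = 0 → θ = 0) → (m = 0 → θ = 0) → ∀ d a,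
      StraightAssoc α β (lastPow α β m) B (sg e) δ (sg g) η (sg f)
        (cls α β (m + 2) (w R (genPow (m - 1) θ))) d a := by
    intro θ h1 h2 d a
    have := (h.shift d a).assoc_of_defect hr (fun Z hZ hZ' => hv Z hZ hZ' d a) e g f η h1 h2
    simpa only [StraightAssoc, shiftB_apply, one_mul, mul_one] using this
  refine straightAssoc_of_span (prevK_span hr hk) ?_
  rintro _ ⟨D, θ, E, hD, hE, hθ, rfl⟩
  refine h.assoc_of_mid (cls_mem_prevK (hD.mono fun i hi => by omega))
    (cls_mem_prevK (hE.mono fun i hi => by omega)) (cls_commute_lastPow hD)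
    (cls_commute_lastPow hE) ?_
  by_cases hδ : δ = 0
  · subst hδ
    have hz : cls α β (m + 2) (w R (genPow (m - 1) θ)) ∈ prevK α β m := by
      by_cases h0 : m = 0
      · rw [hθ h0, show genPow (m - 1) 0 = 1 from rfl, cls_one]
        exact one_mem _
      · exact cls_mem_prevK (inIdx_genPow (by omega))
    have h1 := core 0 (fun _ => rfl) (fun _ => rfl) (cls α β (m + 2) (w R E) * d)
      (a * cls α β (m + 2) (w R D) * cls α β (m + 2) (w R (genPow (m - 1) θ)))
    rw [show genPow (m - 1) 0 = 1 from rfl, cls_one] at h1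
    unfold StraightAssoc at h1 ⊢
    refine (Eq.trans ?_ h1).trans ?_
    · refine straighten_zero_mid_zero α β _ _ fun j => ?_
      rw [lastPow_zero, one_mul, one_mul, one_mul, h.b_left _ _ _ hz, mul_one, mul_one]
    · refine straighten_congr α β fun p j q => ?_
      rw [lastPow_zero, one_mul, one_mul, one_mul, h.b_left _ _ _ hz]
  · exact core θ (fun h0 => absurd h0 hδ) hθ _ _

end Assoc

end

end Funar

namespace Funar

noncomputable section

/-! ### Extension of Markov traces -/

section Vanishing

variable {R : Type*} [CommRing R] {α β u v : R} {X : Type*} [AddCommGroup X] [Module R X] {m : ℕ}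
  {r : Word → FA R}

/-- A trace on `K (m + 2)` which vanishes on the left ideal generated by `J4`, with the letters
reindexed in such a way that the last generators correspond to each other. -/
def VanishesOnJ (α β u v : R) (r : Word → FA R) (m : ℕ) (T : K α β (m + 2) →ₗ[R] X) : Prop :=
  ∀ Z ∈ J4 α β u v r, Z ∈ Sp R (InIdx fun i => 2 ≤ i + m) → ∀ c,
    T (c * cls α β (m + 2) (reidxA R m 2 Z)) = 0

theorem rhoX_mem_inIdx (hr : IsReductionMap α β r) {W : Word} (hW : InIdx (Rng m 2) W) {Z : FA R}
    (hZ : Z ∈ Sp R (InIdx (Rng m 1))) :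
    rhoX r u v W Z ∈ Sp R (InIdx fun i => 2 ≤ i + m) := by
  rw [rhoX_apply]
  refine Sp_mono (fun W hW => hW.mono fun i hi => hi.1) (tauN_mem hr (N := 3)
    (S := fun i => 2 ≤ i + m) (Sp_mul (p := InIdx (Rng m 2)) (q := InIdx (Rng m 2))
      (fun A B hA hB => ?_) (w_mem_Sp hW) (sh_mem ?_)))
  · exact inIdx_mul.mpr ⟨hA.mono fun i hi => ⟨hi.1, hi.2⟩, hB.mono fun i hi => ⟨hi.1, hi.2⟩⟩
  · exact Sp_mono (fun W hW => hW.mono fun i hi => ⟨by have := hi.1; omega, by have := hi.2; omega⟩) hZ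

theorem reidxA_sh_two (m : ℕ) (Z : FA R) : reidxA R m 2 (sh R Z) = reidxA R m 1 Z := by
  rw [reidxA_sh, reidxA_succ]

theorem mem_J4_xc (hr : IsReductionMap α β r) {Z : FA R} (hZ : Z ∈ J4 α β u v r)
    (hZ' : Z ∈ Sp R (InIdx (Rng m 1))) :
    Z ∈ Sp R fun W => InIdx (Rng m 1) W ∧ xc (1 + 1) W ≤ 1 := by
  have h := mem_redSub.mp (J4_le_redSub hr hZ)
  exact Sp_mono (fun W hW => ⟨hW.1, hW.2.xc_le_one (N := 2) (hW.1.mono fun i hi => hi.2)⟩)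
    (Sp_inf hZ' h.2)

variable {T : K α β (m + 2) →ₗ[R] X}
  {Θ : SignType → SignType → K α β (m + 2) →ₗ[R] K α β (m + 2) →ₗ[R] X}

/-- The closed value of `W * sh Z` is computed by `rhoX`, which preserves `J4`. -/
theorem IsTwoTrace.phi_close_eq_zero (hr : IsReductionMap α β r)
    (h : IsTwoTrace α β u v (lastPow α β m) (prevK α β m) T Θ) (hT : ∀ a b, T (a * b) = T (b * a))
    (hJ : VanishesOnJ α β u v r m T) {W : Word} (hW : W ∈ S 4) (hW' : InIdx (Rng m 2) W)
    (hx : xc 3 W ≤ 1) {Z : FA R} (hZ : Z ∈ J4 α β u v r) (hZ' : Z ∈ Sp R (InIdx (Rng m 1)))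
    (D : K α β (m + 2)) :
    phi (closeC u v T D) (closeB Θ D) (reidxA R m 2 (w R W * sh R Z)) = 0 := by
  rw [h.phi_eq_tauN hr hT D (N := 2)]
  · exact hJ _ (rhoX_mem_J4 hW hZ) (rhoX_mem_inIdx hr hW' hZ') D
  · have hsh : sh R Z ∈ Sp R fun W => InIdx (Rng m 2) W ∧ xc (2 + 1) W ≤ 1 := by
      refine Sp_map_le (f := (sh R).toLinearMap) (fun W hW => ?_) (mem_J4_xc hr hZ hZ')
      rw [AlgHom.toLinearMap_apply, sh_w]
      refine w_mem_Sp ⟨inIdx_sh.mpr (hW.1.mono fun i hi => ⟨by have := hi.1; omega, by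
        have := hi.2; omega⟩), ?_⟩
      have hs : ∀ W, xc (2 + 1) (shWord W) = xc (1 + 1) W := fun W => by
        induction W using word_induction with
        | h1 => rfl
        | h i e W ih =>
          rw [map_mul, xc_mul, xc_mul, ih, shWord_gen, xc_gen, xc_gen]
          congr 1
          by_cases hi : i = 2
          · rw [if_pos (by omega), if_pos (by omega)]
          · rw [if_neg (by omega), if_neg (by omega)]
      rw [hs]
      exact hW.2
    refine Sp_mul (p := fun W => InIdx (Rng m 2) W ∧ xc (2 + 1) W ≤ 1) (fun A B hA hB =>
      ⟨inIdx_mul.mpr ⟨hA.1, hB.1⟩, ?_⟩) (w_mem_Sp ⟨hW', hx⟩) hsh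
    rw [xc_mul]
    exact Nat.add_le_add hA.2 hB.2

theorem IsTwoTrace.phi_close_eq_zero' (hr : IsReductionMap α β r)
    (h : IsTwoTrace α β u v (lastPow α β m) (prevK α β m) T Θ) (hT : ∀ a b, T (a * b) = T (b * a))
    (hJ : VanishesOnJ α β u v r m T) {Z : FA R} (hZ : Z ∈ J4 α β u v r)
    (hZ' : Z ∈ Sp R (InIdx (Rng m 1))) (D : K α β (m + 2)) :
    phi (closeC u v T D) (closeB Θ D) (reidxA R m 1 Z) = 0 := by
  have := h.phi_close_eq_zero hr hT hJ (one_mem_S 4) (inIdx_one _) (Nat.zero_le _) hZ hZ' D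
  rwa [w_one, one_mul, reidxA_sh_two] at this

/-- Straightening is associative for words which are closed by `D`. -/
theorem IsTwoTrace.close_assoc (hr : IsReductionMap α β r)
    (h : IsTwoTrace α β u v (lastPow α β m) (prevK α β m) T Θ) (hT : ∀ a b, T (a * b) = T (b * a))
    (hJ : VanishesOnJ α β u v r m T) (D : K α β (m + 2)) (e δ g η f : SignType)
    {k : K α β (m + 2)} (hk : k ∈ prevK α β m) :
    StraightAssoc α β (lastPow α β m) (closeB Θ D) e δ g η f k 1 1 := by
  refine (h.isTwoEval hT D).straightAssoc hr (fun Z hZ hZ' d a => ?_) e δ g η f hk 1 1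
  have h1 : shiftC (closeC u v T D) d a = closeC u v T (d * D * a) := by
    funext j
    ext x y
    simp only [shiftC_apply, closeC_apply, mul_assoc]
  have h2 : shiftB (closeB Θ D) d a = closeB Θ (d * D * a) := by
    funext e f
    ext b x y
    simp only [shiftB_apply, closeB_apply, mul_assoc]
  rw [h1, h2]
  exact h.phi_close_eq_zero' hr hT hJ (assocDefects_subset_J4 hZ) hZ' _

/-- A descending word is the product of a word with letters among the last three generators and a
word which commutes with the last two generators. -/
theorem DescWord.exists_split {D : Word} (h : DescWord (m + 1) D) : ∃ W E, D = reidx m 2 W * E ∧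
    W ∈ S 3 ∧ InIdx (fun i => 2 ≤ i + m ∧ i < 3) W ∧ InIdx (· + 2 < m) E := by
  cases h with
  | one => exact ⟨1, 1, by simp, one_mem_S 3, inIdx_one _, inIdx_one _⟩
  | cons _ e D h =>
    cases h with
    | one =>
      refine ⟨gen 2 e * 1, 1, ?_, gen_mul_mem_S (one_mem_S 2) e, ?_, inIdx_one _⟩
      · simp only [reidx_gen, mul_one]
        rw [show 2 + m - 2 = m by omega]
      · simp only [inIdx_mul, inIdx_gen, inIdx_one]
        exact ⟨⟨by omega, by omega⟩, trivial⟩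
    | cons m e₁ D h =>
      cases h with
      | one =>
        refine ⟨gen 2 e * (gen 1 e₁ * 1), 1, ?_, gen_mul_mem_S (gen_mul_mem_S (one_mem_S 1) e₁) e, ?_,
          inIdx_one _⟩
        · simp only [map_mul, reidx_gen, mul_one]
          rw [show 2 + (m + 1) - 2 = m + 1 by omega, show 1 + (m + 1) - 2 = m by omega]
        · simp only [inIdx_mul, inIdx_gen, inIdx_one]
          exact ⟨⟨by omega, by omega⟩, ⟨by omega, by omega⟩, trivial⟩
      | cons m e₂ D h =>
        refine ⟨gen 2 e * (gen 1 e₁ * (gen 0 e₂ * 1)), D, ?_,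
          gen_mul_mem_S (gen_mul_mem_S (gen_mul_mem_S (one_mem_S 0) e₂) e₁) e, ?_,
          h.inIdx.mono fun i hi => by omega⟩
        · simp only [map_mul, reidx_gen, mul_one, mul_assoc]
          rw [show 2 + (m + 1 + 1) - 2 = m + 1 + 1 by omega,
            show 1 + (m + 1 + 1) - 2 = m + 1 by omega, show 0 + (m + 1 + 1) - 2 = m by omega]
        · simp only [inIdx_mul, inIdx_gen, inIdx_one]
          exact ⟨⟨by omega, by omega⟩, ⟨by omega, by omega⟩, ⟨by omega, by omega⟩, trivial⟩

variable {Ω : SignType → SignType → SignType →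
  K α β (m + 2) →ₗ[R] K α β (m + 2) →ₗ[R] K α β (m + 2) →ₗ[R] X}

/-- The value of `Z x^e' b'` with `Z` in `J4` is zero. By the cyclic property and after a decomposition
of `b'` as a sum of products `A D` with a descending word `D`, it is a closed value of `W * sh Z` with
`W` in `S 4`; the remaining letters of `D` commute with the letters of `Z`. -/
theorem IsThreeTrace.phi_act_eq_zero (hr : IsReductionMap α β r)
    (h : IsTwoTrace α β u v (lastPow α β m) (prevK α β m) T Θ) (hT : ∀ a b, T (a * b) = T (b * a))
    (hJ : VanishesOnJ α β u v r m T) {Z : FA R} (hZ : Z ∈ J4 α β u v r)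
    (hZ' : Z ∈ Sp R (InIdx (Rng m 1))) (a' b' : K α β (m + 2)) (e' : SignType) :
    phi (actC Θ a' e' b') (actB Ω a' e' b') (reidxA R m 1 Z) = 0 := by
  have hc : ∀ e' b' d a, actC Θ a' e' b' 0 d a = actC Θ a' e' b' 0 1 (a * d) := fun e' b' d a => by
    simp only [actC_apply, h.zero_left, one_mul]
    rw [mul_assoc, hT]
    simp only [mul_assoc]
  have hZx := mem_J4_xc hr hZ hZ'
  -- It suffices to compare values on words with at most one letter `x`.
  have key : ∀ (F : FA R →ₗ[R] X) (e' : SignType) (b' : K α β (m + 2)), F Z = 0 →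
      (∀ D e E, InIdx (Rng m 1) D → InIdx (Rng m 1) E → xc (1 + 1) D = 0 → xc (1 + 1) E = 0 →
        F (w R (D * genPow (1 + 1) e * E)) = Θ e e' (cls α β (m + 2) (w R (reidx m 1 E)) * a')
          (b' * cls α β (m + 2) (w R (reidx m 1 D)))) →
      phi (actC Θ a' e' b') (actB Ω a' e' b') (reidxA R m 1 Z) = 0 := by
    intro F e' b' h0 hF
    rw [← h0]
    refine Sp_eqOn (f := (phi (actC Θ a' e' b') (actB Ω a' e' b')).comp
      (reidxA R m 1).toLinearMap) (g := F) (fun W hW => ?_) hZx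
    obtain ⟨D, e, E, rfl, hD, hE⟩ := exists_genPow_split hW.2
    obtain ⟨h1, h2, h3⟩ := reidx_split hW.1 hD hE
    have h4 := hW.1
    simp only [inIdx_mul] at h4
    rw [hF _ _ _ h4.1.1 h4.2 hD hE]
    simp only [LinearMap.comp_apply, AlgHom.toLinearMap_apply, reidxA_w]
    rw [h1, phi_one (hc _ _) h2 h3, actC_apply]
  by_cases he : e' = 0
  · subst he
    have h2 := h.isTwoEval hT (a' * b')
    refine key ((phi (closeC u v T (a' * b')) (closeB Θ (a' * b'))).comp
      (reidxA R m 1).toLinearMap) 0 b' (h.phi_close_eq_zero' hr hT hJ hZ hZ' _)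
      fun D e E hiD hiE hD hE => ?_
    simp only [LinearMap.comp_apply, AlgHom.toLinearMap_apply, reidxA_w, map_mul (reidx m 1),
      reidx_genPow]
    rw [show 1 + 1 + m - 1 = m + 1 by omega, phi_one h2.c_zero (by rw [xc_reidx hiD, hD])
      (by rw [xc_reidx hiE, hE]), closeC_apply, h.zero_right _ _ _ hT]
    simp only [mul_assoc]
  obtain ⟨e', rfl⟩ := exists_sg he
  have hb : b' ∈ Submodule.span R {k | ∃ A D, InIdx (· + 1 < m + 1) A ∧ DescWord (m + 1) D ∧
      k = cls α β (m + 2) (w R (A * D))} := by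
    have hb : b' ∈ Submodule.span R {k | ∃ W, InIdx (fun i => i + 1 < m + 2) W ∧
      k = cls α β (m + 2) (w R W)} := by rw [span_cls]; trivial
    refine Submodule.span_le.mpr ?_ hb
    rintro _ ⟨W, hW, rfl⟩
    exact cls_mem_span_desc hr (by omega) (hW.mono fun i hi => by omega)
  have hval : ∀ b' : K α β (m + 2), ∃ F : FA R →ₗ[R] X,
      F = (phi (actC Θ a' (sg e') b') (actB Ω a' (sg e') b')).comp (reidxA R m 1).toLinearMap ∧
      ∀ D e E, InIdx (Rng m 1) D → InIdx (Rng m 1) E → xc (1 + 1) D = 0 → xc (1 + 1) E = 0 →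
        F (w R (D * genPow (1 + 1) e * E)) = Θ e (sg e')
          (cls α β (m + 2) (w R (reidx m 1 E)) * a')
          (b' * cls α β (m + 2) (w R (reidx m 1 D))) := by
    refine fun b' => ⟨_, rfl, fun D e E hiD hiE hD hE => ?_⟩
    simp only [LinearMap.comp_apply, AlgHom.toLinearMap_apply, reidxA_w, map_mul (reidx m 1),
      reidx_genPow]
    rw [show 1 + 1 + m - 1 = m + 1 by omega, phi_one (hc _ _) (by rw [xc_reidx hiD, hD])
      (by rw [xc_reidx hiE, hE]), actC_apply]
  induction hb using Submodule.span_induction with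
  | zero => exact key 0 _ _ rfl fun D e E _ _ _ _ => by simp
  | add x y _ _ hx hy =>
    obtain ⟨F, hF, hF'⟩ := hval x
    obtain ⟨G, hG, hG'⟩ := hval y
    refine key (F + G) _ _ ?_ fun D e E hiD hiE hD hE => ?_
    · rw [LinearMap.add_apply, hF, hG]
      simp only [LinearMap.comp_apply, AlgHom.toLinearMap_apply]
      rw [hx, hy, add_zero]
    · rw [LinearMap.add_apply, hF' _ _ _ hiD hiE hD hE, hG' _ _ _ hiD hiE hD hE, add_mul, map_add]
  | smul c x _ hx =>
    obtain ⟨F, hF, hF'⟩ := hval x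
    refine key (c • F) _ _ ?_ fun D e E hiD hiE hD hE => ?_
    · rw [LinearMap.smul_apply, hF]
      simp only [LinearMap.comp_apply, AlgHom.toLinearMap_apply]
      rw [hx, smul_zero]
    · rw [LinearMap.smul_apply, hF' _ _ _ hiD hiE hD hE, smul_mul_assoc, map_smul]
  | mem b' hb =>
    obtain ⟨A, D₀, hA, hD₀, rfl⟩ := hb
    obtain ⟨W, E₀, rfl, hW, hiW, hE₀⟩ := hD₀.exists_split
    set b₁ := cls α β (m + 2) (w R A) with hb₁
    set c := cls α β (m + 2) (w R E₀) with hc'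
    have kb : b₁ ∈ prevK α β m := cls_mem_prevK (hA.mono fun i hi => by omega)
    have kc : c ∈ prevK α β m := cls_mem_prevK (hE₀.mono fun i hi => by omega)
    have hxW : xc 3 W = 0 := xc_eq_zero_of hiW fun i hi => by omega
    have hiW' : InIdx (Rng m 2) W := hiW.mono fun i hi => ⟨hi.1, by omega⟩
    have h2 := h.isTwoEval hT (c * a' * b₁)
    refine key ((phi (closeC u v T (c * a' * b₁)) (closeB Θ (c * a' * b₁))).comp
      ((reidxA R m 2).toLinearMap.comp ((LinearMap.mulLeft R (w R (gen 3 e' * W))).comp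
        (sh R).toLinearMap))) _ _ ?_ fun D e E hiD hiE hD hE => ?_
    · refine h.phi_close_eq_zero hr hT hJ (gen_mul_mem_S hW e') ?_ ?_ hZ hZ' _
      · simp only [inIdx_mul, inIdx_gen]
        exact ⟨⟨by omega, by omega⟩, hiW'⟩
      · simp [hxW]
    · have hcomm : ∀ {D}, InIdx (Rng m 1) D →
          Commute c (cls α β (m + 2) (w R (reidx m 1 D))) := fun {D} hD =>
        cls_commute_of_lt α β (m + 2) (m - 1) (hE₀.mono fun i hi => by omega)
          (inIdx_reidx.mpr (hD.mono fun i hi => by have := hi.1; omega))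
      simp only [LinearMap.comp_apply, AlgHom.toLinearMap_apply, LinearMap.mulLeft_apply]
      rw [map_mul, reidxA_sh_two, reidxA_w, reidxA_w, ← w_mul, map_mul (reidx m 1),
        map_mul (reidx m 1), reidx_genPow, map_mul (reidx m 2), reidx_gen,
        show 1 + 1 + m - 1 = m + 1 by omega, show 3 + m - 2 = m + 1 by omega, ← genPow_sg,
        show genPow (m + 1) (sg e') * reidx m 2 W * (reidx m 1 D * genPow (m + 1) e * reidx m 1 E) =
          1 * genPow (m + 1) (sg e') * (reidx m 2 W * reidx m 1 D) * genPow (m + 1) e *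
            reidx m 1 E by simp only [mul_assoc, one_mul],
        h2.phi_two rfl (by rw [xc_mul, xc_reidx hiW', xc_reidx hiD, hxW, hD])
          (by rw [xc_reidx hiE, hE]), closeB_apply, cls_one, mul_one, cls_mul, cls_mul α β (m + 2) A,
          cls_mul,
        ← hb₁, ← hc', h.symm e]
      rw [mul_assoc b₁, h.mul_left _ _ _ kb, mul_assoc _ c, (hcomm hiD).eq, ← mul_assoc _ _ c,
        h.mul_right _ _ kc, ← mul_assoc c, ← mul_assoc c, (hcomm hiE).eq]
      simp only [mul_assoc]

/-- Straightening is associative for words which are followed by `a' x^e' b'`. -/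
theorem IsThreeTrace.act_assoc (hr : IsReductionMap α β r)
    (hΩ : IsThreeTrace (α := α) (β := β) (Y := lastPow α β m) (P := prevK α β m) Θ Ω)
    (h : IsTwoTrace α β u v (lastPow α β m) (prevK α β m) T Θ) (hT : ∀ a b, T (a * b) = T (b * a))
    (hJ : VanishesOnJ α β u v r m T) (a' : K α β (m + 2)) (e' : SignType) (b' : K α β (m + 2))
    (e δ g η f : SignType) {k : K α β (m + 2)} (hk : k ∈ prevK α β m) (d : K α β (m + 2)) :
    StraightAssoc α β (lastPow α β m) (actB Ω a' e' b') e δ g η f k d 1 := by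
  refine (hΩ.isTwoEval h hT a' e' b').straightAssoc hr (fun Z hZ hZ' d a => ?_) e δ g η f hk d 1
  have h1 : shiftC (actC Θ a' e' b') d a = actC Θ (d * a') e' (b' * a) := by
    funext j
    ext x y
    simp only [shiftC_apply, actC_apply, mul_assoc]
  have h2 : shiftB (actB Ω a' e' b') d a = actB Ω (d * a') e' (b' * a) := by
    funext e f
    ext b x y
    simp only [shiftB_apply, actB_apply, mul_assoc]
  rw [h1, h2]
  exact IsThreeTrace.phi_act_eq_zero hr h hT hJ (assocDefects_subset_J4 hZ) hZ' _ _ _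

/-- A trace on `K (m + 2)` which vanishes on `J4` and on `L` extends to a Markov trace on
`K (m + 3)`. -/
theorem exists_extension (hr : IsReductionMap α β r) (hT : ∀ a b, T (a * b) = T (b * a))
    (hJ : VanishesOnJ α β u v r m T)
    (hL : ∀ e f δ η, e ≠ 0 → f ≠ 0 → ∀ b ∈ prevK α β m, ∀ d ∈ prevK α β m,
      T (condExp α β u v (lastPow α β m) e δ f * b * (lastPow α β m η * d)) =
        T (lastPow α β m δ * b * (condExp α β u v (lastPow α β m) f η e * d))) :
    ∃ T' : K α β (m + 3) →ₗ[R] X, (∀ a b, T' (a * b) = T' (b * a)) ∧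
      (∀ a, T' (kMap α β (Nat.le_succ (m + 2)) a) = T a) ∧
      ∀ a e, T' (kMap α β (Nat.le_succ (m + 2)) a * sK α β (m + 3) (m + 1) e) =
        (bif e then u else v) • T a := by
  have hspan := span_sandwich (α := α) (β := β) hr m
  obtain ⟨Θ, hΘ⟩ := exists_isTwoTrace hspan (lastPow_zero m) hT hL
  obtain ⟨Ω, hΩ⟩ := exists_isThreeTrace hspan (lastPow_zero m) hT hΘ
    fun D e δ g η f k hk => hΘ.close_assoc hr hT hJ D e δ g η f hk
  obtain ⟨ρ, l, hl⟩ := exists_regAction hspan hΘ hΩ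
    fun a' e' b' e δ g η f k hk d => hΩ.act_assoc hr hΘ hT hJ a' e' b' e δ g η f hk d
  exact hl.exists_extension hr hΘ

end Vanishing

end

end Funar

namespace Funar

noncomputable section

open scoped TensorProduct

/-! ### Vanishing on `J4` and `L` -/

section Conditions

variable {R : Type*} [CommRing R] {α β u v : R} {X : Type*} [AddCommGroup X] [Module R X]
  {r : Word → FA R} {T : ∀ n, K α β n →ₗ[R] X}

theorem cls_induction {n : ℕ} {P : Submodule R (K α β n)}
    (h : ∀ W, InIdx (fun i => i + 1 < n) W → cls α β n (w R W) ∈ P) (c : K α β n) : c ∈ P := by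
  have hc : c ∈ Submodule.span R {k | ∃ W, InIdx (fun i => i + 1 < n) W ∧
      k = cls α β n (w R W)} := by rw [span_cls]; trivial
  refine Submodule.span_le.mpr ?_ hc
  rintro _ ⟨W, hW, rfl⟩
  exact h W hW

theorem sandwich_induction (hr : IsReductionMap α β r) {m : ℕ} {P : Submodule R (K α β (m + 2))}
    (h : ∀ a e b, kMap α β (Nat.le_succ (m + 1)) a * cls α β (m + 2) (w R (genPow m e)) *
      kMap α β (Nat.le_succ (m + 1)) b ∈ P) (c : K α β (m + 2)) : c ∈ P := by
  have hc : c ∈ Submodule.span R (Set.range (sandwich (lastPow α β m) (prevK α β m))) := by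
    rw [span_sandwich hr]; trivial
  refine Submodule.span_le.mpr ?_ hc
  rintro _ ⟨⟨⟨_, a, rfl⟩, e, ⟨_, b, rfl⟩⟩, rfl⟩
  exact h a e b

theorem mem_J4_lt (hr : IsReductionMap α β r) {Z : FA R} (hZ : Z ∈ J4 α β u v r) :
    Z ∈ Sp R (InIdx (· < 3)) :=
  Sp_mono (fun _ hW => hW.mono fun i hi => by omega) (mem_redSub.mp (J4_le_redSub hr hZ)).1

theorem IsReductionMap.map_one (hr : IsReductionMap α β r) : r 1 = w R 1 := by
  refine (hr.invariant (p := (· = 1)) (f := LinearMap.id) (fun W Y hW hs => ?_) rfl).2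
  subst hW
  exact (wordReduced_of_length (by simp) ⟨Y, hs⟩).elim

theorem IsReductionMap.tau_one (hr : IsReductionMap α β r) : tau r u v 4 (w R 1) = 1 := by
  have h : ∀ N, tauN r u v (N + 2) (w R 1) = w R 1 := fun N => by
    rw [tauN_w, hr.map_one, lin_w, tauWord_free r u v (xc_one N)]
  have h0 := h 0
  have h1 := h 1
  have h2 := h 2
  simp only [zero_add, Nat.reduceAdd] at h0 h1 h2
  have h3 : tauComp r u v 4 (w R 1) = w R 1 := by
    simp only [tauComp, LinearMap.comp_apply, Nat.reduceAdd, zero_add, h2, h1, h0,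
      LinearMap.id_apply]
  rw [tau, LinearMap.comp_apply, LinearMap.comp_apply, h3]
  simp [w_eq_single]

/-- On two strands `Z` is a polynomial in one generator, of index `2` before reindexing, and `rhoX` with
`X` a power of the generator of index `3` already closes all strands. -/
theorem IsMarkov.vanishesOnJ_zero (hr : IsReductionMap α β r) (h : IsMarkov α β u v T 2)
    (hJ : ∀ Z ∈ J4 α β u v r, Funar.tau r u v 4 Z • T 0 1 = 0) : VanishesOnJ α β u v r 0 (T 2) := by
  intro Z hZ hZ' c
  let P : Submodule R (K α β 2) := LinearMap.ker ((T 2).comp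
    (LinearMap.mulRight R (cls α β 2 (reidxA R 0 2 Z))))
  refine cls_induction (P := P) (fun W hW => ?_) c
  refine Submodule.span_le.mpr ?_ (cls_mem_span_mid hr (n := 2) (j := 0) (by omega)
    (hW.mono fun i hi => by omega))
  rintro _ ⟨A, B, e, hA, hB, rfl⟩
  obtain rfl := eq_one_of_inIdx (by simp) hA
  obtain rfl := eq_one_of_inIdx (by simp) hB
  change T 2 (_ * _) = 0
  have hX : genPow 3 e ∈ S 4 := by
    simpa using genPow_mul_mem_S (one_mem_S 3) (e := e) fun _ => rfl
  have hm : w R (genPow 3 e) * sh R Z ∈ Sp R (InIdx fun i => 3 ≤ i ∧ i < 3 + 1) := by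
    refine Sp_mul (fun A B hA hB => inIdx_mul.mpr ⟨hA, hB⟩)
      (w_mem_Sp (inIdx_genPow ⟨by omega, by omega⟩)) (sh_mem ?_)
    exact Sp_mono (fun W hW l hl => ⟨by have := hW.1 l hl; omega, by have := hW.2 l hl; omega⟩)
      (Sp_inf hZ' (mem_J4_lt hr hZ))
  have h1 := h.tauN hr (m := 0) (p := 5) (by norm_num) 1
    (Sp_mono (fun W hW => hW.mono fun i hi => ⟨by omega, by omega⟩) hm)
  have h2 : ∀ {Y}, Y ∈ Sp R (InIdx fun i => 3 ≤ i ∧ i < 3) →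
      T 1 (cls α β 1 (reidxA R 2 5 Y)) = Funar.tau r u v 4 Y • T 0 1 := by
    intro Y hY
    refine Sp_eqOn (f := (T 1).comp ((cls α β 1).toLinearMap.comp (reidxA R 2 5).toLinearMap))
      (g := (LinearMap.toSpanSingleton R X (T 0 1)).comp (Funar.tau r u v 4)) (fun W hW => ?_) hY
    obtain rfl := eq_one_of_inIdx (fun i hi => by omega) hW
    have h3 := h.compat 0 (by omega) 1
    rw [map_one] at h3
    rw [LinearMap.comp_apply, LinearMap.comp_apply, AlgHom.toLinearMap_apply,
      AlgHom.toLinearMap_apply, reidxA_w, map_one (reidx _ _), cls_one, LinearMap.comp_apply,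
      hr.tau_one, LinearMap.toSpanSingleton_apply, one_smul]
    exact h3
  rw [map_one, one_mul, one_mul, h2 (tauN_mem hr hm), ← rhoX_apply, hJ _ (rhoX_mem_J4 hX hZ),
    map_mul (reidxA _ _ _), reidxA_sh, reidxA_w, reidx_genPow, map_mul (cls _ _ _),
    reidxA_succ _ 4, reidxA_succ _ 3, reidxA_succ _ 2] at h1
  rw [one_mul, mul_one]
  exact h1

theorem DescWord.exists_split_S {m : ℕ} {D : Word} (h : DescWord (m + 2) D) :
    ∃ W E, D = reidx m 2 W * E ∧ W ∈ S 4 ∧ InIdx (Rng m 2) W ∧ InIdx (· + 2 < m) E := by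
  cases h with
  | one => exact ⟨1, 1, by simp, one_mem_S 4, inIdx_one _, inIdx_one _⟩
  | cons _ e D h =>
    obtain ⟨W, E, rfl, hW, hi, hE⟩ := h.exists_split
    refine ⟨gen 3 e * W, E, ?_, gen_mul_mem_S hW e, inIdx_mul.mpr ⟨inIdx_gen.mpr
      ⟨by omega, by omega⟩, hi.mono fun i hi => ⟨hi.1, by omega⟩⟩, hE⟩
    rw [map_mul, reidx_gen, show 3 + m - 2 = m + 1 by omega, mul_assoc]

/-- Every element is a combination of products `A D` with a descending word `D` whose first letters
form a word in `S 4`, so that closing the last strand is `rhoX` and the other letters of `D` commute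
with those of `Z`. -/
theorem IsMarkov.vanishesOnJ_succ (hr : IsReductionMap α β r) {m : ℕ}
    (h : IsMarkov α β u v T (m + 3)) (ih : VanishesOnJ α β u v r m (T (m + 2))) :
    VanishesOnJ α β u v r (m + 1) (T (m + 3)) := by
  intro Z hZ hZ' c
  let P : Submodule R (K α β (m + 3)) := LinearMap.ker ((T (m + 3)).comp
    (LinearMap.mulRight R (cls α β (m + 3) (reidxA R (m + 1) 2 Z))))
  refine cls_induction (P := P) (fun W hW => ?_) c
  refine Submodule.span_le.mpr ?_ (cls_mem_span_desc hr (n := m + 3) (j := m + 2) (by omega)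
    (hW.mono fun i hi => by omega))
  rintro _ ⟨A, D, hA, hD, rfl⟩
  obtain ⟨W, E, rfl, hW, hiW, hE⟩ := hD.exists_split_S
  change T (m + 3) (_ * _) = 0
  have hZr : Z ∈ Sp R (InIdx (Rng m 1)) :=
    Sp_mono (fun W hW l hl => ⟨by have := hW.1 l hl; omega, hW.2 l hl⟩)
      (Sp_inf hZ' (mem_J4_lt hr hZ))
  have h1 := h.tauN hr (m := m + 1) (p := 5) (by norm_num)
    (cls α β (m + 2) (w R E) * cls α β (m + 2) (w R A)) (X := w R W * sh R Z)
    (Sp_mul (p := InIdx (Rng m 2)) (q := InIdx (Rng m 2)) (fun A B hA hB => ?_) (w_mem_Sp hiW)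
      (sh_mem (Sp_mono (fun W hW => hW.mono fun i hi => ⟨by have := hi.1; omega, by
        have := hi.2; omega⟩) hZr)))
  · have h2 := ih _ (rhoX_mem_J4 hW hZ) (rhoX_mem_inIdx hr hiW hZr)
      (cls α β (m + 2) (w R E) * cls α β (m + 2) (w R A))
    rw [rhoX_apply, ← reidxA_succ m 2, ← reidxA_succ (m + 1) 3, ← reidxA_succ (m + 2) 4, ← h1,
      reidxA_succ _ 4, reidxA_succ _ 3, reidxA_succ _ 2, map_mul (reidxA R _ _), reidxA_sh_two,
      reidxA_w, map_mul (cls _ _ _), map_mul (kMap _ _ _),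
      kMap_cls α β _ (w_mem_Sp (hE.mono fun i hi => by omega)),
      kMap_cls α β _ (w_mem_Sp (hA.mono fun i hi => by omega))] at h2
    have hcomm : Commute (cls α β (m + 3) (w R E)) (cls α β (m + 3) (reidxA R m 1 Z)) := by
      have := Sp_eqOn (f := (LinearMap.mulLeft R (cls α β (m + 3) (w R E))).comp
        ((cls α β (m + 3)).toLinearMap.comp (reidxA R m 1).toLinearMap))
        (g := (LinearMap.mulRight R (cls α β (m + 3) (w R E))).comp
        ((cls α β (m + 3)).toLinearMap.comp (reidxA R m 1).toLinearMap)) (fun W hW => ?_) hZr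
      · exact this
      · simp only [LinearMap.comp_apply, AlgHom.toLinearMap_apply, reidxA_w,
          LinearMap.mulLeft_apply, LinearMap.mulRight_apply]
        exact (cls_commute_of_lt α β (m + 3) (m - 1) (hE.mono fun i hi => by omega)
          (inIdx_reidx.mpr (hW.mono fun i hi => by have := hi.1; omega))).eq
    rw [reidxA_succ m 1, cls_mul, cls_mul, mul_assoc, mul_assoc, hcomm.eq, ← mul_assoc,
      ← mul_assoc, h.trace _ le_rfl, ← h2]
    simp only [mul_assoc]
  · exact inIdx_mul.mpr ⟨hA.mono fun i hi => ⟨by have := hi.1; omega, by have := hi.2; omega⟩,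
      hB.mono fun i hi => ⟨by have := hi.1; omega, by have := hi.2; omega⟩⟩

/-- A Markov trace vanishes on `J4` if its initial value is killed by `tau(J4)`. -/
theorem IsMarkov.vanishesOnJ (hr : IsReductionMap α β r) :
    ∀ {m : ℕ}, IsMarkov α β u v T (m + 2) → (∀ Z ∈ J4 α β u v r, Funar.tau r u v 4 Z • T 0 1 = 0) →
      VanishesOnJ α β u v r m (T (m + 2))
  | 0, h, hJ => h.vanishesOnJ_zero hr hJ
  | _ + 1, h, hJ => h.vanishesOnJ_succ hr ((h.mono (by omega)).vanishesOnJ hr hJ)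

theorem pairT_add_left (m : ℕ) (b b' d : K α β (m + 1)) :
    pairT T m (b + b') d = pairT T m b d + pairT T m b' d :=
  TensorProduct.ext' fun p q => by
    simp only [pairT_tmul, LinearMap.add_apply, map_add, mul_add, add_mul]

theorem pairT_smul_left (m : ℕ) (a : R) (b d : K α β (m + 1)) :
    pairT T m (a • b) d = a • pairT T m b d :=
  TensorProduct.ext' fun p q => by
    simp only [pairT_tmul, LinearMap.smul_apply, map_smul, mul_smul_comm, smul_mul_assoc]

theorem pairT_add_right (m : ℕ) (b d d' : K α β (m + 1)) :
    pairT T m b (d + d') = pairT T m b d + pairT T m b d' :=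
  TensorProduct.ext' fun p q => by
    simp only [pairT_tmul, LinearMap.add_apply, map_add, mul_add]

theorem pairT_smul_right (m : ℕ) (a : R) (b d : K α β (m + 1)) :
    pairT T m b (a • d) = a • pairT T m b d :=
  TensorProduct.ext' fun p q => by
    simp only [pairT_tmul, LinearMap.smul_apply, map_smul, mul_smul_comm]

/-- The elements `b` for which `pairT T m b d Z` vanishes. -/
def pairKerLeft (T : ∀ n, K α β n →ₗ[R] X) (m : ℕ) (d : K α β (m + 1)) (Z : FA R ⊗[R] FA R) :
    Submodule R (K α β (m + 1)) where
  carrier := {b | pairT T m b d Z = 0}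
  add_mem' {a b} ha hb := by
    rw [Set.mem_ofPred_eq] at *
    rw [pairT_add_left, LinearMap.add_apply, ha, hb, add_zero]
  zero_mem' := by
    rw [Set.mem_ofPred_eq, ← zero_smul R (0 : K α β (m + 1)), pairT_smul_left, zero_smul,
      LinearMap.zero_apply]
  smul_mem' a b hb := by
    rw [Set.mem_ofPred_eq] at *
    rw [pairT_smul_left, LinearMap.smul_apply, hb, smul_zero]

/-- The elements `d` for which `pairT T m b d Z` vanishes. -/
def pairKerRight (T : ∀ n, K α β n →ₗ[R] X) (m : ℕ) (b : K α β (m + 1)) (Z : FA R ⊗[R] FA R) :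
    Submodule R (K α β (m + 1)) where
  carrier := {d | pairT T m b d Z = 0}
  add_mem' {a b} ha hb := by
    rw [Set.mem_ofPred_eq] at *
    rw [pairT_add_right, LinearMap.add_apply, ha, hb, add_zero]
  zero_mem' := by
    rw [Set.mem_ofPred_eq, ← zero_smul R (0 : K α β (m + 1)), pairT_smul_right, zero_smul,
      LinearMap.zero_apply]
  smul_mem' a b hb := by
    rw [Set.mem_ofPred_eq] at *
    rw [pairT_smul_right, LinearMap.smul_apply, hb, smul_zero]

/-- The outer factors of `b = a c a'` commute with the generator and can be moved to `d`. -/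
theorem IsMarkov.pairT_sandwich {m : ℕ} (h : IsMarkov α β u v T (m + 3)) (a b : K α β (m + 1))
    (c d : K α β (m + 2)) {Z : FA R ⊗[R] FA R} (hZ : Z ∈ N α β) :
    pairT T (m + 1) (kMap α β (Nat.le_succ (m + 1)) a * c * kMap α β (Nat.le_succ (m + 1)) b) d Z =
      pairT T (m + 1) c
        (kMap α β (Nat.le_succ (m + 1)) b * d * kMap α β (Nat.le_succ (m + 1)) a) Z := by
  refine (mem_N_induction (P := LinearMap.eqLocus (pairT T (m + 1) _ _)
    (pairT T (m + 1) _ _)) fun p hp q hq => ?_) hZ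
  rw [LinearMap.mem_eqLocus, pairT_tmul, pairT_tmul]
  have hc : ∀ {p : FA R}, p ∈ Sp R (InIdx (· < 1)) → ∀ a : K α β (m + 1),
      cls α β (m + 3) (reidxA R (m + 3) 2 p) * kMap α β (Nat.le_succ (m + 2))
        (kMap α β (Nat.le_succ (m + 1)) a) = kMap α β (Nat.le_succ (m + 2))
        (kMap α β (Nat.le_succ (m + 1)) a) * cls α β (m + 3) (reidxA R (m + 3) 2 p) := by
    intro p hp a
    rw [kMap_kMap α β (Nat.le_succ (m + 1)) (Nat.le_succ (m + 2))]
    obtain ⟨x, hx⟩ : ∃ x, x = kMap α β (show m + 1 ≤ m + 3 by omega) a := ⟨_, rfl⟩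
    have hk : ∀ i e, m + 1 ≤ i → x * cls α β (m + 3) (w R (genPow i e)) =
        cls α β (m + 3) (w R (genPow i e)) * x := fun i e hi => by
      rw [hx]
      exact (kMap_commute α β _ a hi e).eq
    rw [← hx]
    clear hx
    refine Sp_eqOn (f := (LinearMap.mulRight R x).comp
      ((cls α β (m + 3)).toLinearMap.comp (reidxA R (m + 3) 2).toLinearMap))
      (g := (LinearMap.mulLeft R x).comp
      ((cls α β (m + 3)).toLinearMap.comp (reidxA R (m + 3) 2).toLinearMap)) (fun W hW => ?_) hp
    simp only [LinearMap.comp_apply, AlgHom.toLinearMap_apply, reidxA_w, LinearMap.mulLeft_apply,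
      LinearMap.mulRight_apply]
    induction W using word_induction with
    | h1 => rw [map_one, cls_one, one_mul, mul_one]
    | h i e W ih =>
      simp only [inIdx_mul, inIdx_gen] at hW
      have hk := hk (i + (m + 3) - 2) (sg e) (by omega)
      rw [genPow_sg] at hk
      rw [map_mul, reidx_gen, cls_mul, mul_assoc, ih hW.2, ← mul_assoc, ← hk, mul_assoc]
  have h1 := hc hp a
  have h2 := hc hq b
  rw [map_mul (kMap _ _ _), map_mul (kMap _ _ _), map_mul (kMap _ _ _), map_mul (kMap _ _ _)]
  generalize cls α β (m + 3) (reidxA R (m + 3) 2 p) = p at *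
  generalize cls α β (m + 3) (reidxA R (m + 3) 2 q) = q at *
  generalize kMap α β (Nat.le_succ (m + 2)) (kMap α β (Nat.le_succ (m + 1)) a) = a at *
  generalize kMap α β (Nat.le_succ (m + 2)) (kMap α β (Nat.le_succ (m + 1)) b) = b at *
  generalize kMap α β (Nat.le_succ (m + 2)) c = c at *
  generalize kMap α β (Nat.le_succ (m + 2)) d = d at *
  have l1 : p * (a * c * b) * (q * d) = a * (p * c * (q * (b * d))) := by
    rw [← mul_assoc q, h2]
    simp only [← mul_assoc]
    rw [h1]
  rw [l1, h.trace _ le_rfl]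
  simp only [mul_assoc]

/-- A Markov trace vanishes on `L` if its initial value is killed by `tauTensor(L)`. -/
theorem IsMarkov.vanishesOnL (hr : IsReductionMap α β r)
    (hL : ∀ Z ∈ L α β u v r, tauTensor r u v Z • T 0 1 = 0) : ∀ {m : ℕ},
    IsMarkov α β u v T (m + 2) → ∀ Z ∈ L α β u v r, ∀ b d, pairT T m b d Z = 0 := by
  intro m
  induction m with
  | zero =>
    intro h Z hZ b d
    have h1 : ∀ W, InIdx (fun i => i + 1 < 0 + 1) W → cls α β (0 + 1) (w R W) = 1 := fun W hW => by
      rw [eq_one_of_inIdx (by simp) hW, cls_one]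
    refine cls_induction (P := pairKerLeft T 0 d Z) (fun W hW => ?_) b
    rw [h1 W hW]
    refine cls_induction (P := pairKerRight T 0 1 Z) (fun W hW => ?_) d
    rw [h1 W hW]
    exact (h.pairT_zero hr (L_le_N hr hZ)).trans (hL Z hZ)
  | succ m ih =>
    intro h Z hZ b d
    refine sandwich_induction hr (P := pairKerLeft T (m + 1) d Z) (fun a e a' => ?_) b
    refine (h.pairT_sandwich a a' _ d (L_le_N hr hZ)).trans ?_
    generalize kMap α β (Nat.le_succ (m + 1)) a' * d * kMap α β (Nat.le_succ (m + 1)) a = d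
    refine sandwich_induction hr (P := pairKerRight T (m + 1) _ Z) (fun d e' b => ?_) d
    exact (h.pairT_rhoDelta hr b d e' e (L_le_N hr hZ)).symm.trans
      (ih (h.mono (by omega)) _ (rhoDelta_mem_L _ _ hZ) b d)

/-- A Markov trace on `K (m + 2)` whose initial value is killed by `tau(J4)` and by `tauTensor(L)`
extends to `K (m + 3)`. -/
theorem IsMarkov.exists_extension (hr : IsReductionMap α β r) {m : ℕ}
    (h : IsMarkov α β u v T (m + 2)) (hJ : ∀ Z ∈ J4 α β u v r, Funar.tau r u v 4 Z • T 0 1 = 0)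
    (hL : ∀ Z ∈ L α β u v r, tauTensor r u v Z • T 0 1 = 0) :
    ∃ T' : K α β (m + 3) →ₗ[R] X, (∀ a b, T' (a * b) = T' (b * a)) ∧
      (∀ a, T' (kMap α β (Nat.le_succ (m + 2)) a) = T (m + 2) a) ∧
      ∀ a e, T' (kMap α β (Nat.le_succ (m + 2)) a * sK α β (m + 3) (m + 1) e) =
        (bif e then u else v) • T (m + 2) a := by
  refine Funar.exists_extension hr (h.trace _ le_rfl) (h.vanishesOnJ hr hJ) ?_
  rintro e f δ η he hf _ ⟨b, rfl⟩ _ ⟨d, rfl⟩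
  have h1 := h.vanishesOnL hr hL _ (pentagonDefects_subset_L ⟨e, δ, f, η, he, hf, rfl⟩) b d
  rw [map_sub, sub_eq_zero, pairT_tmul, pairT_tmul, reidxA_succ, reidxA_succ, reidxA_succ,
    reidxA_succ, reidxA_succ, reidxA_succ, reidxA_succ, reidxA_succ, ← condExp_eq hr m he hf,
    ← condExp_eq hr m hf he, reidxA_w, reidxA_w, reidx_genPow, reidx_genPow,
    show 0 + m - 0 = m by omega] at h1
  exact h1

end Conditions

end

end Funar

namespace Funar

noncomputable section

open scoped TensorProduct

section Existence

variable {R : Type*} [CommRing R] {α β u v : R} {X : Type*} [AddCommGroup X] [Module R X]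
  {r : Word → FA R}

/-! ### Existence of Markov traces -/

theorem sK_commute_self (α β : R) (n i : ℕ) (e f : Bool) : Commute (sK α β n i e) (sK α β n i f) := by
  cases e <;> cases f
  · exact Commute.refl _
  · exact (sK_mul_not α β n i false).trans (sK_mul_not α β n i true).symm
  · exact (sK_mul_not α β n i true).trans (sK_mul_not α β n i false).symm
  · exact Commute.refl _

/-- `K 2` is generated by one element and its inverse. -/
theorem K_two_commute (x y : K α β 2) : x * y = y * x := by
  have h : ∀ W, InIdx (fun i => i + 1 < 2) W → ∀ e, Commute (cls α β 2 (w R W)) (sK α β 2 0 e) := by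
    intro W hW e
    induction W using word_induction with
    | h1 => rw [cls_one]; exact Commute.one_left _
    | h i f W ih =>
      simp only [inIdx_mul, inIdx_gen] at hW
      obtain rfl : i = 0 := by omega
      rw [cls_mul, cls_gen]
      exact (sK_commute_self α β 2 0 f e).mul_left (ih hW.2)
  refine cls_induction (P := LinearMap.eqLocus (LinearMap.mulRight R y) (LinearMap.mulLeft R y))
    (fun W hW => ?_) x
  rw [LinearMap.mem_eqLocus, LinearMap.mulRight_apply, LinearMap.mulLeft_apply]
  refine cls_induction (P := LinearMap.eqLocus (LinearMap.mulLeft R _) (LinearMap.mulRight R _))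
    (fun W' hW' => ?_) y
  change cls α β 2 (w R W) * cls α β 2 (w R W') = cls α β 2 (w R W') * cls α β 2 (w R W)
  induction W' using word_induction with
  | h1 => rw [cls_one, one_mul, mul_one]
  | h i f W' ih =>
    simp only [inIdx_mul, inIdx_gen] at hW'
    obtain rfl : i = 0 := by omega
    rw [cls_mul, cls_gen]
    exact ((h W hW f).mul_right (ih hW'.2)).eq

/-- The left multiplication by the generator on `K 2`, in the basis formed by `1`, the generator and
its inverse. -/
def genMatrix (α β : R) : Matrix (Fin 3) (Fin 3) R := !![0, -β, 1; 1, α, 0; 0, 1, 0]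

/-- The inverse of `genMatrix`. -/
def genMatrixInv (α β : R) : Matrix (Fin 3) (Fin 3) R := !![0, 1, -α; 0, 0, 1; 1, 0, β]

/-- The regular representation of `K 2`. -/
theorem exists_regular_K_two (α β : R) : ∃ F : K α β 2 →ₐ[R] Matrix (Fin 3) (Fin 3) R,
    F (sK α β 2 0 true) = genMatrix α β ∧ F (sK α β 2 0 false) = genMatrixInv α β := by
  have h1 : genMatrix α β * genMatrixInv α β = 1 := by
    ext i j
    fin_cases i <;> fin_cases j <;>
      simp [genMatrix, genMatrixInv, Matrix.mul_apply, Fin.sum_univ_three]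
  have h2 : genMatrixInv α β * genMatrix α β = 1 := by
    ext i j
    fin_cases i <;> fin_cases j <;>
      simp [genMatrix, genMatrixInv, Matrix.mul_apply, Fin.sum_univ_three]
  obtain ⟨F, hF⟩ := exists_K_lift (α := α) (β := β) (n := 2)
    (fun _ => (⟨genMatrix α β, genMatrixInv α β, h1, h2⟩ : (Matrix (Fin 3) (Fin 3) R)ˣ))
    (fun i j h => absurd j.2 (by omega)) (fun i j h => absurd j.2 (by omega))
    (fun _ => by
      ext i j
      fin_cases i <;> fin_cases j <;>
        simp [genMatrix, genMatrixInv, Matrix.mul_apply, Fin.sum_univ_three, mul_comm,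
          neg_add_eq_sub])
    (fun _ h => absurd h (by omega))
  have := hF ⟨0, by omega⟩
  refine ⟨F, ?_, ?_⟩
  · simpa [sK, sigmaPow] using this.1
  · simpa [sK, sigmaPow] using this.2

/-- On at most two strands every initial value is possible, since `1, s, s⁻¹` are linearly independent in
`K 2`. -/
theorem exists_isMarkov_two (α β u v : R) (t : X) :
    ∃ T : ∀ n, K α β n →ₗ[R] X, IsMarkov α β u v T 2 ∧ T 0 1 = t := by
  obtain ⟨F, hF1, hF2⟩ := exists_regular_K_two α β
  let c : Matrix (Fin 3) (Fin 3) R →ₗ[R] R :=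
    Matrix.entryLinearMap R R 0 0 + u • Matrix.entryLinearMap R R 1 0 +
      v • Matrix.entryLinearMap R R 2 0
  let T₂ : K α β 2 →ₗ[R] X := (LinearMap.toSpanSingleton R X t).comp (c.comp F.toLinearMap)
  have hT₂ : ∀ k, T₂ k = (F k 0 0 + u * F k 1 0 + v * F k 2 0) • t := fun k => rfl
  -- Only the components with `n ≤ 2` matter; the other ones are set to zero.
  let T : ∀ n, K α β n →ₗ[R] X := fun n =>
    if h : n ≤ 2 then T₂.comp (kMap α β h).toLinearMap else 0
  have hT : ∀ n (h : n ≤ 2) k, T n k = T₂ (kMap α β h k) := fun n h k => by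
    simp only [T, dif_pos h]
    rfl
  have h2 : ∀ k : K α β 2, kMap α β (le_refl 2) k = k := fun k =>
    DirectedSystem.map_self (f := fun _ _ h => kMap α β h) k
  have h1 : T₂ 1 = t := by rw [hT₂, map_one]; simp
  refine ⟨T, ⟨fun j hj a b => ?_, fun j hj a => ?_, fun m hm a e => ?_⟩, ?_⟩
  · rw [hT j hj, hT j hj, map_mul (kMap _ _ _), K_two_commute, map_mul (kMap _ _ _)]
  · rw [hT _ hj, hT _ (by omega), kMap_kMap]
  · obtain rfl : m = 0 := by omega
    refine cls_induction (P := LinearMap.eqLocus ((T (0 + 2)).comp ((LinearMap.mulRight R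
      (sK α β (0 + 2) 0 e)).comp (kMap α β (Nat.le_succ (0 + 1))).toLinearMap))
      ((bif e then u else v) • T (0 + 1))) (fun W hW => ?_) a
    rw [eq_one_of_inIdx (by simp) hW, cls_one, LinearMap.mem_eqLocus]
    change T 2 (kMap α β (Nat.le_succ 1) 1 * sK α β 2 0 e) = (bif e then u else v) • T 1 1
    rw [hT 2 le_rfl, hT 1 (by omega), h2, map_one (kMap _ _ _), h1, one_mul, hT₂]
    cases e
    · simp [hF2, genMatrixInv]
    · simp [hF1, genMatrix]
  · rw [hT 0 (by omega), map_one, h1]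

/-- A value which is killed by `tau(J4)` and by `tauTensor(L)` is the initial value of a Markov trace on
any number of strands. -/
theorem exists_isMarkov (hr : IsReductionMap α β r) {t : X}
    (hJ : ∀ Z ∈ J4 α β u v r, tau r u v 4 Z • t = 0)
    (hL : ∀ Z ∈ L α β u v r, tauTensor r u v Z • t = 0) (m : ℕ) :
    ∃ T : ∀ n, K α β n →ₗ[R] X, IsMarkov α β u v T (m + 2) ∧ T 0 1 = t := by
  induction m with
  | zero => exact exists_isMarkov_two α β u v t
  | succ m ih =>
    obtain ⟨T, h, h0⟩ := ih
    obtain ⟨T', h1, h2, h3⟩ := h.exists_extension hr (h0 ▸ hJ) (h0 ▸ hL)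
    have hs : Function.update T (m + 3) T' (m + 3) = T' := Function.update_self ..
    have hn : ∀ n, n ≠ m + 3 → Function.update T (m + 3) T' n = T n := fun n hn =>
      Function.update_of_ne hn ..
    refine ⟨Function.update T (m + 3) T', ⟨fun j hj => ?_, fun j hj => ?_, fun j hj => ?_⟩, ?_⟩
    · rcases hj.eq_or_lt with rfl | hj'
      · rwa [hs]
      · rw [hn _ hj'.ne]
        exact h.trace j (by omega)
    · rcases hj.eq_or_lt with hj' | hj'
      · obtain rfl : j = m + 2 := by omega
        rw [hs, hn _ (by omega)]
        exact h2
      · rw [hn _ hj'.ne, hn _ (by omega)]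
        exact h.compat j (by omega)
    · rcases hj.eq_or_lt with hj' | hj'
      · obtain rfl : j = m + 1 := by omega
        rw [hs, hn _ (by omega)]
        exact h3
      · rw [hn _ hj'.ne, hn _ (by omega)]
        exact h.markov j (by omega)
    · rw [hn _ (by omega), h0]

/-- Markov traces are determined by their initial values. -/
theorem IsMarkov.eq (hr : IsReductionMap α β r) {T T' : ∀ n, K α β n →ₗ[R] X} {n : ℕ}
    (h : IsMarkov α β u v T n) (h' : IsMarkov α β u v T' n) (h0 : T 0 1 = T' 0 1) : T n = T' n := by
  refine LinearMap.ext fun k => ?_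
  refine cls_induction (P := LinearMap.eqLocus (T n) (T' n)) (fun W hW => ?_) k
  cases n with
  | zero => rw [eq_one_of_inIdx (by simp) hW, cls_one]; exact h0
  | succ n => exact (h.tau hr (w_mem_Sp hW)).trans (by rw [h0, h'.tau hr (w_mem_Sp hW)])

/-- A value `t` which is killed by `tau(J4)` and by `tauTensor(L)` is the initial value of a
homomorphism on the target of the universal Markov trace. -/
theorem exists_markovModule_hom (hr : IsReductionMap α β r) {t : X}
    (hJ : ∀ Z ∈ J4 α β u v r, tau r u v 4 Z • t = 0)
    (hL : ∀ Z ∈ L α β u v r, tauTensor r u v Z • t = 0) :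
    ∃ φ : MarkovModule α β u v →ₗ[R] X, φ (univT α β u v 0 1) = t := by
  choose S hS hS0 using exists_isMarkov hr hJ hL
  have hu : ∀ {m m' j}, j ≤ m + 2 → j ≤ m' + 2 → S m j = S m' j := fun {m m' j} h h' =>
    ((hS m).mono h).eq hr ((hS m').mono h') ((hS0 m).trans (hS0 m').symm)
  let T : ∀ n, K α β n →ₗ[R] X := fun n => S n n
  have hT : ∀ {m j}, j ≤ m + 2 → T j = S m j := fun h => hu (by omega) h
  have hc : ∀ i j (hij : i ≤ j) x, T j (kMap α β hij x) = T i x := by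
    intro i j hij
    induction j, hij using Nat.le_induction with
    | base =>
      intro x
      rw [show kMap α β (le_refl i) x = x from
        DirectedSystem.map_self (f := fun _ _ h => kMap α β h) x]
    | succ j hij ih =>
      intro x
      rw [← ih, ← kMap_kMap α β hij (Nat.le_succ j), hT (m := j) (j := j + 1) (by omega),
        (hS j).compat j (by omega)]
  let Φ : KInf α β →ₗ[R] X :=
    DirectLimit.Module.lift R ℕ (fun n => K α β n) (fun _ _ h => kMap α β h) T hc
  have hΦ : ∀ n x, Φ (ofK α β n x) = T n x := fun n x => rfl
  have hmarkov : ∀ m (x : K α β (m + 1)) e,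
      Φ (ofK α β (m + 1) x * sGen α β m e) = (bif e then u else v) • Φ (ofK α β (m + 1) x) := by
    intro m x e
    rw [sGen_eq, ← ofK_kMap α β (Nat.le_succ (m + 1)) x, ← ofK_mul, hΦ, hΦ, hc,
      hT (m := m) (j := m + 2) le_rfl, (hS m).markov m le_rfl,
      hT (m := m) (j := m + 1) (by omega)]
  refine ⟨Submodule.liftQ _ Φ (Submodule.span_le.mpr ?_), ?_⟩
  · rintro _ (⟨n, x, y⟩ | ⟨m, x⟩ | ⟨m, x⟩)
    · change Φ _ = 0
      rw [map_sub, ← ofK_mul, ← ofK_mul, hΦ, hΦ, (hS n).trace n (by omega), sub_self]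
    · change Φ _ = 0
      rw [map_sub, hmarkov, map_smul, cond_true, sub_self]
    · change Φ _ = 0
      rw [map_sub, hmarkov, map_smul, cond_false, sub_self]
  · exact hS0 0

/-- The target of the universal Markov trace is generated by the class of `1`. -/
theorem exists_smul_univT (hr : IsReductionMap α β r) (x : MarkovModule α β u v) :
    ∃ a : R, x = a • univT α β u v 0 1 := by
  obtain ⟨x, rfl⟩ := Submodule.mkQ_surjective _ x
  induction x using DirectLimit.induction with
  | _ n x =>
    obtain ⟨a, ha⟩ := (univT_isMarkov α β u v (n + 1)).exists_smul hr (kMap α β (Nat.le_succ n) x)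
    refine ⟨a, ha ▸ ?_⟩
    exact ((univT_isMarkov α β u v (n + 1)).compat n le_rfl x).symm

/-- The annihilator of the target of the universal Markov trace, for arbitrary parameters. -/
theorem annihilator_markovModule (hr : IsReductionMap α β r) :
    Module.annihilator R (MarkovModule α β u v) =
      (J4 α β u v r).map (tau r u v 4) ⊔ (L α β u v r).map (tauTensor r u v) := by
  set I : Submodule R R := (J4 α β u v r).map (tau r u v 4) ⊔ (L α β u v r).map (tauTensor r u v)
    with hI
  have hJI : ∀ Z ∈ J4 α β u v r, tau r u v 4 Z ∈ I := fun Z hZ =>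
    Submodule.mem_sup_left (Submodule.mem_map_of_mem hZ)
  have hLI : ∀ Z ∈ L α β u v r, tauTensor r u v Z ∈ I := fun Z hZ =>
    Submodule.mem_sup_right (Submodule.mem_map_of_mem hZ)
  have hmk : ∀ a : R, a • (Submodule.Quotient.mk 1 : R ⧸ I) = 0 ↔ a ∈ I := fun a => by
    rw [← Submodule.Quotient.mk_smul, Submodule.Quotient.mk_eq_zero, smul_eq_mul, mul_one]
  refine le_antisymm (fun a ha => ?_) ?_
  · obtain ⟨φ, hφ⟩ := exists_markovModule_hom hr (t := (Submodule.Quotient.mk 1 : R ⧸ I))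
      (fun Z hZ => (hmk _).mpr (hJI Z hZ)) (fun Z hZ => (hmk _).mpr (hLI Z hZ))
    rw [← hmk, ← hφ, ← map_smul, Module.mem_annihilator.mp ha, map_zero]
  · have hU := univT_isMarkov α β u v
    have key : ∀ a : R, a • univT α β u v 0 1 = 0 →
        a ∈ Module.annihilator R (MarkovModule α β u v) := fun a ha =>
      Module.mem_annihilator.mpr fun x => by
        obtain ⟨b, rfl⟩ := exists_smul_univT hr x
        rw [smul_comm, ha, smul_zero]
    refine sup_le ?_ ?_
    · rintro _ ⟨Z, hZ, rfl⟩
      refine key _ ?_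
      rw [← (hU 4).tau hr (mem_redSub.mp (J4_le_redSub hr hZ)).1]
      have := IsMarkov.J4_eq_zero hr hU hZ 0 1
      rwa [one_mul, zero_add, reidxA_self] at this
    · rintro _ ⟨Z, hZ, rfl⟩
      refine key _ ?_
      rw [← (hU 2).pairT_zero hr (L_le_N hr hZ)]
      exact IsMarkov.L_eq_zero hr hU hZ 0 1 1

end Existence

end

end Funar

theorem theorem2p4 {k : Type*} [CommRing k] [Nontrivial k] (α β : k)
    (r : Funar.Word → Funar.FA (Funar.A k))
    (hr : Funar.IsReductionMap (Funar.c α) (Funar.c β) r) :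
    Funar.traceIdeal α β =
      (Funar.J4 (Funar.c α) (Funar.c β) (Funar.u k) (Funar.v k) r).map
          (Funar.tau r (Funar.u k) (Funar.v k) 4) ⊔
        (Funar.L (Funar.c α) (Funar.c β) (Funar.u k) (Funar.v k) r).map
          (Funar.tauTensor r (Funar.u k) (Funar.v k)) :=
  Funar.annihilator_markovModule hr
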